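/- Let $X=\mathfrak a_{\mathbb Z}^*$ be the weight lattice of a (reduced) root datum with simple roots $\alpha_1,\dots,\alpha_n$, simple coroots $\alpha_i^\vee$, positive roots $R^+$, $\rho=\frac12\sum_{\alpha\in R^+}\alpha$, finite Weyl group $W_0$ with longest element $w_0$, and dot action $w\circ\lambda=w(\lambda+\rho)-\rho$. Put $\lambda^*=-w_0\lambda$, $X^+=\{\lambda\in X\mid\langle\lambda+\rho,\alpha_i^\vee\rangle>0\text{ for all }i\}$, $\mathbb K=\mathbb Z[t^{1/2},t^{-1/2}]$, and fix $\ell\in\mathbb Z_{>0}$. The abstract Fock space $\mathcal F_\ell$ is the $\mathbb K$-module generated by $|\lambda\rangle$, $\lambda\in X$, with the following relations for each simple root $\alpha_i$, where $m=\langle\lambda+\rho,\alpha_i^\vee\rangle$: $|\lambda\rangle=0$ if $m=0$; $|s_i\circ\lambda\rangle=-|\lambda\rangle$ if $m\in\ell\mathbb Z_{\ge0}$; $|s_i\circ\lambda\rangle=-t^{1/2}|\lambda\rangle$ if $0<m<\ell$; and $|s_i\circ\lambda\rangle=-t^{1/2}|s_i\circ\lambda^{(1)}\rangle-|\lambda^{(1)}\rangle-t^{1/2}|\lambda\rangle$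 with $\lambda^{(1)}=\lambda-j\alpha_i$ if $m=k\ell+j$, $k>0$, $0<j<\ell$. The bar involution on $\mathcal F_\ell$ is the additive map with $\overline{t^{1/2}}=t^{-1/2}$ and $\overline{|\lambda\rangle}=(-1)^{|R^+|}(t^{-1/2})^{|R^+|-N_\lambda}|w_0\circ\lambda\rangle$, where $N_\lambda=\#\{\alpha\in R^+\mid\langle\lambda+\rho,\alpha^\vee\rangle\in\ell\mathbb Z\}$. The ring $\mathbb K[X]^{W_0}$ acts on $\mathcal F_\ell$ by the action induced from $X^\mu\cdot|\gamma\rangle=|\ell\mu^*+\gamma\rangle$, and $s_\lambda\in\mathbb K[X]^{W_0}$ is the Weyl character, determined by $s_\lambda\sum_{w}\det(w)X^{w\circ0}=\sum_w\det(w)X^{w\circ\lambda}$. Then $\{|\mu\rangle\mid\mu\in X^+\}$ is a $\mathbb K$-basis of $\mathcal F_\ell$; for every $\lambda\in X^+$ the Weyl character $s_\lambda$ exists and is unique; and for every $\lambda\in X^+$ there is a unique $C_{\ell\lambda}\in\mathcal F_\ell$ with $\overline{C_{\ell\lambda}}=C_{\ell\lambda}$ and $C_{\ell\lambda}=|\ell\lambda\rangle+\sum_{\mu\in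 X^+,\,\mu\ne\ell\lambda}p_{\ell\lambda,\mu}|\mu\rangle$, $p_{\ell\lambda,\mu}\in t^{1/2}\mathbb Z[t^{1/2}]$ (with $p_{\ell\lambda,\ell\lambda}=1$). Define $Q^\lambda_{\mu,\nu}$ by $s_{\lambda^*}\cdot|\nu\rangle=\sum_{\mu\in X^+}Q^\lambda_{\mu,\nu}|\mu\rangle$. Then $$C_0=|0\rangle,\qquad C_{\ell\lambda}=s_{\lambda^*}\cdot C_0=s_{\lambda^*}\cdot|0\rangle,\qquad p_{\ell\lambda,\mu}=Q^\lambda_{\mu,0}\qquad(\lambda,\mu\in X^+).$$ Consequently the two families of LLT polynomials agree up to a power of $t$, as formal (possibly infinite) $\mathbb K$-linear combinations of the $s_\lambda$, $\lambda\in X^+$. Let $W=\{t_\mu w\mid\mu\in X,\ w\in W_0\}$ be the extended affine Weyl group, acting on $X$ by $(t_\mu w)\circ\lambda=w\circ\lambda-\ell\mu$, with length $\ell(t_\mu w)=\sum_{\alpha\in R^+,\,w^{-1}\alpha>0}|\langle\mu,\alpha^\vee\rangle|+\sum_{\alpha\in R^+,\,w^{-1}\alpha<0}|\langle\mu,\alpha^\vee\rangle-1|$.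 Let $\eta\in X$ have stabilizer $W_\eta\subseteq W$ equal to the Weyl group of a standard Levi subgroup $L$ (generated by some of the $s_i$), let $\beta,\gamma\in X$, let $\mu,\nu\in X^+$ with $\mu\in W_0\circ(\eta+\ell\beta)$ and $\nu\in W_0\circ(\eta+\ell\gamma)$, and let $v\in W_0t_\beta W_\eta$ and $w\in W_0t_\gamma W_\eta$ be elements of minimal length. For a function $\xi\mapsto l_\xi\in\mathbb Z_{\ge0}$ on $X$ put $$\mathcal L_{L,\beta,\gamma}=t^{\,l_{\beta-\gamma}+\ell(w)-\ell(v)}\sum_{\lambda\in X^+}Q^\lambda_{\mu,\nu}s_\lambda,\qquad G^\ell_\mu=\sum_{\lambda\in X^+}p_{\ell\lambda,\mu}s_\lambda$$ (Grojnowski–Haiman's polynomial for their choice of the normalizing integers $l_\xi$, and Lecouvey's polynomial). If $\nu=0$, then, for every choice of the integers $l_\xi$, $$\mathcal L_{L,\beta,\gamma}=t^{\,l_{\beta-\gamma}+\ell(w)-\ell(v)}\,G^\ell_\mu .$$ -/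

import Mathlib

noncomputable section

set_option linter.unusedSectionVars false

namespace FockSpace

/-- The coefficient ring `𝕂 = ℤ[t^{1/2}, t^{-1/2}]`; the Laurent variable `T 1` is `t^{1/2}`. -/
abbrev KK : Type := LaurentPolynomial ℤ

/-- `tHalf n = (t^{1/2})^n`. -/
def tHalf (n : ℤ) : KK := LaurentPolynomial.T n

/-- The ring automorphism of `𝕂` with `t^{1/2} ↦ t^{-1/2}`. -/
def barKK : KK →+* KK := (LaurentPolynomial.invert : KK ≃ₐ[ℤ] KK).toAlgHom.toRingHom

section Weights

variable {ι X Y : Type*} [Fintype ι] [AddCommGroup X] [AddCommGroup Y]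
  {P : RootDatum ι X Y} (b : P.Base)

/-- The set `R⁺` of (indices of) positive roots. -/
def posRoots : Finset ι := by
  classical exact Finset.univ.filter fun i => b.IsPos i

lemma mem_posRoots {i : ι} : i ∈ posRoots b ↔ b.IsPos i := by
  classical simp [posRoots]

/-- `2ρ`, the sum of the positive roots. -/
def twoRho : X := ∑ i ∈ posRoots b, P.root i

/-- The integer `⟨ρ, αᵢ^∨⟩`, where `ρ` is half the sum of the positive roots
(the division is exact, see `two_mul_rhoPairing`). -/
def rhoPairing (i : ι) : ℤ := P.coroot' i (twoRho b) / 2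

/-- The integer `⟨λ + ρ, αᵢ^∨⟩`. -/
def shiftedPairing (lam : X) (i : ι) : ℤ := P.coroot' i lam + rhoPairing b i

/-- The positive roots `α` for which `w⁻¹ α` is negative. -/
def inversions (w : P.weylGroup) : Finset ι := by
  classical exact (posRoots b).filter fun i => ¬ b.IsPos (w⁻¹ • i)

/-- The length `ℓ(w)` of an element of the finite Weyl group. -/
def length (w : P.weylGroup) : ℕ := (inversions b w).card

/-- The dot action `w ∘ λ = w(λ + ρ) - ρ`, written inside the lattice by means of
`ρ - wρ = ∑ α` over the positive roots `α` with `w⁻¹ α` negative (see `two_smul_dot`). -/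
def dot (w : P.weylGroup) (lam : X) : X := w • lam - ∑ i ∈ inversions b w, P.root i

lemma mem_inversions {w : P.weylGroup} {i : ι} :
    i ∈ inversions b w ↔ b.IsPos i ∧ ¬ b.IsPos (w⁻¹ • i) := by
  classical simp [inversions, mem_posRoots]

lemma root_smul (w : P.weylGroup) (i : ι) : P.root (w • i) = w • P.root i :=
  RootPairing.Equiv.root_indexEquiv_eq_smul (P := P) i (w : P.Aut)

lemma ofIdx_smul_idx (i j : ι) :
    RootPairing.weylGroup.ofIdx P i • j = P.reflectionPerm i j := rfl

lemma ofIdx_smul_wt (i : ι) (x : X) :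
    RootPairing.weylGroup.ofIdx P i • x = x - P.coroot' i x • P.root i :=
  P.reflection_apply i x

lemma pairing_smul (w : P.weylGroup) (x : X) (i : ι) :
    P.coroot' (w • i) (w • x) = P.coroot' i x := by
  obtain ⟨g, hg⟩ := w
  induction hg using RootPairing.weylGroup.induction generalizing i x with
  | mem j =>
    change P.coroot' (P.reflectionPerm j i) (P.reflection j x) = _
    rw [RootPairing.coroot'_reflection]
    simp
  | one => rfl
  | mul g₁ g₂ h₁ h₂ ih₁ ih₂ => exact (ih₁ (g₂ • x) (g₂ • i)).trans (ih₂ x i)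

/-- The index of the root `-αᵢ`. -/
def negIdx (P : RootDatum ι X Y) (i : ι) : ι := P.reflectionPerm i i

lemma root_neg (i : ι) : P.root (negIdx P i) = - P.root i := by
  simp [negIdx]

lemma negIdx_negIdx (i : ι) : negIdx P (negIdx P i) = i := by
  apply P.root.injective; simp [root_neg]

lemma isPos_neg (i : ι) : b.IsPos (negIdx P i) ↔ ¬ b.IsPos i :=
  RootPairing.Base.IsPos.neg_iff_not b i

lemma smul_negIdx (w : P.weylGroup) (i : ι) :
    w • negIdx P i = negIdx P (w • i) := by
  apply P.root.injective
  simp [root_smul, root_neg]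

lemma ofIdx_smul_self (i : ι) : RootPairing.weylGroup.ofIdx P i • i = negIdx P i := rfl

lemma ofIdx_smul_smul (i j : ι) :
    RootPairing.weylGroup.ofIdx P i • RootPairing.weylGroup.ofIdx P i • j = j := by
  simp [ofIdx_smul_idx]

lemma ofIdx_inv (i : ι) :
    (RootPairing.weylGroup.ofIdx P i)⁻¹ = RootPairing.weylGroup.ofIdx P i :=
  Subtype.ext (RootPairing.Equiv.reflection_inv P i)

lemma coroot'_neg (i : ι) (x : X) : P.coroot' (negIdx P i) x = - P.coroot' i x := by
  have h := pairing_smul (RootPairing.weylGroup.ofIdx P i)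
    (RootPairing.weylGroup.ofIdx P i • x) i
  have h2 : RootPairing.weylGroup.ofIdx P i • RootPairing.weylGroup.ofIdx P i • x = x := by
    rw [← mul_smul]; nth_rewrite 1 [← ofIdx_inv]; simp
  rw [h2, ofIdx_smul_self, ofIdx_smul_wt] at h
  rw [h, map_sub, map_smul]
  have : P.coroot' i (P.root i) = 2 := P.root_coroot_two i
  rw [this, smul_eq_mul]; ring

lemma twoRho_sub (w : P.weylGroup) :
    twoRho b - w • twoRho b = 2 • ∑ i ∈ inversions b w, P.root i := by
  classical
  have key : w • twoRho b = ∑ j ∈ Finset.univ.filter (fun j => b.IsPos (w⁻¹ • j)), P.root j := by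
    rw [twoRho, Finset.smul_sum]
    refine Finset.sum_bij (fun i _ => w • i) ?_ ?_ ?_ ?_
    · intro i hi; simpa [mem_posRoots] using hi
    · intro i _ j _ h; exact MulAction.injective w h
    · intro j hj; exact ⟨w⁻¹ • j, by simpa [mem_posRoots] using hj, by simp⟩
    · intro i _; rw [root_smul]
  have h1 : twoRho b = ∑ j ∈ (posRoots b).filter (fun j => b.IsPos (w⁻¹ • j)), P.root j
      + ∑ j ∈ inversions b w, P.root j := by
    rw [twoRho, inversions, Finset.sum_filter_add_sum_filter_not]
  have h2 : ∑ j ∈ Finset.univ.filter (fun j => b.IsPos (w⁻¹ • j)), P.root j =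
      ∑ j ∈ (posRoots b).filter (fun j => b.IsPos (w⁻¹ • j)), P.root j
      + ∑ j ∈ Finset.univ.filter (fun j => b.IsPos (w⁻¹ • j) ∧ ¬ b.IsPos j), P.root j := by
    rw [← Finset.sum_filter_add_sum_filter_not
      (Finset.univ.filter (fun j => b.IsPos (w⁻¹ • j))) (fun j => b.IsPos j)]
    congr 1
    · apply Finset.sum_congr _ (fun _ _ => rfl)
      ext j; simp [mem_posRoots, and_comm]
    · rw [Finset.filter_filter]
  have h3 : ∑ j ∈ Finset.univ.filter (fun j => b.IsPos (w⁻¹ • j) ∧ ¬ b.IsPos j), P.root j =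
      - ∑ j ∈ inversions b w, P.root j := by
    rw [← Finset.sum_neg_distrib]
    refine Finset.sum_bij (fun i _ => negIdx P i) ?_ ?_ ?_ ?_
    · intro i hi
      simp only [Finset.mem_filter, Finset.mem_univ, true_and] at hi
      simp [mem_inversions, smul_negIdx, isPos_neg, hi.1, hi.2]
    · intro i _ j _ h
      simpa [negIdx_negIdx] using congrArg (negIdx P) h
    · intro j hj
      rw [mem_inversions] at hj
      refine ⟨negIdx P j, ?_, negIdx_negIdx j⟩
      simp [smul_negIdx, isPos_neg, hj.1, hj.2]
    · intro i _; simp [root_neg]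
  rw [key, h2, h3, h1, two_smul]
  abel

/-- The dot action satisfies `2 (w ∘ λ) = w(2λ + 2ρ) - 2ρ`. -/
lemma two_smul_dot (w : P.weylGroup) (lam : X) :
    2 • dot b w lam = w • (2 • lam + twoRho b) - twoRho b := by
  have h := twoRho_sub b w
  rw [dot, smul_sub, ← h, smul_add, smul_comm]
  abel

lemma torsionFree (P : RootDatum ι X Y) {x y : X} (h : 2 • x = 2 • y) : x = y := by
  have : Module.IsReflexive ℤ X := .of_isPerfPair P.toLinearMap
  have h' : (2 : ℤ) • x = (2 : ℤ) • y := by simpa [two_smul] using h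
  exact smul_right_injective X (two_ne_zero (α := ℤ)) h'

lemma dot_mul (u w : P.weylGroup) (lam : X) : dot b (u * w) lam = dot b u (dot b w lam) := by
  apply torsionFree P
  rw [two_smul_dot, two_smul_dot, two_smul_dot, mul_smul]
  simp

lemma dot_one (lam : X) : dot b (1 : P.weylGroup) lam = lam := by
  apply torsionFree P
  rw [two_smul_dot, one_smul]
  abel

lemma dot_ofIdx_dot_ofIdx (i : ι) (lam : X) : dot b (RootPairing.weylGroup.ofIdx P i)
    (dot b (RootPairing.weylGroup.ofIdx P i) lam) = lam := by
  rw [← dot_mul]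
  nth_rewrite 1 [← ofIdx_inv]
  rw [inv_mul_cancel, dot_one]

lemma dot_add (w : P.weylGroup) (x y : X) : dot b w (x + y) = dot b w x + w • y := by
  simp only [dot, smul_add]; abel

variable [P.IsReduced]

lemma inversions_ofIdx {i : ι} (hi : i ∈ b.support) :
    inversions b (RootPairing.weylGroup.ofIdx P i) = {i} := by
  have hip := RootPairing.Base.isPos_of_mem_support hi
  ext j
  rw [mem_inversions, Finset.mem_singleton, ofIdx_inv]
  constructor
  · rintro ⟨h1, h2⟩
    by_contra hne
    exact h2 (h1.reflectionPerm hi hne)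
  · rintro rfl
    exact ⟨hip, by rw [ofIdx_smul_self, isPos_neg]; simpa using hip⟩

lemma coroot'_twoRho {i : ι} (hi : i ∈ b.support) : P.coroot' i (twoRho b) = 2 := by
  have h := twoRho_sub b (RootPairing.weylGroup.ofIdx P i)
  rw [inversions_ofIdx b hi, ofIdx_smul_wt] at h
  have h2 := congrArg (P.coroot' i) h
  have : P.coroot' i (P.root i) = 2 := P.root_coroot_two i
  simp only [sub_sub_cancel, map_smul, Finset.sum_singleton, map_nsmul, this, smul_eq_mul] at h2
  simp only [mul_comm _ (2 : ℤ), nsmul_eq_mul] at h2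
  push_cast at h2
  linarith

lemma two_mul_rhoPairing (i : ι) : 2 * rhoPairing b i = P.coroot' i (twoRho b) := by
  apply Int.mul_ediv_cancel'
  have h := b.coroot_mem_span_int i
  change (2 : ℤ) ∣ P.toLinearMap (twoRho b) (P.coroot i)
  generalize P.coroot i = y at h ⊢
  induction h using Submodule.span_induction with
  | mem y hy =>
    obtain ⟨j, hj, rfl⟩ := hy
    exact ⟨1, by simpa using coroot'_twoRho b hj⟩
  | zero => simp
  | add x y _ _ hx hy => rw [map_add]; exact dvd_add hx hy
  | smul a x _ hx => rw [map_smul, smul_eq_mul]; exact Dvd.dvd.mul_left hx a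

lemma rhoPairing_simple {i : ι} (hi : i ∈ b.support) : rhoPairing b i = 1 := by
  have := two_mul_rhoPairing b i
  rw [coroot'_twoRho b hi] at this
  linarith

lemma two_mul_shiftedPairing (lam : X) (i : ι) :
    2 * shiftedPairing b lam i = P.coroot' i (2 • lam + twoRho b) := by
  rw [shiftedPairing, mul_add, two_mul_rhoPairing, map_add, map_nsmul]
  simp

lemma shiftedPairing_dot (w : P.weylGroup) (lam : X) (i : ι) :
    shiftedPairing b (dot b w lam) (w • i) = shiftedPairing b lam i := by
  have h : 2 * shiftedPairing b (dot b w lam) (w • i) = 2 * shiftedPairing b lam i := by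
    rw [two_mul_shiftedPairing, two_mul_shiftedPairing, two_smul_dot, sub_add_cancel, pairing_smul]
  linarith

lemma shiftedPairing_neg (lam : X) (i : ι) :
    shiftedPairing b lam (negIdx P i) = - shiftedPairing b lam i := by
  have h : 2 * shiftedPairing b lam (negIdx P i) = 2 * - shiftedPairing b lam i := by
    rw [two_mul_shiftedPairing, mul_neg, two_mul_shiftedPairing, coroot'_neg]
  linarith

lemma shiftedPairing_dot_ofIdx (lam : X) (i : ι) :
    shiftedPairing b (dot b (RootPairing.weylGroup.ofIdx P i) lam) i =
      - shiftedPairing b lam i := by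
  have h := shiftedPairing_dot b (RootPairing.weylGroup.ofIdx P i) lam (negIdx P i)
  rwa [smul_negIdx, ofIdx_smul_self, negIdx_negIdx, shiftedPairing_neg] at h

lemma shiftedPairing_add (x y : X) (i : ι) :
    shiftedPairing b (x + y) i = shiftedPairing b x i + P.coroot' i y := by
  simp only [shiftedPairing, map_add]; ring

lemma dot_ofIdx {i : ι} (hi : i ∈ b.support) (lam : X) :
    dot b (RootPairing.weylGroup.ofIdx P i) lam = lam - shiftedPairing b lam i • P.root i := by
  rw [dot, inversions_ofIdx b hi, ofIdx_smul_wt, Finset.sum_singleton, shiftedPairing,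
    rhoPairing_simple b hi, add_smul, one_smul]
  abel

end Weights

section Longest

variable {ι X Y : Type*} [Fintype ι] [AddCommGroup X] [AddCommGroup Y]
  {P : RootDatum ι X Y} (b : P.Base)

/-- The Weyl group of a root datum is finite: it acts faithfully on the roots. -/
instance finite_weylGroup : Finite P.weylGroup := by
  have hfaith : Function.Injective (P.weylGroupToPerm) := by
    rw [injective_iff_map_eq_one]
    intro w hw
    have hidx : ∀ i : ι, w • i = i := fun i => DFunLike.congr_fun hw i
    have hspan : ∀ x : X, w • x - x ∈ P.rootSpan ℤ := by
      obtain ⟨g, hg⟩ := w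
      clear hw hidx
      induction hg using RootPairing.weylGroup.induction with
      | mem j =>
        intro x
        change P.reflection j x - x ∈ _
        rw [RootPairing.reflection_apply, sub_sub_cancel_left]
        exact neg_mem (Submodule.smul_mem _ _ (Submodule.subset_span ⟨j, rfl⟩))
      | one => intro x; change x - x ∈ _; simp
      | mul g₁ g₂ h₁ h₂ ih₁ ih₂ =>
        intro x
        have : (⟨g₁ * g₂, mul_mem h₁ h₂⟩ : P.weylGroup) • x - x =
          ((⟨g₁, h₁⟩ : P.weylGroup) • ((⟨g₂, h₂⟩ : P.weylGroup) • x)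
            - ((⟨g₂, h₂⟩ : P.weylGroup) • x)) + ((⟨g₂, h₂⟩ : P.weylGroup) • x - x) := by
          rw [sub_add_sub_cancel]; rfl
        rw [this]
        exact add_mem (ih₁ _) (ih₂ _)
    have hfix : ∀ x : X, w • x = x := by
      intro x
      have hker : w • x - x ∈ LinearMap.ker P.RootForm := by
        rw [LinearMap.mem_ker]
        ext y
        have h0 : ∀ i, P.coroot' i (w • x - x) = 0 := by
          intro i
          have := pairing_smul w x i
          rw [hidx] at this
          rw [map_sub, this, sub_self]
        have h1 : ∀ i, P.toLinearMap (w • x) (P.coroot i) - P.toLinearMap x (P.coroot i) = 0 := by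
          intro i; simpa using h0 i
        simp [RootPairing.RootForm, h1]
      have := (Submodule.disjoint_def.mp P.disjoint_rootSpan_ker_rootForm) _ (hspan x) hker
      exact sub_eq_zero.mp this
    apply Subtype.ext
    apply RootPairing.Equiv.weightHom_injective P
    ext x
    exact hfix x
  exact Finite.of_injective _ hfaith

instance fintype_weylGroup : Fintype P.weylGroup := Fintype.ofFinite _

/-- The longest element `w₀` of the finite Weyl group: an element of maximal length. -/
def longest : P.weylGroup := Classical.choose (Finite.exists_max (length b))

lemma length_le_longest (w : P.weylGroup) : length b w ≤ length b (longest b) :=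
  Classical.choose_spec (Finite.exists_max (length b)) w

/-- `λ* = -w₀ λ`. -/
def star (lam : X) : X := -(longest b • lam)

variable [P.IsReduced]

lemma longest_inv_neg {i : ι} (hi : b.IsPos i) : ¬ b.IsPos ((longest b)⁻¹ • i) := by
  classical
  set w := longest b with hw
  have hsimple : ∀ i ∈ b.support, ¬ b.IsPos (w⁻¹ • i) := by
    intro i hi hpos
    have hip := RootPairing.Base.isPos_of_mem_support hi
    set s := RootPairing.weylGroup.ofIdx P i with hs
    have hsub : insert i ((inversions b w).image (fun j => s • j)) ⊆ inversions b (s * w) := by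
      intro k hk
      rw [mem_inversions, mul_inv_rev, mul_smul, hs, ofIdx_inv]
      rcases Finset.mem_insert.mp hk with rfl | hk
      · refine ⟨hip, ?_⟩
        rw [ofIdx_smul_self, smul_negIdx, isPos_neg]
        simpa using hpos
      · obtain ⟨j, hj, rfl⟩ := Finset.mem_image.mp hk
        rw [mem_inversions] at hj
        have hne : j ≠ i := by rintro rfl; exact hj.2 hpos
        refine ⟨hj.1.reflectionPerm hi hne, ?_⟩
        rw [hs, ofIdx_smul_smul]
        exact hj.2
    have hnot : i ∉ (inversions b w).image (fun j => s • j) := by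
      intro h
      obtain ⟨j, hj, hji⟩ := Finset.mem_image.mp h
      rw [mem_inversions] at hj
      have : j = negIdx P i := by
        rw [← ofIdx_smul_self, ← hs, ← hji]
        exact (ofIdx_smul_smul i j).symm
      rw [this, isPos_neg] at hj
      exact hj.1 hip
    have hcard := Finset.card_le_card hsub
    rw [Finset.card_insert_of_notMem hnot,
      Finset.card_image_of_injective _ (MulAction.injective s)] at hcard
    have := length_le_longest b (s * w)
    rw [← hw] at this
    simp only [length] at this
    omega
  refine hi.induction_on_add (p := fun i => ¬ b.IsPos (w⁻¹ • i)) hsimple ?_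
  intro i j k hk h1 hj
  have h2 := hsimple j hj
  rw [← isPos_neg] at h1 h2 ⊢
  refine h1.add h2 ?_
  simp only [root_neg, root_smul, hk, smul_add]
  abel

lemma longest_neg {i : ι} (hi : b.IsPos i) : ¬ b.IsPos (longest b • i) := by
  intro h
  have := longest_inv_neg b h
  rw [inv_smul_smul] at this
  exact this hi

lemma height_le_of_pos (w : P.weylGroup) (hw : ∀ i, b.IsPos i → ¬ b.IsPos (w • i))
    {i : ι} (hi : b.IsPos i) : b.height i ≤ b.height (negIdx P (w • i)) := by
  have hs : ∀ i ∈ b.support, b.height i ≤ b.height (negIdx P (w • i)) := by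
    intro i hi
    have h := hw i (RootPairing.Base.isPos_of_mem_support hi)
    rw [← isPos_neg, RootPairing.Base.isPos_iff] at h
    rw [RootPairing.Base.height_one_of_mem_support hi]
    omega
  refine hi.induction_on_add (p := fun i => b.height i ≤ b.height (negIdx P (w • i))) hs ?_
  intro i j k hk h1 hj
  have h2 := hs j hj
  have hk' : P.root (negIdx P (w • k)) = P.root (negIdx P (w • i)) + P.root (negIdx P (w • j)) := by
    simp only [root_neg, root_smul, hk, smul_add]; abel
  rw [b.height_add hk, b.height_add hk']
  omega

lemma mem_support_of_height_one {i : ι} (hi : b.height i = 1) : i ∈ b.support := by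
  classical
  obtain ⟨f, -, hf, hsum⟩ := b.exists_root_eq_sum_int i
  have hh := RootPairing.Base.height_eq_sum hsum
  rw [hi] at hh
  have hpos : ∀ j, 0 ≤ f j := by
    rcases hf with hf | hf
    · exact fun j => hf.le j
    · exfalso
      have : ∑ j ∈ b.support, f j ≤ 0 := Finset.sum_nonpos fun j _ => hf.le j
      omega
  obtain ⟨j, hj, hfj⟩ : ∃ j ∈ b.support, 0 < f j := by
    by_contra! hcon
    have : ∑ j ∈ b.support, f j ≤ 0 := Finset.sum_nonpos hcon
    omega
  have hrest := Finset.add_sum_erase b.support f hj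
  have hnn : 0 ≤ ∑ k ∈ b.support.erase j, f k := Finset.sum_nonneg fun k _ => hpos k
  have hz : ∑ k ∈ b.support.erase j, f k = 0 := by omega
  have hfz := (Finset.sum_eq_zero_iff_of_nonneg (fun k _ => hpos k)).mp hz
  have hfj1 : f j = 1 := by omega
  have : P.root i = P.root j := by
    rw [hsum, ← Finset.add_sum_erase b.support _ hj, hfj1, one_smul,
      Finset.sum_eq_zero (fun k hk => by rw [hfz k hk, zero_smul]), add_zero]
  rwa [P.root.injective this]

/-- `w₀` maps simple roots to negatives of simple roots. -/
lemma longest_simple {i : ι} (hi : i ∈ b.support) : negIdx P (longest b • i) ∈ b.support := by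
  have hip := RootPairing.Base.isPos_of_mem_support hi
  have hpos : b.IsPos (negIdx P (longest b • i)) := by
    rw [isPos_neg]; exact longest_neg b hip
  have h1 := height_le_of_pos b (longest b) (fun _ => longest_neg b) hip
  have h2 := height_le_of_pos b (longest b)⁻¹ (fun _ => longest_inv_neg b) hpos
  rw [smul_negIdx, inv_smul_smul, negIdx_negIdx] at h2
  apply mem_support_of_height_one
  rw [RootPairing.Base.height_one_of_mem_support hi] at h1 h2
  omega

lemma longest_mul_ofIdx (i : ι) :
    longest b * RootPairing.weylGroup.ofIdx P i =
      RootPairing.weylGroup.ofIdx P (negIdx P (longest b • i)) * longest b := by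
  apply Subtype.ext
  apply RootPairing.Equiv.weightHom_injective P
  ext x
  change longest b • (RootPairing.weylGroup.ofIdx P i • x) =
    RootPairing.weylGroup.ofIdx P (negIdx P (longest b • i)) • (longest b • x)
  rw [ofIdx_smul_wt, ofIdx_smul_wt, coroot'_neg, pairing_smul, root_neg, root_smul, smul_sub,
    smul_comm]
  simp

end Longest

section Fock

variable {ι X Y : Type*} [Fintype ι] [AddCommGroup X] [AddCommGroup Y]
  {P : RootDatum ι X Y} (b : P.Base) (ℓ : ℕ)

/-- The free `𝕂`-module `V` on symbols `|λ⟩`, `λ ∈ X`. -/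
abbrev FreeKet (X : Type*) : Type _ := X →₀ KK

/-- The symbol `|λ⟩` in the free module. -/
def fket (lam : X) : FreeKet X := Finsupp.single lam 1

/-- The elements of `V` which are set to zero in the abstract Fock space. For `k > 0` and
`0 < j < ℓ` with `⟨λ + ρ, αᵢ^∨⟩ = kℓ + j` one has `λ⁽¹⁾ = λ - j αᵢ`. -/
inductive IsRelation : FreeKet X → Prop
  | wall (lam : X) (i : ι) (hi : i ∈ b.support) (h : shiftedPairing b lam i = 0) :
      IsRelation (fket lam)
  | multiple (lam : X) (i : ι) (hi : i ∈ b.support) (k : ℕ)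
      (h : shiftedPairing b lam i = ℓ * k) :
      IsRelation (fket (dot b (RootPairing.weylGroup.ofIdx P i) lam) + fket lam)
  | small (lam : X) (i : ι) (hi : i ∈ b.support)
      (h₀ : 0 < shiftedPairing b lam i) (h₁ : shiftedPairing b lam i < ℓ) :
      IsRelation (fket (dot b (RootPairing.weylGroup.ofIdx P i) lam) + tHalf 1 • fket lam)
  | generic (lam : X) (i : ι) (hi : i ∈ b.support) (k j : ℤ) (hk : 0 < k) (hj : 0 < j)
      (hjl : j < ℓ) (h : shiftedPairing b lam i = k * ℓ + j) :
      IsRelation (fket (dot b (RootPairing.weylGroup.ofIdx P i) lam)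
        + tHalf 1 • fket (dot b (RootPairing.weylGroup.ofIdx P i) (lam - j • P.root i))
        + fket (lam - j • P.root i) + tHalf 1 • fket lam)

/-- The submodule `I` of `V` spanned by the straightening relations. -/
def relations : Submodule KK (FreeKet X) := Submodule.span KK {v | IsRelation b ℓ v}

/-- The abstract Fock space `F_ℓ = V / I`. -/
abbrev Fock : Type _ := FreeKet X ⧸ relations b ℓ

/-- The class `|λ⟩` in the abstract Fock space. -/
def ket (lam : X) : Fock b ℓ := (relations b ℓ).mkQ (fket lam)

/-- `N_λ`, the number of positive roots `α` with `⟨λ + ρ, α^∨⟩ ∈ ℓℤ`. -/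
def wallCount (lam : X) : ℕ := by
  classical exact ((posRoots b).filter fun i => (ℓ : ℤ) ∣ shiftedPairing b lam i).card

/-- The scalar `(-1)^{ℓ(w₀)} (t^{-1/2})^{ℓ(w₀) - N_λ}`, with `ℓ(w₀) = |R⁺|`. -/
def barScalar (lam : X) : KK :=
  (-1) ^ (posRoots b).card * tHalf (-(((posRoots b).card : ℤ) - wallCount b ℓ lam))

/-- The bar involution on the free module `V`. -/
def barFree : FreeKet X →ₛₗ[barKK] FreeKet X where
  toFun v := Finsupp.sum v fun lam p => (barKK p * barScalar b ℓ lam) • fket (dot b (longest b) lam)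
  map_add' u v := by
    refine Finsupp.sum_add_index' (h := fun lam p =>
      (barKK p * barScalar b ℓ lam) • fket (dot b (longest b) lam)) ?_ ?_
    · simp
    · intro lam p q; rw [map_add, add_mul, add_smul]
  map_smul' c v := by
    rw [Finsupp.sum_smul_index' (by simp), Finsupp.smul_sum]
    simp only [smul_eq_mul, map_mul, mul_assoc, mul_smul]

lemma barFree_fket (lam : X) :
    barFree b ℓ (fket lam) = barScalar b ℓ lam • fket (dot b (longest b) lam) := by
  change Finsupp.sum (Finsupp.single lam (1 : KK)) (fun lam p =>
      (barKK p * barScalar b ℓ lam) • fket (dot b (longest b) lam)) = _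
  rw [Finsupp.sum_single_index] <;> simp

lemma barKK_tHalf (n : ℤ) : barKK (tHalf n) = tHalf (-n) := by
  simp [barKK, tHalf]

lemma mem_relations {v : FreeKet X} (h : IsRelation b ℓ v) : v ∈ relations b ℓ :=
  Submodule.subset_span h

section
variable [P.IsReduced]

lemma two_mul_wallCount (lam : X) :
    2 * wallCount b ℓ lam = Nat.card {i : ι // (ℓ : ℤ) ∣ shiftedPairing b lam i} := by
  classical
  rw [Nat.card_eq_fintype_card, Fintype.card_subtype, two_mul,
    ← Finset.card_filter_add_card_filter_not (s := Finset.univ.filter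
      fun i => (ℓ : ℤ) ∣ shiftedPairing b lam i) (p := fun i => b.IsPos i)]
  have h1 : wallCount b ℓ lam = ((Finset.univ.filter
      fun i => (ℓ : ℤ) ∣ shiftedPairing b lam i).filter fun i => b.IsPos i).card := by
    rw [wallCount]; congr 1; ext i; simp [mem_posRoots, and_comm]
  congr 1
  rw [wallCount]
  refine Finset.card_bij (fun i _ => negIdx P i) ?_ ?_ ?_
  · intro i hi
    rw [Finset.mem_filter, mem_posRoots] at hi
    simp [shiftedPairing_neg, hi.2, isPos_neg, hi.1]
  · intro i _ j _ h
    simpa [negIdx_negIdx] using congrArg (negIdx P) h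
  · intro j hj
    simp only [Finset.mem_filter, Finset.mem_univ, true_and] at hj
    refine ⟨negIdx P j, ?_, negIdx_negIdx j⟩
    simp [mem_posRoots, isPos_neg, shiftedPairing_neg, hj.1, hj.2]

lemma wallCount_dot (w : P.weylGroup) (lam : X) :
    wallCount b ℓ (dot b w lam) = wallCount b ℓ lam := by
  have h : 2 * wallCount b ℓ (dot b w lam) = 2 * wallCount b ℓ lam := by
    rw [two_mul_wallCount, two_mul_wallCount]
    refine Nat.card_congr ((MulAction.toPerm w⁻¹ : Equiv.Perm ι).subtypeEquiv fun i => ?_)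
    change _ ↔ (ℓ : ℤ) ∣ shiftedPairing b lam (w⁻¹ • i)
    rw [← shiftedPairing_dot b w lam (w⁻¹ • i), smul_inv_smul]
  omega

lemma wallCount_add (lam mu : X) : wallCount b ℓ (lam + (ℓ : ℤ) • mu) = wallCount b ℓ lam := by
  classical
  rw [wallCount, wallCount]
  congr 1
  ext i
  rw [Finset.mem_filter, Finset.mem_filter, shiftedPairing_add, map_smul, smul_eq_mul,
    dvd_add_left (Dvd.intro _ rfl)]

/-- The bar involution preserves the straightening relations. -/
lemma barFree_mem : relations b ℓ ≤ (relations b ℓ).comap (barFree b ℓ) := by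
  rw [relations, Submodule.span_le]
  intro v hv
  change barFree b ℓ v ∈ relations b ℓ
  have hbar : ∀ lam mu : X, wallCount b ℓ mu = wallCount b ℓ lam →
      barFree b ℓ (fket mu) = barScalar b ℓ lam • fket (dot b (longest b) mu) := by
    intro lam mu h
    rw [barFree_fket, barScalar, barScalar, h]
  have hT : barKK (tHalf 1) = tHalf (-1) := barKK_tHalf 1
  have hTT : tHalf (-1) * tHalf 1 = 1 := by
    rw [tHalf, tHalf, ← LaurentPolynomial.T_add]; simp
  have hst : ∀ (i : ι) (x : X), dot b (longest b) (dot b (RootPairing.weylGroup.ofIdx P i) x) =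
      dot b (RootPairing.weylGroup.ofIdx P (negIdx P (longest b • i))) (dot b (longest b) x) := by
    intro i x
    rw [← dot_mul, longest_mul_ofIdx, dot_mul]
  have hsp : ∀ (i : ι) (x : X), shiftedPairing b (dot b (longest b) x)
      (negIdx P (longest b • i)) = - shiftedPairing b x i := by
    intro i x
    rw [shiftedPairing_neg, shiftedPairing_dot]
  rcases hv with ⟨lam, i, hi, h⟩ | ⟨lam, i, hi, k, h⟩ | ⟨lam, i, hi, h₀, h₁⟩ |
    ⟨lam, i, hi, k, j, hk, hj, hjl, h⟩
  · rw [barFree_fket]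
    refine Submodule.smul_mem _ _ (mem_relations b ℓ (.wall _ _ (longest_simple b hi) ?_))
    rw [hsp, h, neg_zero]
  · rw [map_add, hbar lam _ (wallCount_dot b ℓ _ _), hbar lam lam rfl, ← smul_add]
    have := IsRelation.multiple (b := b) (ℓ := ℓ)
      (dot b (longest b) (dot b (RootPairing.weylGroup.ofIdx P i) lam)) _ (longest_simple b hi) k
      (by rw [hsp, shiftedPairing_dot_ofIdx, neg_neg, h])
    rw [← hst, dot_ofIdx_dot_ofIdx, add_comm] at this
    exact Submodule.smul_mem _ _ (mem_relations b ℓ this)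
  · have := IsRelation.small (b := b) (ℓ := ℓ)
      (dot b (longest b) (dot b (RootPairing.weylGroup.ofIdx P i) lam)) _ (longest_simple b hi)
      (by rw [hsp, shiftedPairing_dot_ofIdx, neg_neg]; exact h₀)
      (by rw [hsp, shiftedPairing_dot_ofIdx, neg_neg]; exact h₁)
    rw [← hst, dot_ofIdx_dot_ofIdx] at this
    have := Submodule.smul_mem _ (tHalf (-1) * barScalar b ℓ lam) (mem_relations b ℓ this)
    convert! this using 1
    rw [map_add, map_smulₛₗ, hT, hbar lam _ (wallCount_dot b ℓ _ _), hbar lam lam rfl, smul_add,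
      smul_smul, smul_smul, mul_right_comm, hTT, one_mul, add_comm]
  · have h1 : wallCount b ℓ (lam - j • P.root i) = wallCount b ℓ lam := by
      rw [← wallCount_dot b ℓ (RootPairing.weylGroup.ofIdx P i) lam, dot_ofIdx b hi, h]
      have : lam - j • P.root i = lam - (k * ℓ + j) • P.root i + (ℓ : ℤ) • (k • P.root i) := by
        module
      rw [this, wallCount_add]
    have h2 : dot b (longest b) (dot b (RootPairing.weylGroup.ofIdx P i) lam)
        - j • P.root (negIdx P (longest b • i)) =
        dot b (longest b) (dot b (RootPairing.weylGroup.ofIdx P i) (lam - j • P.root i)) := by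
      have e : lam - j • P.root i = lam + -(j • P.root i) := sub_eq_add_neg _ _
      have h2' : P.coroot' i (P.root i) = 2 := P.root_coroot_two i
      rw [e, dot_add, dot_add, root_neg, root_smul, ofIdx_smul_wt, map_neg, map_smul, h2']
      have e2 : -(j • P.root i) - (-(j • (2 : ℤ))) • P.root i = j • P.root i := by
        simp only [smul_eq_mul]; module
      rw [e2, smul_neg, sub_neg_eq_add, smul_comm (longest b) j]
    have := IsRelation.generic (b := b) (ℓ := ℓ)
      (dot b (longest b) (dot b (RootPairing.weylGroup.ofIdx P i) lam)) _ (longest_simple b hi)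
      k j hk hj hjl (by rw [hsp, shiftedPairing_dot_ofIdx, neg_neg, h])
    rw [h2, ← hst, ← hst, dot_ofIdx_dot_ofIdx, dot_ofIdx_dot_ofIdx] at this
    have := Submodule.smul_mem _ (tHalf (-1) * barScalar b ℓ lam) (mem_relations b ℓ this)
    convert! this using 1
    simp only [map_add, map_smulₛₗ, hT]
    rw [hbar lam _ (wallCount_dot b ℓ _ _), hbar lam lam rfl, hbar lam _ h1,
      hbar lam (dot b _ (lam - _)) ((wallCount_dot b ℓ _ _).trans h1)]
    have hc : tHalf (-1) * barScalar b ℓ lam * tHalf 1 = barScalar b ℓ lam := by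
      rw [mul_right_comm, hTT, one_mul]
    simp only [smul_add, smul_smul, hc]
    abel

/-- The bar involution on the abstract Fock space. -/
def bar : Fock b ℓ →ₛₗ[barKK] Fock b ℓ :=
  Submodule.mapQ (relations b ℓ) (relations b ℓ) (barFree b ℓ) (barFree_mem b ℓ)

end

end Fock

section Action

variable {ι X Y : Type*} [Fintype ι] [AddCommGroup X] [AddCommGroup Y]
  {P : RootDatum ι X Y} (b : P.Base) (ℓ : ℕ)

/-- The group algebra `𝕂[X]`, spanned by the `X^μ` with `X^μ X^ν = X^(μ+ν)`. -/
abbrev KX (X : Type*) : Type _ := AddMonoidAlgebra KK X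

/-- The basis element `X^μ`. -/
def xpow (mu : X) : KX X := AddMonoidAlgebra.single mu 1

/-- The action of the finite Weyl group on `𝕂[X]`, `w X^μ = X^(wμ)`. -/
def weylAct (w : P.weylGroup) : KX X →ₐ[KK] KX X :=
  AddMonoidAlgebra.mapDomainAlgHom KK KK (DistribSMul.toAddMonoidHom X w)

/-- The ring `𝕂[X]^{W₀}` of symmetric functions. -/
def symFun (P : RootDatum ι X Y) : Subalgebra KK (KX X) where
  carrier := {f | ∀ w : P.weylGroup, weylAct w f = f}
  mul_mem' hf hg w := by rw [map_mul, hf w, hg w]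
  add_mem' hf hg w := by rw [map_add, hf w, hg w]
  algebraMap_mem' r w := by rw [AlgHom.commutes]

/-- Translation by `ν` on the free module `V`: `|γ⟩ ↦ |ν + γ⟩`. -/
def shift (nu : X) : FreeKet X →ₗ[KK] FreeKet X := Finsupp.lmapDomain KK KK fun gam => nu + gam

lemma shift_fket (nu gam : X) : shift nu (fket gam) = fket (nu + gam) := by
  simp [shift, fket]

/-- The action of `𝕂[X]` on `V`: `X^μ · |γ⟩ = |ℓ μ* + γ⟩ = |-ℓ w₀ μ + γ⟩`. -/
def actFree : KX X →ₐ[KK] Module.End KK (FreeKet X) :=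
  AddMonoidAlgebra.lift KK (Module.End KK (FreeKet X)) X
    { toFun := fun mu => shift (ℓ • star b mu.toAdd)
      map_one' := by
        refine Finsupp.lhom_ext' fun gam => LinearMap.ext_ring ?_
        change shift _ (fket gam) = fket gam
        rw [shift_fket]; simp [star]
      map_mul' := fun mu nu => by
        refine Finsupp.lhom_ext' fun gam => LinearMap.ext_ring ?_
        change shift _ (fket gam) = shift _ (shift _ (fket gam))
        rw [shift_fket, shift_fket, shift_fket, ← add_assoc, ← smul_add]
        simp [star, add_comm] }

lemma actFree_apply (f : KX X) (v : FreeKet X) :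
    actFree b ℓ f v = ∑ mu ∈ f.coeff.support, f.coeff mu • shift (ℓ • star b mu) v := by
  rw [actFree, AddMonoidAlgebra.lift_apply, Finsupp.sum, LinearMap.sum_apply]
  rfl

lemma coeff_of_mem_symFun {f : KX X} (hf : f ∈ symFun P) (w : P.weylGroup) (mu : X) :
    f.coeff (w • mu) = f.coeff mu := by
  have h := hf w
  have h2 : (weylAct w f).coeff (w • mu) = f.coeff mu :=
    Finsupp.mapDomain_apply (f := fun x : X => w • x) (MulAction.injective w) f.coeff mu
  rwa [h] at h2

section
variable [P.IsReduced]

lemma ket_wall {x : X} {i : ι} (hi : i ∈ b.support) (h : shiftedPairing b x i = 0) :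
    ket b ℓ x = 0 :=
  (Submodule.Quotient.mk_eq_zero _).mpr (mem_relations b ℓ (.wall x i hi h))

lemma ket_multiple {x : X} {i : ι} (hi : i ∈ b.support) (h : (ℓ : ℤ) ∣ shiftedPairing b x i) :
    ket b ℓ (dot b (RootPairing.weylGroup.ofIdx P i) x) + ket b ℓ x = 0 := by
  have key : ∀ (y : X) (k : ℕ), shiftedPairing b y i = ℓ * k →
      ket b ℓ (dot b (RootPairing.weylGroup.ofIdx P i) y) + ket b ℓ y = 0 := fun y k h =>
    (Submodule.Quotient.mk_eq_zero _).mpr (mem_relations b ℓ (.multiple y i hi k h))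
  obtain ⟨c, hc⟩ := h
  rcases le_total 0 c with h0 | h0
  · lift c to ℕ using h0
    exact key x c hc
  · obtain ⟨d, rfl⟩ : ∃ d : ℕ, c = -d := ⟨(-c).toNat, by omega⟩
    have := key (dot b (RootPairing.weylGroup.ofIdx P i) x) d
      (by rw [shiftedPairing_dot_ofIdx, hc]; ring)
    rwa [dot_ofIdx_dot_ofIdx, add_comm] at this

lemma ket_small {x : X} {i : ι} (hi : i ∈ b.support) (h₀ : 0 < shiftedPairing b x i)
    (h₁ : shiftedPairing b x i < ℓ) :
    ket b ℓ (dot b (RootPairing.weylGroup.ofIdx P i) x) + tHalf 1 • ket b ℓ x = 0 :=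
  (Submodule.Quotient.mk_eq_zero _).mpr (mem_relations b ℓ (.small x i hi h₀ h₁))

lemma ket_generic {x : X} {i : ι} (hi : i ∈ b.support) (k j : ℤ) (hj : 0 < j)
    (hjl : j < ℓ) (h : shiftedPairing b x i = k * ℓ + j) :
    ket b ℓ (dot b (RootPairing.weylGroup.ofIdx P i) x)
        + tHalf 1 • ket b ℓ (dot b (RootPairing.weylGroup.ofIdx P i) (x - j • P.root i))
        + ket b ℓ (x - j • P.root i) + tHalf 1 • ket b ℓ x = 0 := by
  have key : ∀ (y : X) (k : ℤ), 0 < k → shiftedPairing b y i = k * ℓ + j →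
      ket b ℓ (dot b (RootPairing.weylGroup.ofIdx P i) y)
        + tHalf 1 • ket b ℓ (dot b (RootPairing.weylGroup.ofIdx P i) (y - j • P.root i))
        + ket b ℓ (y - j • P.root i) + tHalf 1 • ket b ℓ y = 0 := fun y k hk h =>
    (Submodule.Quotient.mk_eq_zero _).mpr (mem_relations b ℓ (.generic y i hi k j hk hj hjl h))
  have h2 : P.coroot' i (P.root i) = 2 := P.root_coroot_two i
  rcases lt_trichotomy k 0 with hk | rfl | hk
  · have e : dot b (RootPairing.weylGroup.ofIdx P i) (x - j • P.root i) - j • P.root i =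
        dot b (RootPairing.weylGroup.ofIdx P i) x := by
      rw [sub_eq_add_neg x, dot_add, ofIdx_smul_wt, map_neg, map_smul, h2, smul_eq_mul]
      module
    have := key (dot b (RootPairing.weylGroup.ofIdx P i) (x - j • P.root i)) (-k) (by omega)
      (by rw [shiftedPairing_dot_ofIdx, sub_eq_add_neg, shiftedPairing_add, map_neg, map_smul, h2,
            h, smul_eq_mul]; ring)
    rw [e, dot_ofIdx_dot_ofIdx, dot_ofIdx_dot_ofIdx] at this
    rw [← this]; abel
  · rw [zero_mul, zero_add] at h
    have e : x - j • P.root i = dot b (RootPairing.weylGroup.ofIdx P i) x := by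
      rw [dot_ofIdx b hi, h]
    have := ket_small b ℓ hi (x := x) (by omega) (by omega)
    rw [e, dot_ofIdx_dot_ofIdx]
    calc _ = (ket b ℓ (dot b (RootPairing.weylGroup.ofIdx P i) x) + tHalf 1 • ket b ℓ x)
          + (ket b ℓ (dot b (RootPairing.weylGroup.ofIdx P i) x) + tHalf 1 • ket b ℓ x) := by abel
      _ = 0 := by rw [this, add_zero]
  · exact key x k hk h

lemma coroot'_ofIdx_smul (i : ι) (x : X) :
    P.coroot' i (RootPairing.weylGroup.ofIdx P i • x) = - P.coroot' i x := by
  have h2 : P.coroot' i (P.root i) = 2 := P.root_coroot_two i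
  rw [ofIdx_smul_wt, map_sub, map_smul, h2, smul_eq_mul]; ring

/-- The two translates of a straightening relation for `αᵢ` by `ℓν` and `ℓ sᵢν` cancel. -/
lemma shift_relation {v : FreeKet X} (hv : IsRelation b ℓ v) : ∃ i : ι, ∀ nu : X,
    ((relations b ℓ).mkQ (shift (ℓ • nu) v) +
      (relations b ℓ).mkQ (shift (ℓ • (RootPairing.weylGroup.ofIdx P i • nu)) v) = 0) ∧
    (RootPairing.weylGroup.ofIdx P i • nu = nu → (relations b ℓ).mkQ (shift (ℓ • nu) v) = 0) := by
  have hk : ∀ x : X, (relations b ℓ).mkQ (fket x) = ket b ℓ x := fun _ => rfl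
  have hd : ∀ (i : ι) (nu x : X), dot b (RootPairing.weylGroup.ofIdx P i) (ℓ • nu + x) =
      ℓ • (RootPairing.weylGroup.ofIdx P i • nu) + dot b (RootPairing.weylGroup.ofIdx P i) x := by
    intro i nu x
    rw [add_comm, dot_add, add_comm, smul_comm]
  have hss : ∀ (i : ι) (nu : X),
      RootPairing.weylGroup.ofIdx P i • RootPairing.weylGroup.ofIdx P i • nu = nu := by
    intro i nu
    nth_rewrite 1 [← ofIdx_inv]; rw [inv_smul_smul]
  have hsp : ∀ (i : ι) (nu x : X), shiftedPairing b (ℓ • nu + x) i =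
      shiftedPairing b x i + ℓ * P.coroot' i nu := by
    intro i nu x
    rw [add_comm, shiftedPairing_add, map_nsmul, nsmul_eq_mul]
  have h0 : ∀ (i : ι) (nu : X), RootPairing.weylGroup.ofIdx P i • nu = nu →
      P.coroot' i nu = 0 := by
    intro i nu h
    have := coroot'_ofIdx_smul (P := P) i nu
    rw [h] at this
    omega
  rcases hv with ⟨lam, i, hi, h⟩ | ⟨lam, i, hi, k, h⟩ | ⟨lam, i, hi, h₀, h₁⟩ |
    ⟨lam, i, hi, k, j, hk', hj, hjl, h⟩ <;>
  refine ⟨i, fun nu => ⟨?_, fun hnu => ?_⟩⟩ <;>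
  simp only [map_add, map_smul, shift_fket, hk]
  · have e : dot b (RootPairing.weylGroup.ofIdx P i) lam = lam := by
      rw [dot_ofIdx b hi, h, zero_smul, sub_zero]
    have := ket_multiple b ℓ hi (x := ℓ • nu + lam) (by rw [hsp, h, zero_add]; exact ⟨_, rfl⟩)
    rw [hd, e] at this
    rw [← this, add_comm]
  · exact ket_wall b ℓ hi (by rw [hsp, h, h0 i nu hnu]; simp)
  · have a1 := ket_multiple b ℓ hi (x := ℓ • nu + lam)
      (by rw [hsp, h]; exact dvd_add ⟨_, rfl⟩ ⟨_, rfl⟩)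
    have a2 := ket_multiple b ℓ hi (x := ℓ • (RootPairing.weylGroup.ofIdx P i • nu) + lam)
      (by rw [hsp, h]; exact dvd_add ⟨_, rfl⟩ ⟨_, rfl⟩)
    rw [hd] at a1 a2
    rw [hss] at a2
    calc _ = _ := by abel
      _ = _ := congrArg₂ (· + ·) a1 a2
      _ = 0 := add_zero 0
  · have a1 := ket_multiple b ℓ hi (x := ℓ • nu + lam)
      (by rw [hsp, h]; exact dvd_add ⟨_, rfl⟩ ⟨_, rfl⟩)
    rwa [hd, hnu] at a1
  · have a1 := ket_generic b ℓ hi (x := ℓ • nu + lam) (P.coroot' i nu)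
      (shiftedPairing b lam i) h₀ h₁ (by rw [hsp]; ring)
    have e : ℓ • nu + lam - shiftedPairing b lam i • P.root i =
        ℓ • nu + dot b (RootPairing.weylGroup.ofIdx P i) lam := by
      rw [dot_ofIdx b hi]; abel
    rw [e, hd, hd, dot_ofIdx_dot_ofIdx] at a1
    rw [← a1]; abel
  · have a1 := ket_small b ℓ hi (x := ℓ • nu + lam) (by rw [hsp, h0 i nu hnu]; simpa using h₀)
      (by rw [hsp, h0 i nu hnu]; simpa using h₁)
    rwa [hd, hnu] at a1
  · have a1 := ket_generic b ℓ hi (x := ℓ • nu + lam) (k + P.coroot' i nu) j hj hjl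
      (by rw [hsp, h]; ring)
    have a2 := ket_generic b ℓ hi (x := ℓ • (RootPairing.weylGroup.ofIdx P i • nu) + lam)
      (k - P.coroot' i nu) j hj hjl (by rw [hsp, coroot'_ofIdx_smul, h]; ring)
    rw [add_sub_assoc, hd, hd] at a1 a2
    rw [hss] at a2
    have a3 := congrArg₂ (· + ·) a1 a2
    simp only [add_zero] at a3
    rw [← a3]; abel
  · have a1 := ket_generic b ℓ hi (x := ℓ • nu + lam) k j hj hjl
      (by rw [hsp, h, h0 i nu hnu]; ring)
    rwa [add_sub_assoc, hd, hd, hnu] at a1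

/-- Symmetric functions preserve the straightening relations. -/
lemma actFree_mem (f : symFun P) :
    relations b ℓ ≤ (relations b ℓ).comap (actFree b ℓ (f : KX X)) := by
  conv_lhs => rw [relations]
  rw [Submodule.span_le]
  intro v hv
  change actFree b ℓ (f : KX X) v ∈ relations b ℓ
  obtain ⟨i, hi⟩ := shift_relation b ℓ hv
  rw [← Submodule.ker_mkQ (relations b ℓ), LinearMap.mem_ker, actFree_apply, map_sum]
  set w := (longest b)⁻¹ * RootPairing.weylGroup.ofIdx P i * longest b with hw
  have hstar : ∀ mu : X, star b (w • mu) = RootPairing.weylGroup.ofIdx P i • star b mu := by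
    intro mu
    simp [star, hw, mul_smul]
  have hww : ∀ mu : X, w • w • mu = mu := by
    intro mu
    simp only [hw, mul_smul, smul_inv_smul]
    have : RootPairing.weylGroup.ofIdx P i • RootPairing.weylGroup.ofIdx P i • (longest b • mu) =
        longest b • mu := by
      nth_rewrite 1 [← ofIdx_inv]; rw [inv_smul_smul]
    rw [this, inv_smul_smul]
  refine Finset.sum_involution (fun mu _ => w • mu) ?_ ?_ ?_ ?_
  · intro mu _
    rw [coeff_of_mem_symFun f.2, hstar, map_smul, map_smul, ← smul_add, (hi _).1, smul_zero]
  · intro mu _ hne heq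
    apply hne
    have : RootPairing.weylGroup.ofIdx P i • star b mu = star b mu := by rw [← hstar, heq]
    rw [map_smul, (hi _).2 this, smul_zero]
  · intro mu hmu
    rw [Finsupp.mem_support_iff] at hmu ⊢
    rwa [coeff_of_mem_symFun f.2]
  · intro mu _
    exact hww mu

/-- The action of the ring of symmetric functions on the abstract Fock space, induced by
`X^μ · |γ⟩ = |ℓ μ* + γ⟩`. -/
def symAct : symFun P →ₐ[KK] Module.End KK (Fock b ℓ) where
  toFun f := Submodule.mapQ _ _ (actFree b ℓ (f : KX X)) (actFree_mem b ℓ f)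
  map_one' := by ext; simp
  map_mul' f g := by ext; simp
  map_zero' := by ext; simp
  map_add' f g := by ext; simp
  commutes' r := by
    refine LinearMap.ext fun x => ?_
    obtain ⟨v, rfl⟩ := Submodule.mkQ_surjective _ x
    change (relations b ℓ).mkQ (actFree b ℓ (algebraMap KK (KX X) r) v) = _
    rw [AlgHom.commutes, Module.algebraMap_end_apply, Module.algebraMap_end_apply, map_smul]

end

end Action

section Bases

variable {ι X Y : Type*} [Fintype ι] [AddCommGroup X] [AddCommGroup Y]
  {P : RootDatum ι X Y} (b : P.Base) (ℓ : ℕ)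

/-- Dominant integral weights: `⟨λ + ρ, αᵢ^∨⟩ > 0` for all simple roots `αᵢ`. -/
def IsDominant (lam : X) : Prop := ∀ i ∈ b.support, 0 < shiftedPairing b lam i

/-- The type `(𝔞_ℤ^*)⁺` of dominant integral weights. -/
abbrev DominantWeight : Type _ := {lam : X // IsDominant b lam}

/-- The linear map sending a finitely supported family `(c_μ)` of scalars indexed by dominant
weights to `∑ c_μ |μ⟩`. -/
def ketSum : (DominantWeight b →₀ KK) →ₗ[KK] Fock b ℓ :=
  Finsupp.linearCombination KK fun mu : DominantWeight b => ket b ℓ (mu : X)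

/-- The coordinates of an element of `F_ℓ` in the basis of the `|μ⟩`, `μ` dominant
(meaningful as `ketSum` is bijective). -/
def coord (x : Fock b ℓ) : DominantWeight b →₀ KK := Function.invFun (ketSum b ℓ) x

/-- The subset `t^{1/2} ℤ[t^{1/2}]` of `𝕂`. -/
def IsPositivePoly (p : KK) : Prop :=
  ∃ q : Polynomial ℤ, p = tHalf 1 * Polynomial.toLaurent q

variable [P.IsReduced]

lemma isDominant_iff (lam : X) : IsDominant b lam ↔ ∀ i ∈ b.support, 0 ≤ P.coroot' i lam := by
  refine forall₂_congr fun i hi => ?_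
  rw [shiftedPairing, rhoPairing_simple b hi]
  omega

/-- The weight `0` is dominant. -/
def zeroWeight : DominantWeight b := ⟨0, by simp [isDominant_iff]⟩

/-- The weight `ℓλ`. -/
def scaleWeight (lam : DominantWeight b) : DominantWeight b :=
  ⟨ℓ • (lam : X), by
    have h := lam.2
    rw [isDominant_iff] at h ⊢
    intro i hi
    rw [map_nsmul]
    exact nsmul_nonneg (h i hi) ℓ⟩

/-- The characterization of the Kazhdan-Lusztig basis element `C_λ`: it is bar invariant and
`C_λ = |λ⟩ + ∑_{μ ≠ λ} p_{μλ} |μ⟩`, summed over dominant `μ`, with `p_{μλ} ∈ t^{1/2} ℤ[t^{1/2}]`. -/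
def IsKLElement (lam : DominantWeight b) (C : Fock b ℓ) : Prop :=
  bar b ℓ C = C ∧ ∃ p : DominantWeight b →₀ KK, C = ketSum b ℓ p ∧ p lam = 1 ∧
    ∀ mu, mu ≠ lam → IsPositivePoly (p mu)

/-- The Kazhdan-Lusztig basis element `C_λ`. -/
def klElement (lam : DominantWeight b) : Fock b ℓ := Classical.epsilon (IsKLElement b ℓ lam)

/-- The coefficient of `|μ⟩` in `C_λ`. -/
def klCoeff (lam mu : DominantWeight b) : KK := coord b ℓ (klElement b ℓ lam) mu

/-- The alternating sum `∑_{w ∈ W₀} det(w) X^(w ∘ λ)`. -/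
def weylNumerator (lam : X) : KX X :=
  ∑ w : P.weylGroup,
    LinearMap.det ((DistribSMul.toAddMonoidHom X w).toIntLinearMap) • xpow (dot b w lam)

/-- `s` is the Weyl character of `λ`, the quotient of the two alternating sums. -/
def IsWeylCharacter (lam : X) (s : symFun P) : Prop :=
  (s : KX X) * weylNumerator b 0 = weylNumerator b lam

/-- The Weyl character `s_λ ∈ 𝕂[X]^{W₀}`. -/
def weylCharacter (lam : X) : symFun P := Classical.epsilon (IsWeylCharacter b lam)

/-- The coefficient `Q^λ_{μν}` of `|μ⟩` in `s_{λ*} · |ν⟩`. -/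
def qCoeff (lam mu nu : DominantWeight b) : KK :=
  coord b ℓ (symAct b ℓ (weylCharacter b (star b (lam : X))) (ket b ℓ (nu : X))) mu

end Bases

section LLT

variable {ι X Y : Type*} [Fintype ι] [AddCommGroup X] [AddCommGroup Y]
  {P : RootDatum ι X Y} (b : P.Base) (ℓ : ℕ)

/-- Formal, possibly infinite, `𝕂`-linear combinations `∑_λ c_λ s_λ` of the Weyl characters of
the dominant weights `λ`; the element is recorded by its coefficient family `λ ↦ c_λ`. -/
abbrev FormalSum : Type _ := DominantWeight b → KK

/-- The extended affine Weyl group `W = X ⋊ W₀`, with elements `t_μ w` and `w t_μ = t_(wμ) w`. -/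
abbrev AffWeyl (P : RootDatum ι X Y) : Type _ :=
  Multiplicative X ⋊[(MulAutMultiplicative X).symm.toMonoidHom.comp
    (DistribMulAction.toAddAut P.weylGroup X)] P.weylGroup

/-- The defining relation of the semidirect product is the usual one. -/
lemma weyl_mul_transl (w : P.weylGroup) (mu : X) :
    (SemidirectProduct.inr w : AffWeyl P) * (SemidirectProduct.inl (Multiplicative.ofAdd mu)) =
      (SemidirectProduct.inl (Multiplicative.ofAdd (w • mu)) : AffWeyl P) *
        SemidirectProduct.inr w := by
  apply SemidirectProduct.ext
  · simp only [SemidirectProduct.mul_left, SemidirectProduct.left_inl, SemidirectProduct.left_inr,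
      SemidirectProduct.right_inl, SemidirectProduct.right_inr, one_mul, map_one, mul_one]
    rfl
  · simp only [SemidirectProduct.mul_right, SemidirectProduct.right_inl,
      SemidirectProduct.right_inr, one_mul, mul_one]

/-- The translation `t_μ`. -/
def transl (P : RootDatum ι X Y) (mu : X) : AffWeyl P :=
  SemidirectProduct.inl (Multiplicative.ofAdd mu)

/-- The level `(-ℓ-h)` dot action: `(t_μ w) ∘ λ = w ∘ λ - ℓμ`. -/
def affDot (x : AffWeyl P) (lam : X) : X := dot b x.right lam - ℓ • x.left.toAdd

/-- The length on the extended affine Weyl group: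
`ℓ(t_μ w) = ∑_{α > 0, w⁻¹α > 0} |⟨μ, α^∨⟩| + ∑_{α > 0, w⁻¹α < 0} |⟨μ, α^∨⟩ - 1|`. -/
def affLength (x : AffWeyl P) : ℕ := by
  classical exact ∑ i ∈ posRoots b,
    (P.coroot' i x.left.toAdd - if b.IsPos (x.right⁻¹ • i) then 0 else 1).natAbs

/-- The finite Weyl group `W₀` inside `W`. -/
def finWeyl (P : RootDatum ι X Y) : Subgroup (AffWeyl P) := SemidirectProduct.inr.range

/-- The Weyl group, inside `W`, of the standard Levi subgroup with simple roots `αⱼ`, `j ∈ J`. -/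
def leviWeyl (P : RootDatum ι X Y) (J : Finset ι) : Subgroup (AffWeyl P) :=
  Subgroup.closure {x | ∃ j ∈ J, x = SemidirectProduct.inr (RootPairing.weylGroup.ofIdx P j)}

/-- The data entering the Grojnowski-Haiman polynomials: the stabilizer `W_η` of `η` in `W` is the
Weyl group of the standard Levi subgroup `L` given by `J`; `μ` is the dominant weight in the
`W₀`-orbit (for the dot action) of `η + ℓβ`; and `v` is an element of minimal length in the double
coset `W₀ t_β W_η`. -/
structure IsGHDatum (J : Finset ι) (eta bet : X) (v : AffWeyl P) (mu : DominantWeight b) :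
    Prop where
  levi : J ⊆ b.support
  stabilizer : ∀ x : AffWeyl P, affDot b ℓ x eta = eta ↔ x ∈ leviWeyl P J
  orbit : ∃ u : P.weylGroup, (mu : X) = dot b u (eta + ℓ • bet)
  mem : v ∈ DoubleCoset.doubleCoset (transl P bet) (finWeyl P : Set (AffWeyl P)) (leviWeyl P J)
  minimal : ∀ x ∈ DoubleCoset.doubleCoset (transl P bet) (finWeyl P : Set (AffWeyl P))
    (leviWeyl P J), affLength b v ≤ affLength b x

variable [P.IsReduced]

/-- Lecouvey's polynomial `G_μ^ℓ = ∑_λ p_{ℓλ,μ} s_λ`, with `p_{ℓλ,μ}` the coefficient of `|μ⟩` in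
`C_{ℓλ}`. -/
def lecouveyLLT (mu : DominantWeight b) : FormalSum b :=
  fun lam => klCoeff b ℓ (scaleWeight b ℓ lam) mu

/-- The Grojnowski-Haiman polynomial `t^{l(β-γ) + ℓ(w) - ℓ(v)} ∑_λ Q^λ_{μν} s_λ`, normalized
by the function `l : X → ℕ`. -/
def ghLLT (l : X → ℕ) (bet gam : X) (v w : AffWeyl P) (mu nu : DominantWeight b) : FormalSum b :=
  tHalf (2 * ((l (bet - gam) : ℤ) + affLength b w - affLength b v)) •
    fun lam => qCoeff b ℓ lam mu nu

end LLT

end FockSpace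

end

/-! The heart of the matter is that v = s_{λ*}·|0⟩ already has the two properties characterizing
C_{ℓλ} (`isKLElement_symAct`).

Bar invariance: |0⟩ is bar invariant since 0 has the smallest ρ-shifted norm among dominant weights
(`bar_ket_zero`), and Weyl characters commute with the bar involution, because their coefficients
are W₀-symmetric integers and translation by ℓX does not change N_λ (`bar_symAct_ket`).

Congruence v ≡ |ℓλ⟩ modulo the lattice of t^{1/2}ℤ[t^{1/2}]-combinations of dominant kets: the
relation for αᵢ at the weight ℓν + (ℓ-1)αᵢ gives |ℓ(sᵢ∘ν)⟩ ≡ -|ℓν⟩. Hence X^μ ↦ |ℓμ*⟩ sends the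
alternating sum a_μ to |W₀|·|ℓμ*⟩ up to the lattice. Applying this to a_λ = s_λ a_0 = ∑ (coefficient
of X^μ in s_λ)·a_μ gives |W₀| s_λ·|0⟩ ≡ |W₀|·|ℓλ*⟩, and |W₀| can be cancelled coefficientwise
(`starKet_weylCharacter_sub_mem`).

For this to determine C_{ℓλ}, the dominant kets must form a basis on which bar is unitriangular.
Straightening by induction on (x+ρ, x+ρ) gives spanning, integrality and unitriangularity. Linear
independence is the hard part. For η in the closed fundamental ℓ-alcove a functional F_ℓ → 𝕂[X] is
built (`detect`), sending |x⟩ to a weighted sum of Θ_w(X^μ) over the expressions x = w∘η + ℓμ, where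
Θ_w is a product of Demazure-Lusztig operators Tᵢ. The straightening relations become two
identities, for Tᵢ on X^μ + X^{sᵢμ} and on X^μ + X^{sᵢμ+αᵢ}. At t^{1/2} = 1 these functionals
separate dominant weights, so the coefficients of a vanishing combination are divisible by t^{1/2} -
1; dividing and repeating makes them divisible by every power of it, hence zero
(`ketSum_injective`).

That Θ_w is well defined requires the braid relations for the Tᵢ. They are obtained uniformly, with
no rank-two case check (`demWord_eq`). Two reduced words of the same element agree modulo terms of
smaller norm, by comparison with the regular Hecke module. The remaining lower terms vanish because
the Tᵢ are self-adjoint for a nondegenerate constant-term pairing with weight ∏(1 - X^α)/(1 - tX^α).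
-/

noncomputable section

set_option linter.unusedSectionVars false

namespace FockSpace

open RootPairing.weylGroup (ofIdx)

/-! ### Root combinatorics: the invariant form, reduced words, dominance and the shifted norm. -/

section RootCombinatorics

variable {ι X Y : Type*} [Fintype ι] [AddCommGroup X] [AddCommGroup Y]
  {P : RootDatum ι X Y} (b : P.Base)

/-- The Weyl group invariant form `(x, y) = ∑ ⟨x, α^∨⟩ ⟨y, α^∨⟩` on the weight lattice. -/
def form (P : RootDatum ι X Y) : X →ₗ[ℤ] X →ₗ[ℤ] ℤ :=
  ∑ i, (P.coroot' i).smulRight (P.coroot' i)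

lemma form_apply (x y : X) : form P x y = ∑ i, P.coroot' i x * P.coroot' i y := by
  simp [form, LinearMap.sum_apply]

lemma form_comm (x y : X) : form P x y = form P y x := by
  simp only [form_apply, mul_comm]

lemma form_smul (w : P.weylGroup) (x y : X) : form P (w • x) (w • y) = form P x y := by
  rw [form_apply, form_apply]
  refine (Fintype.sum_equiv (MulAction.toPerm w) _ _ fun i => ?_).symm
  change _ = P.coroot' (w • i) (w • x) * P.coroot' (w • i) (w • y)
  rw [pairing_smul, pairing_smul]

lemma form_self_nonneg (x : X) : 0 ≤ form P x x := by
  rw [form_apply]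
  exact Finset.sum_nonneg fun i _ => mul_self_nonneg _

lemma coroot'_root (i : ι) : P.coroot' i (P.root i) = 2 := P.root_coroot_two i

/-- Invariance of the form under sᵢ. It trades pairings with coroots for the form with roots, which
is additive along root strings while coroots are not. -/
lemma two_mul_form_root (i : ι) (y : X) :
    2 * form P (P.root i) y = P.coroot' i y * form P (P.root i) (P.root i) := by
  have h := form_smul (ofIdx P i) (P.root i) y
  rw [ofIdx_smul_wt, ofIdx_smul_wt, coroot'_root] at h
  simp only [map_sub, map_smul, LinearMap.sub_apply, LinearMap.smul_apply, smul_eq_mul] at h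
  linarith

lemma form_root_pos (i : ι) : 0 < form P (P.root i) (P.root i) := by
  rw [form_apply]
  refine Finset.sum_pos' (fun j _ => mul_self_nonneg _) ⟨i, Finset.mem_univ _, ?_⟩
  rw [coroot'_root]; norm_num

/-- The norm drops precisely when c lies strictly between 0 and ⟨x, αᵢ^∨⟩; every induction on norms
below rests on this. -/
lemma form_sub_zsmul (x : X) (i : ι) (c : ℤ) :
    form P (x - c • P.root i) (x - c • P.root i) =
      form P x x - c * (P.coroot' i x - c) * form P (P.root i) (P.root i) := by
  have h := two_mul_form_root (P := P) i x
  simp only [map_sub, map_smul, LinearMap.sub_apply, LinearMap.smul_apply, smul_eq_mul]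
  rw [form_comm x (P.root i)]
  linear_combination (-c) * h

/-- A positive root is built up by adding simple roots, and `form` is linear in the root;
`two_mul_form_root` carries the sign there and back. -/
lemma coroot'_nonneg_of_isPos {x : X} (hx : ∀ i ∈ b.support, 0 ≤ P.coroot' i x) {j : ι}
    (hj : b.IsPos j) : 0 ≤ P.coroot' j x := by
  have h : 0 ≤ form P (P.root j) x := by
    refine hj.induction_on_add (p := fun j => 0 ≤ form P (P.root j) x) ?_ ?_
    · intro i hi
      have := mul_nonneg (hx i hi) (form_root_pos (P := P) i).le
      rw [← two_mul_form_root] at this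
      omega
    · intro i j k hk h1 hj
      have := mul_nonneg (hx j hj) (form_root_pos (P := P) j).le
      rw [← two_mul_form_root] at this
      rw [hk, map_add, LinearMap.add_apply]
      omega
  have := two_mul_form_root (P := P) j x
  by_contra! hneg
  have := mul_neg_of_neg_of_pos hneg (form_root_pos (P := P) j)
  omega

lemma coroot'_pos_of_isPos {x : X} (hx : ∀ i ∈ b.support, 0 < P.coroot' i x) {j : ι}
    (hj : b.IsPos j) : 0 < P.coroot' j x := by
  have h : 0 < form P (P.root j) x := by
    refine hj.induction_on_add (p := fun j => 0 < form P (P.root j) x) ?_ ?_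
    · intro i hi
      have := mul_pos (hx i hi) (form_root_pos (P := P) i)
      rw [← two_mul_form_root] at this
      omega
    · intro i j k hk h1 hj
      have := mul_pos (hx j hj) (form_root_pos (P := P) j)
      rw [← two_mul_form_root] at this
      rw [hk, map_add, LinearMap.add_apply]
      omega
  have := two_mul_form_root (P := P) j x
  by_contra! hneg
  have := mul_nonpos_of_nonpos_of_nonneg hneg (form_root_pos (P := P) j).le
  omega

lemma mul_ofIdx (w : P.weylGroup) (i : ι) : w * ofIdx P i = ofIdx P (w • i) * w := by
  apply Subtype.ext
  apply RootPairing.Equiv.weightHom_injective P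
  ext x
  change w • (ofIdx P i • x) = ofIdx P (w • i) • (w • x)
  rw [ofIdx_smul_wt, ofIdx_smul_wt, pairing_smul, root_smul, smul_sub, smul_comm]

lemma ofIdx_mul_self (i : ι) : ofIdx P i * ofIdx P i = 1 := by
  nth_rewrite 1 [← ofIdx_inv]; exact inv_mul_cancel _

lemma ofIdx_mul_cancel (i : ι) (w : P.weylGroup) : ofIdx P i * (ofIdx P i * w) = w := by
  rw [← mul_assoc, ofIdx_mul_self, one_mul]

lemma ofIdx_smul_smul_wt (i : ι) (x : X) : ofIdx P i • ofIdx P i • x = x := by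
  rw [← mul_smul, ofIdx_mul_self, one_smul]

/-- The product of the reflections indexed by a word. -/
def wordProd (P : RootDatum ι X Y) (l : List ι) : P.weylGroup := (l.map (ofIdx P)).prod

@[simp] lemma wordProd_nil : wordProd P [] = 1 := rfl

@[simp] lemma wordProd_cons (i : ι) (l : List ι) :
    wordProd P (i :: l) = ofIdx P i * wordProd P l := by simp [wordProd]

lemma wordProd_append (l l' : List ι) :
    wordProd P (l ++ l') = wordProd P l * wordProd P l' := by simp [wordProd]

lemma wordProd_reverse (l : List ι) : wordProd P l.reverse = (wordProd P l)⁻¹ := by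
  induction l with
  | nil => simp
  | cons i l ih => rw [List.reverse_cons, wordProd_append, ih]; simp [ofIdx_inv]

variable [P.IsReduced]

lemma isPos_ofIdx_smul {i j : ι} (hi : i ∈ b.support) (hj : b.IsPos j) (hne : j ≠ i) :
    b.IsPos (ofIdx P i • j) := hj.reflectionPerm hi hne

/-- Products of simple reflections form a subgroup. It contains all reflections, since every root is
reached from a simple one by simple reflections and a reflection conjugates to that of the moved
root. -/
lemma exists_word (w : P.weylGroup) :
    ∃ l : List ι, (∀ i ∈ l, i ∈ b.support) ∧ wordProd P l = w := by
  let H : Subgroup P.weylGroup :=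
    { carrier := {w | ∃ l : List ι, (∀ i ∈ l, i ∈ b.support) ∧ wordProd P l = w}
      one_mem' := ⟨[], by simp, rfl⟩
      mul_mem' := by
        rintro _ _ ⟨l, hl, rfl⟩ ⟨l', hl', rfl⟩
        refine ⟨l ++ l', ?_, wordProd_append l l'⟩
        intro i hi
        rcases List.mem_append.mp hi with h | h
        exacts [hl i h, hl' i h]
      inv_mem' := by
        rintro _ ⟨l, hl, rfl⟩
        exact ⟨l.reverse, fun i hi => hl i (List.mem_reverse.mp hi), wordProd_reverse l⟩ }
  have hsimple : ∀ i ∈ b.support, ofIdx P i ∈ H := fun i hi => ⟨[i], by simpa using hi, by simp⟩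
  have hconj : ∀ i j, ofIdx P i ∈ H → ofIdx P j ∈ H → ofIdx P (P.reflectionPerm j i) ∈ H := by
    intro i j hi hj
    have h := mul_ofIdx (ofIdx P j) i
    rw [← ofIdx_smul_idx, eq_mul_inv_of_mul_eq h.symm]
    exact H.mul_mem (H.mul_mem hj hi) (H.inv_mem hj)
  have hrefl : ∀ i, ofIdx P i ∈ H := fun i =>
    b.induction_reflect i (p := fun i => ofIdx P i ∈ H) (fun i hi => hconj i i hi hi) hsimple
      (fun i j hi hj => hconj i j hi (hsimple j hj))
  change w ∈ H
  obtain ⟨g, hg⟩ := w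
  induction hg using RootPairing.weylGroup.induction with
  | mem i => exact hrefl i
  | one => exact H.one_mem
  | mul x y hx hy h1 h2 => exact H.mul_mem h1 h2

/-- The reflection sᵢ permutes the positive roots other than αᵢ, so old inversions are moved by sᵢ
and αᵢ is the only new one. The `Finset.cons` form lets filtered counts be read off. -/
lemma inversions_ofIdx_mul {i : ι} (hi : i ∈ b.support) {w : P.weylGroup}
    (h : b.IsPos (w⁻¹ • i)) : ∃ hn : i ∉ (inversions b w).map
      (MulAction.toPerm (ofIdx P i)).toEmbedding,
    inversions b (ofIdx P i * w) =
      Finset.cons i ((inversions b w).map (MulAction.toPerm (ofIdx P i)).toEmbedding) hn := by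
  have hip := RootPairing.Base.isPos_of_mem_support hi
  have hn : i ∉ (inversions b w).map (MulAction.toPerm (ofIdx P i)).toEmbedding := by
    intro hmem
    obtain ⟨j, hj, hji⟩ := Finset.mem_map.mp hmem
    rw [mem_inversions] at hj
    have hji' : ofIdx P i • j = i := hji
    have : j = negIdx P i := by
      rw [← ofIdx_smul_smul (P := P) i j, hji', ofIdx_smul_self]
    rw [this, isPos_neg] at hj
    exact hj.1 hip
  refine ⟨hn, ?_⟩
  ext k
  rw [Finset.mem_cons, mem_inversions, mul_inv_rev, mul_smul, ofIdx_inv, Finset.mem_map]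
  constructor
  · rintro ⟨h1, h2⟩
    by_cases hk : k = i
    · exact Or.inl hk
    · exact Or.inr ⟨ofIdx P i • k, (mem_inversions b).mpr ⟨isPos_ofIdx_smul b hi h1 hk, h2⟩,
        ofIdx_smul_smul i k⟩
  · rintro (rfl | ⟨j, hj, rfl⟩)
    · refine ⟨hip, ?_⟩
      rw [ofIdx_smul_self, smul_negIdx, isPos_neg]
      simpa using h
    · rw [mem_inversions] at hj
      have hne : j ≠ i := by rintro rfl; exact hj.2 h
      refine ⟨isPos_ofIdx_smul b hi hj.1 hne, ?_⟩
      change ¬ b.IsPos (w⁻¹ • ofIdx P i • ofIdx P i • j)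
      rw [ofIdx_smul_smul]
      exact hj.2

lemma length_ofIdx_mul {i : ι} (hi : i ∈ b.support) {w : P.weylGroup}
    (h : b.IsPos (w⁻¹ • i)) : length b (ofIdx P i * w) = length b w + 1 := by
  obtain ⟨hn, h⟩ := inversions_ofIdx_mul b hi h
  rw [length, h, Finset.card_cons, Finset.card_map, length]

lemma isPos_ofIdx_mul_inv_smul (i : ι) (w : P.weylGroup) :
    b.IsPos ((ofIdx P i * w)⁻¹ • i) ↔ ¬ b.IsPos (w⁻¹ • i) := by
  rw [mul_inv_rev, mul_smul, ofIdx_inv, ofIdx_smul_self, smul_negIdx, isPos_neg]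

lemma length_ofIdx_mul' {i : ι} (hi : i ∈ b.support) {w : P.weylGroup}
    (h : ¬ b.IsPos (w⁻¹ • i)) : length b (ofIdx P i * w) + 1 = length b w := by
  rw [← isPos_ofIdx_mul_inv_smul] at h
  have := length_ofIdx_mul b hi h
  rw [ofIdx_mul_cancel] at this
  exact this.symm

lemma length_one : length b (1 : P.weylGroup) = 0 := by
  rw [length, Finset.card_eq_zero, Finset.eq_empty_iff_forall_notMem]
  intro i hi
  rw [mem_inversions] at hi
  simp at hi

lemma length_inv (w : P.weylGroup) : length b w⁻¹ = length b w := by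
  refine Finset.card_bij (fun i _ => negIdx P (w • i)) ?_ ?_ ?_
  · intro i hi
    rw [mem_inversions, inv_inv] at hi
    rw [mem_inversions, smul_negIdx, inv_smul_smul, isPos_neg, isPos_neg]
    exact ⟨hi.2, not_not.mpr hi.1⟩
  · intro i _ j _ h
    have := congrArg (negIdx P) h
    rw [negIdx_negIdx, negIdx_negIdx] at this
    exact MulAction.injective w this
  · intro j hj
    rw [mem_inversions] at hj
    refine ⟨negIdx P (w⁻¹ • j), ?_, ?_⟩
    · rw [mem_inversions, inv_inv, smul_negIdx, smul_inv_smul, isPos_neg, isPos_neg]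
      exact ⟨hj.2, not_not.mpr hj.1⟩
    · rw [smul_negIdx, smul_inv_smul, negIdx_negIdx]

lemma length_wordProd_le {l : List ι} (hl : ∀ i ∈ l, i ∈ b.support) :
    length b (wordProd P l) ≤ l.length := by
  induction l with
  | nil => simp [length_one]
  | cons i l ih =>
    have h1 := ih fun j hj => hl j (List.mem_cons_of_mem _ hj)
    have hi := hl i List.mem_cons_self
    rw [wordProd_cons, List.length_cons]
    by_cases h : b.IsPos ((wordProd P l)⁻¹ • i)
    · rw [length_ofIdx_mul b hi h]; omega
    · have := length_ofIdx_mul' b hi h; omega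

/-- Apply the letters to αᵢ one at a time from the right. The letter j that first makes the image
negative must meet αⱼ itself; there sⱼ(tail) = (tail)sᵢ, so this letter cancels. -/
lemma exchange {l : List ι} (hl : ∀ i ∈ l, i ∈ b.support) {i : ι} (hi : i ∈ b.support)
    (h : ¬ b.IsPos (wordProd P l • i)) : ∃ l' : List ι, (∀ i ∈ l', i ∈ b.support) ∧
      l'.length + 1 = l.length ∧ wordProd P l * ofIdx P i = wordProd P l' := by
  induction l with
  | nil => exact absurd (RootPairing.Base.isPos_of_mem_support hi) (by simpa using h)
  | cons j l ih =>
    have hl' : ∀ i ∈ l, i ∈ b.support := fun k hk => hl k (List.mem_cons_of_mem _ hk)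
    have hj := hl j List.mem_cons_self
    rw [wordProd_cons] at h ⊢
    by_cases hp : b.IsPos (wordProd P l • i)
    · have hij : wordProd P l • i = j := by
        by_contra hne
        rw [mul_smul] at h
        exact h (isPos_ofIdx_smul b hj hp hne)
      refine ⟨l, hl', rfl, ?_⟩
      rw [mul_assoc, mul_ofIdx, hij, ofIdx_mul_cancel]
    · obtain ⟨l', h1, h2, h3⟩ := ih hl' hp
      refine ⟨j :: l', ?_, by simp [h2], by rw [mul_assoc, h3, wordProd_cons]⟩
      intro k hk
      rcases List.mem_cons.mp hk with rfl | hk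
      exacts [hj, h1 k hk]

/-- A word in the simple reflections is reduced if its length is that of its product. -/
def ReducedWord (l : List ι) : Prop :=
  (∀ i ∈ l, i ∈ b.support) ∧ length b (wordProd P l) = l.length

lemma exists_reducedWord (w : P.weylGroup) : ∃ l, ReducedWord b l ∧ wordProd P l = w := by
  obtain ⟨l, hl, rfl⟩ := exists_word b w
  induction l with
  | nil => exact ⟨[], ⟨hl, by simp [length_one]⟩, rfl⟩
  | cons i l ih =>
    obtain ⟨l₀, h₀, hw⟩ := ih fun j hj => hl j (List.mem_cons_of_mem _ hj)
    have hi := hl i List.mem_cons_self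
    rw [wordProd_cons, ← hw]
    by_cases h : b.IsPos ((wordProd P l₀)⁻¹ • i)
    · refine ⟨i :: l₀, ⟨?_, ?_⟩, wordProd_cons _ _⟩
      · intro k hk
        rcases List.mem_cons.mp hk with rfl | hk
        exacts [hi, h₀.1 k hk]
      · rw [wordProd_cons, length_ofIdx_mul b hi h, h₀.2, List.length_cons]
    · have h' := h
      rw [← wordProd_reverse] at h'
      -- `exchange` treats multiplication on the right; reversing the word turns it into
      -- multiplication on the left.
      obtain ⟨l', h1, h2, h3⟩ := exchange b (l := l₀.reverse)
        (fun j hj => h₀.1 j (List.mem_reverse.mp hj)) hi h'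
      have h4 : wordProd P l'.reverse = ofIdx P i * wordProd P l₀ := by
        rw [wordProd_reverse, ← h3, wordProd_reverse, mul_inv_rev, inv_inv, ofIdx_inv]
      refine ⟨l'.reverse, ⟨fun j hj => h1 j (List.mem_reverse.mp hj), ?_⟩, h4⟩
      have h5 := length_ofIdx_mul' b hi h
      rw [h4, List.length_reverse]
      rw [List.length_reverse] at h2
      have := h₀.2
      omega

lemma ReducedWord.tail {i : ι} {l : List ι} (h : ReducedWord b (i :: l)) :
    ReducedWord b l ∧ b.IsPos ((wordProd P l)⁻¹ • i) := by
  have hl : ∀ j ∈ l, j ∈ b.support := fun j hj => h.1 j (List.mem_cons_of_mem _ hj)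
  have hi := h.1 i List.mem_cons_self
  have h1 := length_wordProd_le b hl
  have h2 := h.2
  rw [wordProd_cons, List.length_cons] at h2
  by_cases hp : b.IsPos ((wordProd P l)⁻¹ • i)
  · rw [length_ofIdx_mul b hi hp] at h2
    exact ⟨⟨hl, by omega⟩, hp⟩
  · have := length_ofIdx_mul' b hi hp
    omega

lemma ReducedWord.cons {i : ι} {l : List ι} (h : ReducedWord b l) (hi : i ∈ b.support)
    (hp : b.IsPos ((wordProd P l)⁻¹ • i)) : ReducedWord b (i :: l) := by
  refine ⟨?_, by rw [wordProd_cons, length_ofIdx_mul b hi hp, h.2, List.length_cons]⟩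
  intro k hk
  rcases List.mem_cons.mp hk with rfl | hk
  exacts [hi, h.1 k hk]

lemma ReducedWord.reverse {l : List ι} (h : ReducedWord b l) : ReducedWord b l.reverse :=
  ⟨fun j hj => h.1 j (List.mem_reverse.mp hj), by
    rw [wordProd_reverse, length_inv, h.2, List.length_reverse]⟩

/-- Induction on elements of the Weyl group along reduced words. -/
lemma weyl_induction {p : P.weylGroup → Prop} (one : p 1)
    (step : ∀ i ∈ b.support, ∀ w, b.IsPos (w⁻¹ • i) → p w → p (ofIdx P i * w))
    (w : P.weylGroup) : p w := by
  obtain ⟨l, hl, rfl⟩ := exists_reducedWord b w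
  induction l with
  | nil => exact one
  | cons i l ih =>
    obtain ⟨h1, h2⟩ := hl.tail
    rw [wordProd_cons]
    exact step i (hl.1 i List.mem_cons_self) _ h2 (ih h1)

lemma exists_descent {w : P.weylGroup} (hw : w ≠ 1) :
    ∃ i ∈ b.support, ¬ b.IsPos (w⁻¹ • i) := by
  revert hw
  refine weyl_induction b (p := fun w => w ≠ 1 → ∃ i ∈ b.support, ¬ b.IsPos (w⁻¹ • i))
    (fun h => absurd rfl h) ?_ w
  intro i hi w hp _ _
  refine ⟨i, hi, ?_⟩
  rw [isPos_ofIdx_mul_inv_smul]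
  exact not_not.mpr hp

/-- The leftmost letter sᵢ of a reduced word flips the sign of a pairing that is nonnegative before
and after. The pairing is thus zero, sᵢ acts trivially there and can be dropped. -/
lemma smul_eq_of_dominant (w : P.weylGroup) {x : X} (hx : ∀ i ∈ b.support, 0 ≤ P.coroot' i x)
    (hw : ∀ i ∈ b.support, 0 ≤ P.coroot' i (w • x)) : w • x = x := by
  revert hw
  refine weyl_induction b (p := fun w => (∀ i ∈ b.support, 0 ≤ P.coroot' i (w • x)) → w • x = x)
    (fun _ => one_smul _ _) ?_ w
  intro i hi w hp ih hw
  have h1 : 0 ≤ P.coroot' i (w • x) := by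
    rw [← smul_inv_smul w i, pairing_smul]
    exact coroot'_nonneg_of_isPos b hx hp
  have h2 := hw i hi
  rw [mul_smul, coroot'_ofIdx_smul] at h2
  have h3 : P.coroot' i (w • x) = 0 := by omega
  have h4 : ofIdx P i • w • x = w • x := by rw [ofIdx_smul_wt, h3, zero_smul, sub_zero]
  rw [mul_smul, h4] at hw ⊢
  exact ih hw

lemma form_root_twoRho_pos {j : ι} (hj : b.IsPos j) : 0 < form P (P.root j) (twoRho b) := by
  have h := two_mul_form_root (P := P) j (twoRho b)
  have h2 : 0 < P.coroot' j (twoRho b) :=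
    coroot'_pos_of_isPos b (fun i hi => by rw [coroot'_twoRho b hi]; norm_num) hj
  have := mul_pos h2 (form_root_pos (P := P) j)
  omega

/-- A negative pairing with αᵢ would let sᵢ increase the product with 2ρ; dominant representatives
are therefore found as maximizers over the finite orbit. -/
lemma dominant_of_form_maximal {x : X}
    (h : ∀ u : P.weylGroup, form P (u • x) (twoRho b) ≤ form P x (twoRho b)) {i : ι}
    (hi : i ∈ b.support) : 0 ≤ P.coroot' i x := by
  by_contra! hneg
  have h1 := h (ofIdx P i)
  rw [ofIdx_smul_wt, map_sub, map_smul, LinearMap.sub_apply, LinearMap.smul_apply,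
    smul_eq_mul] at h1
  have h2 := form_root_twoRho_pos b (RootPairing.Base.isPos_of_mem_support hi)
  nlinarith

lemma exists_smul_dominant (x : X) :
    ∃ w : P.weylGroup, ∀ i ∈ b.support, 0 ≤ P.coroot' i (w • x) := by
  obtain ⟨w, hw⟩ := Finite.exists_max fun w : P.weylGroup => form P (w • x) (twoRho b)
  refine ⟨w, fun i hi => dominant_of_form_maximal b (fun u => ?_) hi⟩
  rw [← mul_smul]
  exact hw _

lemma exists_dot_dominant (x : X) :
    ∃ w : P.weylGroup, ∀ i ∈ b.support, 0 ≤ shiftedPairing b (dot b w x) i := by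
  obtain ⟨w, hw⟩ := exists_smul_dominant b (2 • x + twoRho b)
  refine ⟨w, fun i hi => ?_⟩
  have h := two_mul_shiftedPairing b (dot b w x) i
  rw [two_smul_dot, sub_add_cancel] at h
  have := hw i hi
  omega

lemma shiftedPairing_nonneg_of_isPos {x : X} (hx : ∀ i ∈ b.support, 0 ≤ shiftedPairing b x i)
    {j : ι} (hj : b.IsPos j) : 0 ≤ shiftedPairing b x j := by
  have := coroot'_nonneg_of_isPos b (x := 2 • x + twoRho b)
    (fun i hi => by rw [← two_mul_shiftedPairing]; have := hx i hi; omega) hj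
  rw [← two_mul_shiftedPairing] at this
  omega

lemma IsDominant.pos {x : X} (hx : IsDominant b x) {j : ι} (hj : b.IsPos j) :
    0 < shiftedPairing b x j := by
  have := coroot'_pos_of_isPos b (x := 2 • x + twoRho b)
    (fun i hi => by rw [← two_mul_shiftedPairing]; have := hx i hi; omega) hj
  rw [← two_mul_shiftedPairing] at this
  omega

/-- The dot action is free on dominant weights, and each orbit contains at most one of them. -/
lemma IsDominant.eq_one {x : X} (hx : IsDominant b x) {w : P.weylGroup}
    (hw : ∀ i ∈ b.support, 0 ≤ shiftedPairing b (dot b w x) i) : w = 1 := by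
  by_contra hne
  obtain ⟨i, hi, hneg⟩ := exists_descent b hne
  have h1 := hw i hi
  rw [← smul_inv_smul w i, shiftedPairing_dot] at h1
  rw [← isPos_neg] at hneg
  have h2 := hx.pos b hneg
  rw [shiftedPairing_neg] at h2
  omega

/-- The norm `4 |x + ρ|²`. -/
def shiftedNorm (x : X) : ℤ := form P (2 • x + twoRho b) (2 • x + twoRho b)

lemma shiftedNorm_nonneg (x : X) : 0 ≤ shiftedNorm b x := form_self_nonneg _

lemma shiftedNorm_dot (w : P.weylGroup) (x : X) :
    shiftedNorm b (dot b w x) = shiftedNorm b x := by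
  rw [shiftedNorm, two_smul_dot, sub_add_cancel, form_smul, shiftedNorm]

lemma shiftedNorm_sub_zsmul (x : X) (i : ι) (c : ℤ) : shiftedNorm b (x - c • P.root i) =
    shiftedNorm b x - 4 * c * (shiftedPairing b x i - c) * form P (P.root i) (P.root i) := by
  have h := form_sub_zsmul (P := P) (2 • x + twoRho b) i (2 * c)
  rw [← two_mul_shiftedPairing] at h
  have e : 2 • (x - c • P.root i) + twoRho b = 2 • x + twoRho b - (2 * c) • P.root i := by module
  rw [shiftedNorm, e, h, shiftedNorm]
  ring

end RootCombinatorics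

/-! ### The sign character of the Weyl group. -/

section Determinant

variable {ι X Y : Type*} [Fintype ι] [AddCommGroup X] [AddCommGroup Y]
  {P : RootDatum ι X Y}

/-- The determinant of an element of the Weyl group acting on the weight lattice. -/
def weylDet (w : P.weylGroup) : ℤ :=
  LinearMap.det ((DistribSMul.toAddMonoidHom X w).toIntLinearMap)

lemma weylDet_mul (u w : P.weylGroup) : weylDet (u * w) = weylDet u * weylDet w := by
  rw [weylDet, weylDet, weylDet, ← LinearMap.det_comp]
  exact congrArg _ (LinearMap.ext fun x => mul_smul u w x)

lemma weylDet_one : weylDet (1 : P.weylGroup) = 1 := by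
  rw [weylDet, ← LinearMap.det_id (M := X)]
  exact congrArg _ (LinearMap.ext fun x => one_smul P.weylGroup x)

lemma weylDet_ofIdx [Module.Finite ℤ X] (i : ι) : weylDet (ofIdx P i) = -1 := by
  have : Module.IsReflexive ℤ X := .of_isPerfPair P.toLinearMap
  have : Module.Free ℤ X := inferInstance
  -- A reflection is a transvection with vector -αᵢ; its determinant is 1 - ⟨αᵢ, αᵢ^∨⟩ = -1.
  have e : (DistribSMul.toAddMonoidHom X (ofIdx P i)).toIntLinearMap =
      LinearMap.transvection (P.coroot' i) (-P.root i) := by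
    ext x
    rw [LinearMap.transvection.apply, smul_neg, ← sub_eq_add_neg]
    exact ofIdx_smul_wt i x
  rw [weylDet, e, LinearMap.transvection.det, map_neg, coroot'_root]
  norm_num

lemma weylDet_mul_self (w : P.weylGroup) : weylDet w * weylDet w = 1 := by
  have h : weylDet w * weylDet w⁻¹ = 1 := by rw [← weylDet_mul, mul_inv_cancel, weylDet_one]
  rcases Int.eq_one_or_neg_one_of_mul_eq_one h with h | h <;> rw [h] <;> norm_num

end Determinant

lemma tHalf_mul (m n : ℤ) : tHalf m * tHalf n = tHalf (m + n) :=
  (LaurentPolynomial.T_add m n).symm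

lemma tHalf_zero : tHalf 0 = 1 := LaurentPolynomial.T_zero

lemma isUnit_tHalf (n : ℤ) : IsUnit (tHalf n) := LaurentPolynomial.isUnit_T n

/-! ### Linear maps out of the group algebra 𝕂[X]. -/

section GroupAlgebra

variable {X : Type*} [AddCommGroup X]

lemma xpow_mul (mu nu : X) : xpow mu * xpow nu = xpow (mu + nu) := by
  simp [xpow, AddMonoidAlgebra.single_mul_single]

lemma xpow_zero : xpow (0 : X) = 1 := rfl

/-- The linear map on `𝕂[X]` with given values on the basis elements `X^μ`. -/
def kxLift {N : Type*} [AddCommMonoid N] [Module KK N] (f : X → N) : KX X →ₗ[KK] N :=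
  Finsupp.linearCombination KK f ∘ₗ (AddMonoidAlgebra.coeffLinearEquiv KK).toLinearMap

lemma kxLift_apply {N : Type*} [AddCommMonoid N] [Module KK N] (f : X → N) (x : KX X) :
    kxLift f x = ∑ mu ∈ x.coeff.support, x.coeff mu • f mu := rfl

@[simp] lemma kxLift_xpow {N : Type*} [AddCommMonoid N] [Module KK N] (f : X → N) (mu : X) :
    kxLift f (xpow mu) = f mu := by
  change Finsupp.linearCombination KK f (Finsupp.single mu 1) = _
  rw [Finsupp.linearCombination_single, one_smul]

lemma kxLift_xpow_self (x : KX X) : kxLift xpow x = x := by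
  apply AddMonoidAlgebra.coeff_injective
  rw [kxLift_apply, AddMonoidAlgebra.coeff_sum]
  refine Eq.trans (Finset.sum_congr rfl fun mu _ => ?_) x.coeff.sum_single
  change x.coeff mu • Finsupp.single mu 1 = _
  rw [Finsupp.smul_single, smul_eq_mul, mul_one]

lemma sum_coeff_smul_xpow (x : KX X) :
    ∑ mu ∈ x.coeff.support, x.coeff mu • xpow mu = x := by
  rw [← kxLift_apply, kxLift_xpow_self]

lemma kx_hom_ext {N : Type*} [AddCommMonoid N] [Module KK N] {f g : KX X →ₗ[KK] N}
    (h : ∀ mu, f (xpow mu) = g (xpow mu)) : f = g := by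
  refine LinearMap.ext fun x => ?_
  rw [← sum_coeff_smul_xpow x, map_sum, map_sum]
  simp only [map_smul, h]

lemma coeff_xpow (mu nu : X) [Decidable (mu = nu)] :
    (xpow mu).coeff nu = if mu = nu then 1 else 0 := by
  classical
  change Finsupp.single mu (1 : KK) nu = _
  rw [Finsupp.single_apply]

end GroupAlgebra

/-! ### Demazure-Lusztig operators on 𝕂[X] and their leading terms. -/

section DemazureLusztig

variable {ι X Y : Type*} [Fintype ι] [AddCommGroup X] [AddCommGroup Y]
  {P : RootDatum ι X Y} (b : P.Base)

lemma weylAct_xpow (w : P.weylGroup) (mu : X) : weylAct w (xpow mu) = xpow (w • mu) := by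
  simp [weylAct, xpow]

variable (P) in
/-- The Demazure operator `f ↦ (f - sᵢ f) / (X^αᵢ - 1)`. -/
def demazure (i : ι) : KX X →ₗ[KK] KX X :=
  kxLift fun mu => ∑ j ∈ Finset.range (P.coroot' i mu).toNat, xpow (mu - ((j : ℤ) + 1) • P.root i)
    - ∑ j ∈ Finset.range (-P.coroot' i mu).toNat, xpow (mu + (j : ℤ) • P.root i)

/-- Both geometric sums telescope against X^αᵢ - 1, and one of the two ranges is always empty. -/
lemma mul_demazure (i : ι) (f : KX X) :
    (xpow (P.root i) - 1) * demazure P i f = f - weylAct (ofIdx P i) f := by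
  suffices h : (LinearMap.mulLeft KK (xpow (P.root i) - 1)) ∘ₗ demazure P i =
      LinearMap.id - (weylAct (ofIdx P i)).toLinearMap from LinearMap.congr_fun h f
  refine kx_hom_ext fun mu => ?_
  change (xpow (P.root i) - 1) * demazure P i (xpow mu) = xpow mu - weylAct (ofIdx P i) (xpow mu)
  rw [weylAct_xpow, ofIdx_smul_wt, demazure, kxLift_xpow, mul_sub, Finset.mul_sum, Finset.mul_sum]
  have h1 : ∀ j : ℕ, (xpow (P.root i) - 1) * xpow (mu - ((j : ℤ) + 1) • P.root i) =
      xpow (mu - (j : ℤ) • P.root i) - xpow (mu - ((j + 1 : ℕ) : ℤ) • P.root i) := by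
    intro j
    rw [sub_mul, one_mul, xpow_mul]
    congr 2
    · module
  have h2 : ∀ j : ℕ, (xpow (P.root i) - 1) * xpow (mu + (j : ℤ) • P.root i) =
      xpow (mu + ((j + 1 : ℕ) : ℤ) • P.root i) - xpow (mu + (j : ℤ) • P.root i) := by
    intro j
    rw [sub_mul, one_mul, xpow_mul]
    congr 2
    push_cast
    module
  rw [Finset.sum_congr rfl fun j _ => h1 j, Finset.sum_congr rfl fun j _ => h2 j,
    Finset.sum_range_sub' (fun j : ℕ => xpow (mu - (j : ℤ) • P.root i)),
    Finset.sum_range_sub (fun j : ℕ => xpow (mu + (j : ℤ) • P.root i))]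
  rcases le_total 0 (P.coroot' i mu) with h | h
  · rw [Int.toNat_of_nonneg h, Int.toNat_of_nonpos (by omega : -P.coroot' i mu ≤ 0)]
    simp
  · rw [Int.toNat_of_nonpos h, Int.toNat_of_nonneg (by omega : 0 ≤ -P.coroot' i mu)]
    simp [sub_eq_add_neg]

variable (P) in
/-- The Demazure-Lusztig operator. -/
def demLus (i : ι) : Module.End KK (KX X) :=
  -(tHalf 1 • (weylAct (ofIdx P i)).toLinearMap) + (tHalf 1 - tHalf (-1)) • demazure P i

lemma demLus_apply (i : ι) (f : KX X) : demLus P i f =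
    -(tHalf 1 • weylAct (ofIdx P i) f) + (tHalf 1 - tHalf (-1)) • demazure P i f := rfl

/-- The span of the `X^μ` with `(μ, μ) < n`. -/
def normLT (P : RootDatum ι X Y) (n : ℤ) : Submodule KK (KX X) :=
  Submodule.span KK (xpow '' {mu | form P mu mu < n})

lemma xpow_mem_normLT {n : ℤ} {mu : X} (h : form P mu mu < n) : xpow mu ∈ normLT P n :=
  Submodule.subset_span ⟨mu, h, rfl⟩

lemma normLT_mono {m n : ℤ} (h : m ≤ n) : normLT P m ≤ normLT P n :=
  Submodule.span_mono (Set.image_mono fun _ hm => lt_of_lt_of_le hm h)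

lemma coeff_eq_zero_of_mem_normLT {n : ℤ} {f : KX X} (hf : f ∈ normLT P n) {mu : X}
    (h : n ≤ form P mu mu) : f.coeff mu = 0 := by
  classical
  induction hf using Submodule.span_induction with
  | mem x hx =>
    obtain ⟨nu, hnu, rfl⟩ := hx
    rw [coeff_xpow, if_neg]
    rintro rfl
    exact absurd hnu (not_lt.mpr h)
  | zero => rfl
  | add x y _ _ hx hy => rw [AddMonoidAlgebra.coeff_add, Finsupp.add_apply, hx, hy, add_zero]
  | smul a x _ hx => rw [AddMonoidAlgebra.coeff_smul, Finsupp.smul_apply, hx, smul_zero]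

lemma form_sub_lt {i : ι} {mu : X} {c : ℤ} (h0 : 0 < c) (h1 : c < P.coroot' i mu) :
    form P (mu - c • P.root i) (mu - c • P.root i) < form P mu mu := by
  rw [form_sub_zsmul]
  have := mul_pos (mul_pos h0 (by omega : 0 < P.coroot' i mu - c)) (form_root_pos (P := P) i)
  omega

/-- The leading term of the Demazure-Lusztig operator. -/
lemma demLus_xpow_of_pos {i : ι} {mu : X} (h : 0 < P.coroot' i mu) :
    demLus P i (xpow mu) + tHalf (-1) • xpow (ofIdx P i • mu) ∈ normLT P (form P mu mu) := by
  obtain ⟨k, hk⟩ : ∃ k : ℕ, P.coroot' i mu = (k : ℤ) + 1 := ⟨(P.coroot' i mu - 1).toNat, by omega⟩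
  have e : demLus P i (xpow mu) + tHalf (-1) • xpow (ofIdx P i • mu) =
      (tHalf 1 - tHalf (-1)) •
        ∑ j ∈ Finset.range k, xpow (mu - ((j : ℤ) + 1) • P.root i) := by
    rw [demLus_apply, weylAct_xpow, demazure, kxLift_xpow, ofIdx_smul_wt, hk,
      Int.toNat_of_nonpos (by omega : -((k : ℤ) + 1) ≤ 0), Finset.range_zero, Finset.sum_empty,
      sub_zero, show ((k : ℤ) + 1).toNat = k + 1 by omega, Finset.sum_range_succ]
    module
  rw [e]
  refine Submodule.smul_mem _ _ (Submodule.sum_mem _ fun j hj => xpow_mem_normLT ?_)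
  rw [Finset.mem_range] at hj
  exact form_sub_lt (by omega) (by omega)

lemma demLus_xpow_of_zero {i : ι} {mu : X} (h : P.coroot' i mu = 0) :
    demLus P i (xpow mu) = -(tHalf 1 • xpow mu) := by
  rw [demLus_apply, weylAct_xpow, demazure, kxLift_xpow, ofIdx_smul_wt, h]
  simp

/-- For a negative pairing the Demazure sum starts at X^μ itself, hence the extra leading term; this
and the positive case mirror the two branches of `leftMul`. -/
lemma demLus_xpow_of_neg {i : ι} {mu : X} (h : P.coroot' i mu < 0) :
    demLus P i (xpow mu) + tHalf 1 • xpow (ofIdx P i • mu) + (tHalf 1 - tHalf (-1)) • xpow mu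
      ∈ normLT P (form P mu mu) := by
  obtain ⟨k, hk⟩ : ∃ k : ℕ, P.coroot' i mu = -((k : ℤ) + 1) :=
    ⟨(-P.coroot' i mu - 1).toNat, by omega⟩
  have e : demLus P i (xpow mu) + tHalf 1 • xpow (ofIdx P i • mu)
        + (tHalf 1 - tHalf (-1)) • xpow mu =
      -((tHalf 1 - tHalf (-1)) •
        ∑ j ∈ Finset.range k, xpow (mu + ((j + 1 : ℕ) : ℤ) • P.root i)) := by
    rw [demLus_apply, weylAct_xpow, demazure, kxLift_xpow, ofIdx_smul_wt, hk,
      Int.toNat_of_nonpos (by omega : -((k : ℤ) + 1) ≤ 0), Finset.range_zero, Finset.sum_empty,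
      show (- -((k : ℤ) + 1)).toNat = k + 1 by omega, Finset.sum_range_succ']
    simp only [Nat.cast_zero, zero_smul, add_zero]
    module
  rw [e]
  refine Submodule.neg_mem _
    (Submodule.smul_mem _ _ (Submodule.sum_mem _ fun j hj => xpow_mem_normLT ?_))
  rw [Finset.mem_range] at hj
  have e2 : mu + ((j + 1 : ℕ) : ℤ) • P.root i = mu - (-((j : ℤ) + 1)) • P.root i := by
    push_cast; module
  rw [e2, form_sub_zsmul, hk]
  have := mul_pos (mul_pos (by omega : 0 < (j : ℤ) + 1) (by omega : 0 < (k : ℤ) - j))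
    (form_root_pos (P := P) i)
  linarith

lemma demLus_mem_normLT (i : ι) {n : ℤ} {f : KX X} (hf : f ∈ normLT P n) :
    demLus P i f ∈ normLT P n := by
  suffices h : normLT P n ≤ (normLT P n).comap (demLus P i) from h hf
  rw [normLT, Submodule.span_le]
  rintro _ ⟨mu, hmu, rfl⟩
  change demLus P i (xpow mu) ∈ normLT P n
  have hx : xpow mu ∈ normLT P n := xpow_mem_normLT hmu
  have hs : xpow (ofIdx P i • mu) ∈ normLT P n := xpow_mem_normLT (by rwa [form_smul])
  have hle : normLT P (form P mu mu) ≤ normLT P n := normLT_mono (le_of_lt hmu)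
  rcases lt_trichotomy (P.coroot' i mu) 0 with h | h | h
  · have h1 := hle (demLus_xpow_of_neg h)
    rwa [Submodule.add_mem_iff_left _ (Submodule.smul_mem _ _ hx),
      Submodule.add_mem_iff_left _ (Submodule.smul_mem _ _ hs)] at h1
  · rw [demLus_xpow_of_zero h]
    exact Submodule.neg_mem _ (Submodule.smul_mem _ _ hx)
  · have h1 := hle (demLus_xpow_of_pos h)
    rwa [Submodule.add_mem_iff_left _ (Submodule.smul_mem _ _ hs)] at h1

end DemazureLusztig

/-! ### The regular module of the finite Hecke algebra. -/

section RegularRepresentation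

variable {ι X Y : Type*} [Fintype ι] [AddCommGroup X] [AddCommGroup Y]
  {P : RootDatum ι X Y} (b : P.Base)

/-- Left multiplication by the `i`-th generator on the regular module of the Hecke algebra. -/
def leftMul (i : ι) : Module.End KK (P.weylGroup →₀ KK) := by
  classical exact Finsupp.linearCombination KK fun v =>
    if b.IsPos (v⁻¹ • i) then -(tHalf (-1) • Finsupp.single (ofIdx P i * v) 1)
    else -(tHalf 1 • Finsupp.single (ofIdx P i * v) 1)
      - (tHalf 1 - tHalf (-1)) • Finsupp.single v 1

/-- Right multiplication by the `j`-th generator on the regular module of the Hecke algebra. -/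
def rightMul (j : ι) : Module.End KK (P.weylGroup →₀ KK) := by
  classical exact Finsupp.linearCombination KK fun v =>
    if b.IsPos (v • j) then -(tHalf (-1) • Finsupp.single (v * ofIdx P j) 1)
    else -(tHalf 1 • Finsupp.single (v * ofIdx P j) 1)
      - (tHalf 1 - tHalf (-1)) • Finsupp.single v 1

lemma leftMul_of_pos {i : ι} {v : P.weylGroup} (h : b.IsPos (v⁻¹ • i)) :
    leftMul b i (Finsupp.single v 1) = -(tHalf (-1) • Finsupp.single (ofIdx P i * v) 1) := by
  simp only [leftMul, Finsupp.linearCombination_single, one_smul, if_pos h]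

lemma leftMul_of_neg {i : ι} {v : P.weylGroup} (h : ¬ b.IsPos (v⁻¹ • i)) :
    leftMul b i (Finsupp.single v 1) = -(tHalf 1 • Finsupp.single (ofIdx P i * v) 1)
      - (tHalf 1 - tHalf (-1)) • Finsupp.single v 1 := by
  simp only [leftMul, Finsupp.linearCombination_single, one_smul, if_neg h]

lemma rightMul_of_pos {j : ι} {v : P.weylGroup} (h : b.IsPos (v • j)) :
    rightMul b j (Finsupp.single v 1) = -(tHalf (-1) • Finsupp.single (v * ofIdx P j) 1) := by
  simp only [rightMul, Finsupp.linearCombination_single, one_smul, if_pos h]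

lemma rightMul_of_neg {j : ι} {v : P.weylGroup} (h : ¬ b.IsPos (v • j)) :
    rightMul b j (Finsupp.single v 1) = -(tHalf 1 • Finsupp.single (v * ofIdx P j) 1)
      - (tHalf 1 - tHalf (-1)) • Finsupp.single v 1 := by
  simp only [rightMul, Finsupp.linearCombination_single, one_smul, if_neg h]

variable [P.IsReduced]

lemma isPos_ofIdx_smul_iff {i k : ι} (hi : i ∈ b.support) (h1 : k ≠ i) (h2 : k ≠ negIdx P i) :
    b.IsPos (ofIdx P i • k) ↔ b.IsPos k := by
  constructor
  · intro h
    have := isPos_ofIdx_smul b hi h (by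
      intro he
      apply h2
      rw [← ofIdx_smul_smul (P := P) i k, he, ofIdx_smul_self])
    rwa [ofIdx_smul_smul] at this
  · exact fun h => isPos_ofIdx_smul b hi h h1

lemma ofIdx_negIdx (i : ι) : ofIdx P (negIdx P i) = ofIdx P i := by
  have h := mul_ofIdx (ofIdx P i) i
  rw [ofIdx_smul_self] at h
  exact (mul_right_cancel h).symm

/-- Left and right ascents are tested independently unless v αⱼ = ±αᵢ. In those two cases sᵢv = vsⱼ,
and the two operators agree on both v and sᵢv. -/
lemma leftMul_rightMul {i j : ι} (hi : i ∈ b.support) (hj : j ∈ b.support) :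
    leftMul b i * rightMul b j = rightMul b j * leftMul b i := by
  refine Finsupp.lhom_ext' fun v => LinearMap.ext_ring ?_
  change leftMul b i (rightMul b j (Finsupp.single v 1)) =
    rightMul b j (leftMul b i (Finsupp.single v 1))
  have hip := RootPairing.Base.isPos_of_mem_support hi
  have hjp := RootPairing.Base.isPos_of_mem_support hj
  have hassoc : ofIdx P i * (v * ofIdx P j) = ofIdx P i * v * ofIdx P j := (mul_assoc _ _ _).symm
  by_cases hA : v • j = i
  · have h1 : v⁻¹ • i = j := by rw [← hA, inv_smul_smul]
    have e : v * ofIdx P j = ofIdx P i * v := by rw [mul_ofIdx, hA]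
    rw [rightMul_of_pos b (by rwa [hA]), leftMul_of_pos b (by rwa [h1])]
    simp only [map_neg, map_smul]
    rw [e, leftMul_of_neg b, rightMul_of_neg b, mul_assoc (ofIdx P i) v, e]
    · rw [mul_smul, hA, ofIdx_smul_self, isPos_neg]
      exact not_not.mpr hip
    · rw [isPos_ofIdx_mul_inv_smul, h1]
      exact not_not.mpr hjp
  by_cases hB : v • j = negIdx P i
  · have h1 : v⁻¹ • i = negIdx P j := by
      rw [← negIdx_negIdx (P := P) i, ← hB, smul_negIdx, inv_smul_smul]
    have e : v * ofIdx P j = ofIdx P i * v := by rw [mul_ofIdx, hB, ofIdx_negIdx]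
    have n1 : ¬ b.IsPos (v • j) := by rw [hB, isPos_neg]; exact not_not.mpr hip
    have n2 : ¬ b.IsPos (v⁻¹ • i) := by rw [h1, isPos_neg]; exact not_not.mpr hjp
    have p1 : b.IsPos ((ofIdx P i * v)⁻¹ • i) := by rwa [isPos_ofIdx_mul_inv_smul]
    have p2 : b.IsPos ((ofIdx P i * v) • j) := by
      rw [mul_smul, hB, smul_negIdx, ofIdx_smul_self, negIdx_negIdx]; exact hip
    rw [rightMul_of_neg b n1, leftMul_of_neg b n2]
    simp only [map_neg, map_smul, map_sub]
    rw [leftMul_of_neg b n2, rightMul_of_neg b n1, e, leftMul_of_pos b p1, rightMul_of_pos b p2,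
      mul_assoc, e]
  · have h1 : v⁻¹ • i ≠ j := by rintro rfl; exact hA (smul_inv_smul v i)
    have h2 : v⁻¹ • i ≠ negIdx P j := by
      intro h
      apply hB
      rw [← smul_inv_smul v i, h, smul_negIdx, negIdx_negIdx]
    have l1 : b.IsPos ((v * ofIdx P j)⁻¹ • i) ↔ b.IsPos (v⁻¹ • i) := by
      rw [mul_inv_rev, mul_smul, ofIdx_inv]
      exact isPos_ofIdx_smul_iff b hj h1 h2
    have r1 : b.IsPos ((ofIdx P i * v) • j) ↔ b.IsPos (v • j) := by
      rw [mul_smul]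
      exact isPos_ofIdx_smul_iff b hi hA hB
    by_cases hl : b.IsPos (v⁻¹ • i) <;> by_cases hr : b.IsPos (v • j)
    · rw [rightMul_of_pos b hr, leftMul_of_pos b hl]
      simp only [map_neg, map_smul]
      rw [leftMul_of_pos b (l1.mpr hl), rightMul_of_pos b (r1.mpr hr), hassoc]
    · rw [rightMul_of_neg b hr, leftMul_of_pos b hl]
      simp only [map_neg, map_smul, map_sub]
      rw [leftMul_of_pos b (l1.mpr hl), rightMul_of_neg b (fun h => hr (r1.mp h)),
        leftMul_of_pos b hl, hassoc]
      module
    · rw [rightMul_of_pos b hr, leftMul_of_neg b hl]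
      simp only [map_neg, map_smul, map_sub]
      rw [leftMul_of_neg b (fun h => hl (l1.mp h)), rightMul_of_pos b (r1.mpr hr),
        rightMul_of_pos b hr, hassoc]
      module
    · rw [rightMul_of_neg b hr, leftMul_of_neg b hl]
      simp only [map_neg, map_smul, map_sub]
      rw [leftMul_of_neg b (fun h => hl (l1.mp h)), rightMul_of_neg b (fun h => hr (r1.mp h)),
        rightMul_of_neg b hr, leftMul_of_neg b hl, hassoc]
      module

/-- An operator commuting with all left multiplications and reaching v from 1 reduces identities
among products of left multiplications to their value at 1. -/
lemma exists_rightMul (v : P.weylGroup) : ∃ (R : Module.End KK (P.weylGroup →₀ KK)) (c : KK),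
    IsUnit c ∧ (∀ i ∈ b.support, leftMul b i * R = R * leftMul b i) ∧
      R (Finsupp.single 1 1) = c • Finsupp.single v 1 := by
  rw [← inv_inv v]
  refine weyl_induction b (p := fun w => ∃ (R : Module.End KK (P.weylGroup →₀ KK)) (c : KK),
    IsUnit c ∧ (∀ i ∈ b.support, leftMul b i * R = R * leftMul b i) ∧
      R (Finsupp.single 1 1) = c • Finsupp.single w⁻¹ 1) ?_ ?_ v⁻¹
  · exact ⟨1, 1, isUnit_one, fun i _ => by simp, by simp⟩
  · rintro j hj w hp ⟨R, c, hc, hR, h1⟩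
    refine ⟨rightMul b j * R, -(c * tHalf (-1)), (hc.mul (isUnit_tHalf _)).neg, ?_, ?_⟩
    · intro i hi
      rw [← mul_assoc, leftMul_rightMul b hi hj, mul_assoc, hR i hi, mul_assoc]
    · change rightMul b j (R _) = _
      rw [h1, map_smul, rightMul_of_pos b hp, mul_inv_rev, ofIdx_inv]
      module

lemma leftMul_word_one {l : List ι} (hl : ReducedWord b l) :
    (l.map (leftMul b)).prod (Finsupp.single 1 1) =
      (-tHalf (-1)) ^ l.length • Finsupp.single (wordProd P l) 1 := by
  induction l with
  | nil => simp
  | cons i l ih =>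
    obtain ⟨h1, h2⟩ := hl.tail
    rw [List.map_cons, List.prod_cons]
    change leftMul b i _ = _
    rw [ih h1, map_smul, leftMul_of_pos b h2, wordProd_cons, List.length_cons, pow_succ]
    module

/-- On the regular module, the product of generators along a reduced word depends on the
product of the word only. -/
lemma leftMul_word_eq {l l' : List ι} (hl : ReducedWord b l) (hl' : ReducedWord b l')
    (h : wordProd P l = wordProd P l') :
    (l.map (leftMul b)).prod = (l'.map (leftMul b)).prod := by
  have hlen : l.length = l'.length := by rw [← hl.2, ← hl'.2, h]
  refine Finsupp.lhom_ext' fun v => LinearMap.ext_ring ?_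
  change (l.map (leftMul b)).prod (Finsupp.single v 1) =
    (l'.map (leftMul b)).prod (Finsupp.single v 1)
  obtain ⟨R, c, hc, hR, h1⟩ := exists_rightMul b v
  have hcomm : ∀ l : List ι, (∀ i ∈ l, i ∈ b.support) →
      (l.map (leftMul b)).prod * R = R * (l.map (leftMul b)).prod := by
    intro l hl
    induction l with
    | nil => simp
    | cons i l ih =>
      rw [List.map_cons, List.prod_cons, mul_assoc,
        ih fun j hj => hl j (List.mem_cons_of_mem _ hj), ← mul_assoc,
        hR i (hl i List.mem_cons_self), mul_assoc]
  -- At 1 a reduced word gives its product times a scalar that depends on the length only; R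
  -- transports this to v.
  have key : ∀ l : List ι, ReducedWord b l → c • (l.map (leftMul b)).prod (Finsupp.single v 1) =
      (-tHalf (-1)) ^ l.length • R (Finsupp.single (wordProd P l) 1) := by
    intro l hl
    rw [← map_smul, ← h1, ← map_smul, ← leftMul_word_one b hl]
    exact LinearMap.congr_fun (hcomm l hl.1) _
  rw [← hc.smul_left_cancel, key l hl, key l' hl', h, hlen]

end RegularRepresentation

/-! ### Braid relations modulo terms of smaller norm. -/

section LeadingTerms

variable {ι X Y : Type*} [Fintype ι] [AddCommGroup X] [AddCommGroup Y]
  {P : RootDatum ι X Y} (b : P.Base)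

/-- A common recursion for all counts of inversions subject to a condition carried along by sᵢ:
`orthCount`, `alcoveExp`, and the off-wall count in `ket_dot_sub_mem`. -/
lemma card_filter_inversions [P.IsReduced] {i : ι} (hi : i ∈ b.support) {w : P.weylGroup}
    (h : b.IsPos (w⁻¹ • i)) (p p' : ι → Prop) [DecidablePred p] [DecidablePred p']
    (hp : ∀ k, p' (ofIdx P i • k) ↔ p k) :
    ((inversions b (ofIdx P i * w)).filter p').card =
      ((inversions b w).filter p).card + if p' i then 1 else 0 := by
  classical
  obtain ⟨hn, e⟩ := inversions_ofIdx_mul b hi h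
  have e2 : (((inversions b w).map (MulAction.toPerm (ofIdx P i)).toEmbedding).filter p').card =
      ((inversions b w).filter p).card := by
    rw [Finset.filter_map, Finset.card_map]
    congr 1
    exact Finset.filter_congr fun k _ => hp k
  rw [e, Finset.filter_cons]
  split_ifs with hpi
  · rw [Finset.card_cons, e2]
  · rw [e2, add_zero]

/-- The number of positive roots `α` orthogonal to `λ` with `v α` negative. -/
def orthCount (lam : X) (v : P.weylGroup) : ℕ := by
  classical exact ((inversions b v).filter fun k => P.coroot' k (v • lam) = 0).card

lemma orthCount_ofIdx_mul [P.IsReduced] {i : ι} (hi : i ∈ b.support) {v : P.weylGroup}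
    (h : b.IsPos (v⁻¹ • i)) (lam : X) : orthCount b lam (ofIdx P i * v) =
      orthCount b lam v + if P.coroot' i (v • lam) = 0 then 1 else 0 := by
  rw [orthCount, card_filter_inversions b hi h (fun k => P.coroot' k (v • lam) = 0), orthCount]
  · rw [mul_smul, coroot'_ofIdx_smul]
    simp only [neg_eq_zero]
  · intro k
    rw [mul_smul, pairing_smul]

/-- The comparison map from the regular module of the Hecke algebra to `𝕂[X]`. -/
def orbitMap (lam : X) : (P.weylGroup →₀ KK) →ₗ[KK] KX X :=
  Finsupp.linearCombination KK fun v => tHalf (2 * orthCount b lam v) • xpow (v • lam)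

lemma orbitMap_single (lam : X) (v : P.weylGroup) :
    orbitMap b lam (Finsupp.single v 1) = tHalf (2 * orthCount b lam v) • xpow (v • lam) := by
  rw [orbitMap, Finsupp.linearCombination_single, one_smul]

variable [P.IsReduced]

/-- If sᵢ fixes vλ and lengthens v, the operator multiplies X^{vλ} by -t^{1/2}, while `leftMul`
passes from v to sᵢv with factor -t^{-1/2}. The discrepancy t is the weight recorded by `orthCount`.
-/
lemma demLus_orbitMap_single {i : ι} (hi : i ∈ b.support) {lam : X}
    (hlam : ∀ j ∈ b.support, 0 ≤ P.coroot' j lam) (v : P.weylGroup) :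
    demLus P i (orbitMap b lam (Finsupp.single v 1)) -
      orbitMap b lam (leftMul b i (Finsupp.single v 1)) ∈ normLT P (form P lam lam) := by
  have hn : form P (v • lam) (v • lam) = form P lam lam := form_smul _ _ _
  have hc : P.coroot' i (v • lam) = P.coroot' (v⁻¹ • i) lam := by
    rw [← pairing_smul v lam (v⁻¹ • i), smul_inv_smul]
  by_cases h : b.IsPos (v⁻¹ • i)
  · have h0 : 0 ≤ P.coroot' i (v • lam) := hc ▸ coroot'_nonneg_of_isPos b hlam h
    have e := orthCount_ofIdx_mul b hi h lam
    rw [leftMul_of_pos b h, map_neg, map_smul, orbitMap_single, orbitMap_single, e, map_smul,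
      mul_smul]
    rcases h0.lt_or_eq with h0 | h0
    · rw [if_neg h0.ne', add_zero]
      have h1 := Submodule.smul_mem _ (tHalf (2 * orthCount b lam v)) (demLus_xpow_of_pos h0)
      rw [hn] at h1
      convert! h1 using 1
      module
    · rw [if_pos h0.symm, demLus_xpow_of_zero h0.symm, ofIdx_smul_wt, ← h0, zero_smul, sub_zero]
      convert! Submodule.zero_mem _ using 1
      rw [smul_neg, smul_smul, smul_smul, tHalf_mul, tHalf_mul, sub_neg_eq_add, neg_add_eq_zero]
      congr 2
      push_cast
      ring
  · have h0 : P.coroot' i (v • lam) ≤ 0 := by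
      rw [← isPos_neg, ← smul_negIdx] at h
      have := coroot'_nonneg_of_isPos b hlam h
      rw [smul_negIdx, coroot'_neg, ← hc] at this
      omega
    rw [← isPos_ofIdx_mul_inv_smul] at h
    have e := orthCount_ofIdx_mul b hi h lam
    rw [isPos_ofIdx_mul_inv_smul] at h
    rw [ofIdx_mul_cancel, mul_smul, coroot'_ofIdx_smul] at e
    simp only [neg_eq_zero] at e
    rw [leftMul_of_neg b h, map_sub, map_neg, map_smul, map_smul, orbitMap_single, orbitMap_single,
      map_smul, mul_smul]
    rcases h0.lt_or_eq with h0 | h0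
    · rw [if_neg h0.ne, add_zero] at e
      have h1 := Submodule.smul_mem _ (tHalf (2 * orthCount b lam v)) (demLus_xpow_of_neg h0)
      rw [hn] at h1
      convert! h1 using 1
      rw [e]
      module
    · rw [if_pos h0] at e
      rw [demLus_xpow_of_zero h0, ofIdx_smul_wt, h0, zero_smul, sub_zero, e]
      convert! Submodule.zero_mem _ using 1
      have e1 : tHalf (2 * ((orthCount b lam (ofIdx P i * v) + 1 : ℕ) : ℤ)) =
          tHalf 1 * tHalf 1 * tHalf (2 * (orthCount b lam (ofIdx P i * v) : ℤ)) := by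
        rw [tHalf_mul, tHalf_mul]
        congr 1
        push_cast
        ring
      have e2 : tHalf (-1) * tHalf 1 = 1 := by rw [tHalf_mul]; exact tHalf_zero
      rw [e1]
      generalize tHalf (2 * (orthCount b lam (ofIdx P i * v) : ℤ)) = E
      trans ((1 - tHalf (-1) * tHalf 1) * (tHalf 1 * E)) • xpow (v • lam)
      · module
      · rw [e2, sub_self, zero_mul, zero_smul]

variable (P) in
/-- The product of the Demazure-Lusztig operators along a word. -/
def demWord (l : List ι) : Module.End KK (KX X) := (l.map (demLus P)).prod

@[simp] lemma demWord_nil : demWord P [] = 1 := rfl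

lemma demWord_cons (i : ι) (l : List ι) (f : KX X) :
    demWord P (i :: l) f = demLus P i (demWord P l f) := by
  simp [demWord]

lemma demWord_append (l l' : List ι) (f : KX X) :
    demWord P (l ++ l') f = demWord P l (demWord P l' f) := by
  simp [demWord]

lemma demLus_orbitMap {i : ι} (hi : i ∈ b.support) {lam : X}
    (hlam : ∀ j ∈ b.support, 0 ≤ P.coroot' j lam) (x : P.weylGroup →₀ KK) :
    demLus P i (orbitMap b lam x) - orbitMap b lam (leftMul b i x) ∈
      normLT P (form P lam lam) := by
  induction x using Finsupp.induction_linear with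
  | zero => simp
  | add x y hx hy =>
    simp only [map_add]
    rw [add_sub_add_comm]
    exact add_mem hx hy
  | single v c =>
    have e : Finsupp.single v c = c • Finsupp.single v 1 := by simp
    rw [e]
    simp only [map_smul]
    rw [← smul_sub]
    exact Submodule.smul_mem _ _ (demLus_orbitMap_single b hi hlam v)

lemma demWord_orbitMap {l : List ι} (hl : ∀ i ∈ l, i ∈ b.support) {lam : X}
    (hlam : ∀ j ∈ b.support, 0 ≤ P.coroot' j lam) (x : P.weylGroup →₀ KK) :
    demWord P l (orbitMap b lam x) - orbitMap b lam ((l.map (leftMul b)).prod x) ∈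
      normLT P (form P lam lam) := by
  induction l with
  | nil => simp
  | cons i l ih =>
    have h1 := demLus_mem_normLT i (ih fun j hj => hl j (List.mem_cons_of_mem _ hj))
    have h2 := demLus_orbitMap b (hl i List.mem_cons_self) hlam ((l.map (leftMul b)).prod x)
    rw [map_sub] at h1
    rw [demWord_cons, List.map_cons, List.prod_cons, Module.End.mul_apply]
    have h3 := add_mem h1 h2
    rwa [sub_add_sub_cancel] at h3

/-- Up to terms of smaller norm, the product of the Demazure-Lusztig operators along a reduced
word depends on the product of the word only. -/
lemma demWord_sub_mem {l l' : List ι} (hl : ReducedWord b l) (hl' : ReducedWord b l')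
    (h : wordProd P l = wordProd P l') (mu : X) :
    demWord P l (xpow mu) - demWord P l' (xpow mu) ∈ normLT P (form P mu mu) := by
  obtain ⟨w, hw⟩ := exists_smul_dominant b mu
  -- With wμ dominant, X^μ is up to a unit the image of the basis vector w⁻¹ under `orbitMap` at wμ.
  have h1 := demWord_orbitMap b hl.1 hw (Finsupp.single w⁻¹ 1)
  have h2 := demWord_orbitMap b hl'.1 hw (Finsupp.single w⁻¹ 1)
  rw [leftMul_word_eq b hl hl' h] at h1
  have h3 := sub_mem h1 h2
  rw [sub_sub_sub_cancel_right, orbitMap_single, inv_smul_smul, form_smul, map_smul, map_smul,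
    ← smul_sub] at h3
  exact (Submodule.smul_mem_iff_of_isUnit _ (isUnit_tHalf _)).mp h3

end LeadingTerms

/-! ### The constant-term functional with weight ∏(1 - X^α)/(1 - tX^α). -/

section ConstantTerm

variable {ι X Y : Type*} [Fintype ι] [AddCommGroup X] [AddCommGroup Y]
  {P : RootDatum ι X Y} (b : P.Base)

/-- The coefficients of the power series `(1 - x) / (1 - t x)`. -/
def geomCoeff : ℕ → KK
  | 0 => 1
  | m + 1 => tHalf 2 ^ m * (tHalf 2 - 1)

/-- Comparison of coefficients in (1 - t x)·(series) = 1 - x. -/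
lemma geomCoeff_succ (m : ℕ) :
    geomCoeff (m + 1) = tHalf 2 * geomCoeff m - if m = 0 then geomCoeff m else 0 := by
  cases m with
  | zero => simp [geomCoeff]
  | succ m => simp [geomCoeff, pow_succ]; ring

/-- The ways to write `β` as a sum of positive roots. -/
def rootPartitions (beta : X) : Set (ι → ℕ) :=
  {n | (∀ j, ¬ b.IsPos j → n j = 0) ∧ ∑ j, n j • P.root j = beta}

/-- The product of the coefficients of `(1 - x) / (1 - t x)` for a vector of exponents. -/
def partitionCoeff (n : ι → ℕ) : KK := ∏ j, geomCoeff (n j)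

lemma partitionCoeff_update [DecidableEq ι] (n : ι → ℕ) (i : ι) :
    partitionCoeff (Function.update n i (n i + 1)) =
      tHalf 2 * partitionCoeff n - if n i = 0 then partitionCoeff n else 0 := by
  have h1 : partitionCoeff n = geomCoeff (n i) * ∏ j ∈ Finset.univ.erase i, geomCoeff (n j) :=
    (Finset.mul_prod_erase _ _ (Finset.mem_univ i)).symm
  have h2 : partitionCoeff (Function.update n i (n i + 1)) =
      geomCoeff (n i + 1) * ∏ j ∈ Finset.univ.erase i, geomCoeff (n j) := by
    rw [partitionCoeff, ← Finset.mul_prod_erase _ _ (Finset.mem_univ i)]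
    congr 1
    · simp
    · refine Finset.prod_congr rfl fun j hj => ?_
      rw [Function.update_of_ne (Finset.ne_of_mem_erase hj)]
  rw [h1, h2, geomCoeff_succ, sub_mul, mul_assoc, ite_mul, zero_mul]

variable [P.IsReduced]

lemma form_sum_root (n : ι → ℕ) : form P (∑ j, n j • P.root j) (twoRho b) =
    ∑ j, (n j : ℤ) * form P (P.root j) (twoRho b) := by
  simp [map_sum, LinearMap.sum_apply]

lemma mul_form_nonneg {n : ι → ℕ} (hn : ∀ j, ¬ b.IsPos j → n j = 0) (j : ι) :
    (n j : ℤ) ≤ (n j : ℤ) * form P (P.root j) (twoRho b) := by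
  by_cases hj : b.IsPos j
  · exact le_mul_of_one_le_right (by omega) (form_root_twoRho_pos b hj)
  · simp [hn j hj]

/-- Every positive root has a positive integral product with 2ρ, so the product of β with 2ρ bounds
each multiplicity. -/
lemma finite_rootPartitions (beta : X) : (rootPartitions b beta).Finite := by
  classical
  refine (Set.finite_Iic fun _ : ι => (form P beta (twoRho b)).toNat).subset ?_
  rintro n ⟨hn, rfl⟩ j
  rw [form_sum_root]
  have h1 := mul_form_nonneg b hn j
  have h2 := Finset.single_le_sum (f := fun j => (n j : ℤ) * form P (P.root j) (twoRho b))
    (fun j _ => le_trans (by omega) (mul_form_nonneg b hn j)) (Finset.mem_univ j)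
  change n j ≤ (∑ j, (n j : ℤ) * form P (P.root j) (twoRho b)).toNat
  omega

/-- The finite set of ways to write `β` as a sum of positive roots. -/
def partitionFinset (beta : X) : Finset (ι → ℕ) := (finite_rootPartitions b beta).toFinset

lemma mem_partitionFinset {beta : X} {n : ι → ℕ} : n ∈ partitionFinset b beta ↔
    (∀ j, ¬ b.IsPos j → n j = 0) ∧ ∑ j, n j • P.root j = beta :=
  Set.Finite.mem_toFinset _

/-- The coefficient of `X^β` in `∏_{α > 0} (1 - X^α) / (1 - t X^α)`. -/
def denomCoeff (beta : X) : KK := ∑ n ∈ partitionFinset b beta, partitionCoeff n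

/-- The coefficient of `X^β` in `∏_{α > 0, α ≠ αᵢ} (1 - X^α) / (1 - t X^α)`. -/
def denomCoeffErase (i : ι) (beta : X) : KK :=
  ∑ n ∈ (partitionFinset b beta).filter fun n => n i = 0, partitionCoeff n

/-- The coefficientwise form of (1 - tX^αᵢ)Δ = (1 - X^αᵢ)Δᵢ, where Δ is the weight and Δᵢ omits the
factor of αᵢ. Partitions containing αᵢ are matched with partitions of β - αᵢ by removing one copy.
-/
lemma denomCoeff_sub {i : ι} (hi : b.IsPos i) (beta : X) :
    denomCoeff b beta - tHalf 2 * denomCoeff b (beta - P.root i) =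
      denomCoeffErase b i beta - denomCoeffErase b i (beta - P.root i) := by
  classical
  have h1 : denomCoeff b beta = denomCoeffErase b i beta +
      ∑ n ∈ (partitionFinset b beta).filter fun n => ¬ n i = 0, partitionCoeff n :=
    (Finset.sum_filter_add_sum_filter_not _ _ _).symm
  have h2 : ∑ n ∈ (partitionFinset b beta).filter (fun n => ¬ n i = 0), partitionCoeff n =
      ∑ n ∈ partitionFinset b (beta - P.root i),
        partitionCoeff (Function.update n i (n i + 1)) := by
    have hsum : ∀ (n : ι → ℕ) (m : ℕ), ∑ j, (Function.update n i m) j • P.root j =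
        m • P.root i + ∑ j ∈ Finset.univ.erase i, n j • P.root j := by
      intro n m
      rw [← Finset.add_sum_erase _ _ (Finset.mem_univ i), Function.update_self]
      congr 1
      refine Finset.sum_congr rfl fun j hj => ?_
      rw [Function.update_of_ne (Finset.ne_of_mem_erase hj)]
    symm
    refine Finset.sum_bij' (fun n _ => Function.update n i (n i + 1))
      (fun n _ => Function.update n i (n i - 1)) ?_ ?_ ?_ ?_ ?_
    · intro n hn
      rw [mem_partitionFinset] at hn
      rw [Finset.mem_filter, mem_partitionFinset]
      refine ⟨⟨fun j hj => ?_, ?_⟩, by simp⟩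
      · rw [Function.update_of_ne (by rintro rfl; exact hj hi), hn.1 j hj]
      · rw [hsum, ← sub_add_cancel beta (P.root i), ← hn.2,
          ← Finset.add_sum_erase _ (fun j => n j • P.root j) (Finset.mem_univ i)]
        module
    · intro n hn
      rw [Finset.mem_filter, mem_partitionFinset] at hn
      obtain ⟨⟨h1, h2⟩, h3⟩ := hn
      obtain ⟨m, hm⟩ := Nat.exists_eq_succ_of_ne_zero h3
      rw [mem_partitionFinset]
      refine ⟨fun j hj => ?_, ?_⟩
      · rw [Function.update_of_ne (by rintro rfl; exact hj hi), h1 j hj]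
      · rw [hsum, ← h2, ← Finset.add_sum_erase _ (fun j => n j • P.root j) (Finset.mem_univ i), hm,
          Nat.succ_sub_one, Nat.succ_eq_add_one]
        module
    · intro n _
      simp
    · intro n hn
      rw [Finset.mem_filter] at hn
      simp [Nat.sub_add_cancel (Nat.one_le_iff_ne_zero.mpr hn.2)]
    · intro n _
      rfl
  rw [h1, h2]
  simp only [partitionCoeff_update, Finset.sum_sub_distrib, ← Finset.mul_sum]
  rw [← Finset.sum_filter, denomCoeff, denomCoeffErase, denomCoeffErase]
  ring

lemma isPos_ofIdx_smul_of_not {i j : ι} (hi : i ∈ b.support) (hj : ¬ b.IsPos j)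
    (h : b.IsPos (ofIdx P i • j)) : ofIdx P i • j = i := by
  by_contra hne
  have := isPos_ofIdx_smul b hi h hne
  rw [ofIdx_smul_smul] at this
  exact hj this

/-- The product Δᵢ runs over the positive roots other than αᵢ, which sᵢ permutes. -/
lemma denomCoeffErase_smul {i : ι} (hi : i ∈ b.support) (beta : X) :
    denomCoeffErase b i (ofIdx P i • beta) = denomCoeffErase b i beta := by
  have key : ∀ (beta : X) (n : ι → ℕ), n ∈ (partitionFinset b beta).filter (fun n => n i = 0) →
      (fun j => n (ofIdx P i • j)) ∈
        (partitionFinset b (ofIdx P i • beta)).filter (fun n => n i = 0) := by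
    intro beta n hn
    rw [Finset.mem_filter, mem_partitionFinset] at hn ⊢
    obtain ⟨⟨h1, h2⟩, h3⟩ := hn
    refine ⟨⟨fun j hj => ?_, ?_⟩, ?_⟩
    · by_cases h : b.IsPos (ofIdx P i • j)
      · rw [isPos_ofIdx_smul_of_not b hi hj h, h3]
      · exact h1 _ h
    · rw [← h2, Finset.smul_sum]
      refine Fintype.sum_equiv (MulAction.toPerm (ofIdx P i)) _ _ fun j => ?_
      change _ = ofIdx P i • n (ofIdx P i • j) • P.root (ofIdx P i • j)
      rw [smul_comm, ← root_smul, ofIdx_smul_smul]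
    · apply h1
      rw [ofIdx_smul_self, isPos_neg]
      exact not_not.mpr (RootPairing.Base.isPos_of_mem_support hi)
  refine (Finset.sum_bij' (fun n _ => fun j => n (ofIdx P i • j))
    (fun n _ => fun j => n (ofIdx P i • j)) (key beta) ?_ ?_ ?_ ?_).symm
  · intro n hn
    have := key _ n hn
    rwa [ofIdx_smul_smul_wt] at this
  · intro n _
    funext j
    simp only [ofIdx_smul_smul]
  · intro n _
    funext j
    simp only [ofIdx_smul_smul]
  · intro n _
    exact (Fintype.prod_equiv (MulAction.toPerm (ofIdx P i)) _ _ fun j => rfl).symm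

lemma denomCoeff_eq_zero {beta : X} (h : form P beta (twoRho b) ≤ 0) (hne : beta ≠ 0) :
    denomCoeff b beta = 0 := by
  rw [denomCoeff, Finset.sum_eq_zero]
  intro n hn
  rw [mem_partitionFinset] at hn
  obtain ⟨h1, rfl⟩ := hn
  exfalso
  apply hne
  rw [form_sum_root] at h
  have h2 : ∀ j ∈ Finset.univ, 0 ≤ (n j : ℤ) * form P (P.root j) (twoRho b) :=
    fun j _ => le_trans (by omega) (mul_form_nonneg b h1 j)
  have h3 := (Finset.sum_eq_zero_iff_of_nonneg h2).mp (le_antisymm h (Finset.sum_nonneg h2))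
  refine Finset.sum_eq_zero fun j hj => ?_
  have h4 := mul_form_nonneg b h1 j
  rw [h3 j hj] at h4
  rw [show n j = 0 by omega, zero_smul]

lemma denomCoeff_zero : denomCoeff b 0 = 1 := by
  have h : partitionFinset b 0 = {0} := by
    ext n
    rw [mem_partitionFinset, Finset.mem_singleton]
    constructor
    · rintro ⟨h1, h2⟩
      have h3 := form_sum_root b n
      rw [h2, map_zero, LinearMap.zero_apply] at h3
      have h4 : ∀ j ∈ Finset.univ, 0 ≤ (n j : ℤ) * form P (P.root j) (twoRho b) :=
        fun j _ => le_trans (by omega) (mul_form_nonneg b h1 j)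
      have h5 := (Finset.sum_eq_zero_iff_of_nonneg h4).mp h3.symm
      funext j
      have h6 := mul_form_nonneg b h1 j
      rw [h5 j (Finset.mem_univ j)] at h6
      exact Nat.le_zero.mp (by exact_mod_cast h6)
    · rintro rfl
      simp
  rw [denomCoeff, h, Finset.sum_singleton, partitionCoeff]
  simp [geomCoeff]

/-- The constant term of `f · ∏_{α > 0} (1 - X^α) / (1 - t X^α)`. -/
def constTerm : KX X →ₗ[KK] KK := kxLift fun mu => denomCoeff b (-mu)

/-- The constant term of `f · ∏_{α > 0, α ≠ αᵢ} (1 - X^α) / (1 - t X^α)`. -/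
def constTermErase (i : ι) : KX X →ₗ[KK] KK := kxLift fun mu => denomCoeffErase b i (-mu)

lemma constTerm_mul {i : ι} (hi : b.IsPos i) (f : KX X) :
    constTerm b ((1 - tHalf 2 • xpow (P.root i)) * f) =
      constTermErase b i ((1 - xpow (P.root i)) * f) := by
  suffices h : constTerm b ∘ₗ LinearMap.mulLeft KK (1 - tHalf 2 • xpow (P.root i)) =
      constTermErase b i ∘ₗ LinearMap.mulLeft KK (1 - xpow (P.root i)) from LinearMap.congr_fun h f
  refine kx_hom_ext fun mu => ?_
  change constTerm b ((1 - tHalf 2 • xpow (P.root i)) * xpow mu) =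
      constTermErase b i ((1 - xpow (P.root i)) * xpow mu)
  rw [sub_mul, sub_mul, one_mul, smul_mul_assoc, xpow_mul, map_sub, map_sub, map_smul]
  simp only [constTerm, constTermErase, kxLift_xpow]
  have h := denomCoeff_sub b hi (-mu)
  rwa [show -mu - P.root i = -(P.root i + mu) by abel] at h

lemma constTermErase_weylAct {i : ι} (hi : i ∈ b.support) (f : KX X) :
    constTermErase b i (weylAct (ofIdx P i) f) = constTermErase b i f := by
  suffices h : constTermErase b i ∘ₗ (weylAct (ofIdx P i)).toLinearMap = constTermErase b i from
    LinearMap.congr_fun h f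
  refine kx_hom_ext fun mu => ?_
  change constTermErase b i (weylAct (ofIdx P i) (xpow mu)) = _
  rw [weylAct_xpow]
  simp only [constTermErase, kxLift_xpow]
  rw [← smul_neg, denomCoeffErase_smul b hi]

/-- The constant term form is nondegenerate on the span of the `X^μ` with `(μ, μ) < n`. -/
lemma eq_zero_of_constTerm {n : ℤ} {g : KX X} (hg : g ∈ normLT P n)
    (h : ∀ kap : X, form P kap kap < n → constTerm b (g * xpow kap) = 0) : g = 0 := by
  by_contra hne
  have hsupp : g.coeff.support.Nonempty := by
    rw [Finsupp.support_nonempty_iff]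
    exact fun h => hne (AddMonoidAlgebra.coeff_eq_zero.mp h)
  obtain ⟨kap, hk, hmin⟩ := Finset.exists_min_image g.coeff.support
    (fun kap => form P kap (twoRho b)) hsupp
  have hlt : form P kap kap < n := by
    by_contra! hle
    exact (Finsupp.mem_support_iff.mp hk) (coeff_eq_zero_of_mem_normLT hg hle)
  -- κ is an exponent of g with minimal product with 2ρ. Pairing with X^{-κ} leaves only κ: another
  -- exponent ν would require κ - ν to be a nonzero sum of positive roots, against minimality.
  have h1 := h (-kap) (by simpa using hlt)
  rw [← sum_coeff_smul_xpow g, Finset.sum_mul, map_sum] at h1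
  simp only [smul_mul_assoc, xpow_mul, map_smul, constTerm, kxLift_xpow] at h1
  rw [Finset.sum_eq_single kap] at h1
  · rw [add_neg_cancel, neg_zero, denomCoeff_zero, smul_eq_mul, mul_one] at h1
    exact (Finsupp.mem_support_iff.mp hk) h1
  · intro nu hnu hne
    rw [denomCoeff_eq_zero, smul_zero]
    · have := hmin nu hnu
      simp only [map_neg, map_add, LinearMap.add_apply, LinearMap.neg_apply]
      omega
    · intro h0
      apply hne
      rw [neg_eq_zero, add_neg_eq_zero] at h0
      exact h0
  · exact fun h => absurd hk h

end ConstantTerm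

/-! ### Self-adjointness and the braid relations for Demazure-Lusztig operators. -/

section SelfAdjoint

variable {ι X Y : Type*} [Fintype ι] [AddCommGroup X] [AddCommGroup Y]
  {P : RootDatum ι X Y} (b : P.Base)

/-- X is free, so its coordinates embed it in a group with two unique sums, which rules out zero
divisors. -/
lemma isDomain_kx [Module.Finite ℤ X] (P : RootDatum ι X Y) : IsDomain (KX X) := by
  have : Module.IsReflexive ℤ X := .of_isPerfPair P.toLinearMap
  have : Module.Free ℤ X := inferInstance
  have : TwoUniqueSums X := TwoUniqueSums.of_injective_addHom
    (Module.Free.chooseBasis ℤ X).repr.toAddMonoidHom.toAddHom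
    (Module.Free.chooseBasis ℤ X).repr.injective inferInstance
  have : NoZeroDivisors (KX X) := inferInstance
  exact NoZeroDivisors.to_isDomain _

lemma xpow_root_sub_one_ne_zero (i : ι) : xpow (P.root i) - 1 ≠ 0 := by
  rw [sub_ne_zero, ← xpow_zero, xpow, xpow]
  intro h
  rw [AddMonoidAlgebra.single_left_inj one_ne_zero] at h
  have := coroot'_root (P := P) i
  rw [h, map_zero] at this
  norm_num at this

variable [Module.Finite ℤ X]

/-- The commutator of a Demazure-Lusztig operator with multiplication, symmetrized. -/
lemma demLus_mul_sub (i : ι) (f g : KX X) :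
    demLus P i f * g - f * demLus P i g =
      -(tHalf (-1) • ((1 - tHalf 2 • xpow (P.root i)) *
        demazure P i (f * weylAct (ofIdx P i) g))) := by
  have := isDomain_kx P
  -- After multiplication by X^αᵢ - 1 every Demazure quotient is replaced by its numerator, and a
  -- polynomial identity modulo t^{1/2}·t^{-1/2} = 1 remains.
  apply mul_left_cancel₀ (xpow_root_sub_one_ne_zero (P := P) i)
  have h1 := mul_demazure (P := P) i f
  have h2 := mul_demazure (P := P) i g
  have h3 := mul_demazure (P := P) i (f * weylAct (ofIdx P i) g)
  have hs : weylAct (ofIdx P i) (weylAct (ofIdx P i) g) = g := by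
    suffices h : (weylAct (ofIdx P i)).toLinearMap ∘ₗ (weylAct (ofIdx P i)).toLinearMap =
        LinearMap.id from LinearMap.congr_fun h g
    refine kx_hom_ext fun mu => ?_
    change weylAct (ofIdx P i) (weylAct (ofIdx P i) (xpow mu)) = xpow mu
    rw [weylAct_xpow, weylAct_xpow, ofIdx_smul_smul_wt]
  rw [map_mul (weylAct (ofIdx P i)), hs] at h3
  have hq : algebraMap KK (KX X) (tHalf (-1)) * algebraMap KK (KX X) (tHalf 1) = 1 := by
    rw [← map_mul, tHalf_mul]
    exact (algebraMap KK (KX X)).map_one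
  have ht : algebraMap KK (KX X) (tHalf 2) =
      algebraMap KK (KX X) (tHalf 1) * algebraMap KK (KX X) (tHalf 1) := by
    rw [← map_mul, tHalf_mul]
    rfl
  rw [demLus_apply, demLus_apply]
  simp only [Algebra.smul_def, map_sub, ht]
  generalize algebraMap KK (KX X) (tHalf 1) = q at *
  generalize algebraMap KK (KX X) (tHalf (-1)) = q' at *
  generalize demazure P i f = d1 at *
  generalize demazure P i g = d2 at *
  generalize demazure P i (f * weylAct (ofIdx P i) g) = d3 at *
  generalize weylAct (ofIdx P i) f = sf at *
  generalize weylAct (ofIdx P i) g = sg at *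
  generalize xpow (P.root i) = x at *
  linear_combination (q - q') * g * h1 - (q - q') * f * h2 + q' * (1 - q * q * x) * h3
    - (f * sg - sf * g) * x * q * hq

variable [P.IsReduced]

/-- The Demazure-Lusztig operators are self-adjoint for the constant term form. -/
lemma constTerm_demLus {i : ι} (hi : i ∈ b.support) (f g : KX X) :
    constTerm b (demLus P i f * g) = constTerm b (f * demLus P i g) := by
  have h : (1 - xpow (P.root i)) * demazure P i (f * weylAct (ofIdx P i) g) =
      weylAct (ofIdx P i) (f * weylAct (ofIdx P i) g) - f * weylAct (ofIdx P i) g := by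
    rw [← neg_inj, neg_sub, ← mul_demazure]
    ring
  -- The commutator carries a factor 1 - tX^αᵢ. The functional exchanges it for 1 - X^αᵢ, which
  -- clears the Demazure denominator and leaves a difference sᵢh - h, killed by the sᵢ-invariant
  -- `constTermErase`.
  rw [← sub_eq_zero, ← map_sub, demLus_mul_sub, map_neg, map_smul,
    constTerm_mul b (RootPairing.Base.isPos_of_mem_support hi), h, map_sub,
    constTermErase_weylAct b hi, sub_self, smul_zero, neg_zero]

lemma constTerm_demWord {l : List ι} (hl : ∀ i ∈ l, i ∈ b.support) (f g : KX X) :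
    constTerm b (demWord P l f * g) = constTerm b (f * demWord P l.reverse g) := by
  induction l generalizing g with
  | nil => rfl
  | cons i l ih =>
    rw [demWord_cons, constTerm_demLus b (hl i List.mem_cons_self),
      ih fun j hj => hl j (List.mem_cons_of_mem _ hj), List.reverse_cons, demWord_append]
    rfl

/-- The product of the Demazure-Lusztig operators along a reduced word depends on the product of
the word only. -/
theorem demWord_eq {l l' : List ι} (hl : ReducedWord b l) (hl' : ReducedWord b l')
    (h : wordProd P l = wordProd P l') : demWord P l = demWord P l' := by
  have key : ∀ (n : ℕ) (l l' : List ι), ReducedWord b l → ReducedWord b l' →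
      wordProd P l = wordProd P l' → ∀ mu : X, form P mu mu < n →
        demWord P l (xpow mu) = demWord P l' (xpow mu) := by
    intro n
    induction n with
    | zero =>
      intro l l' _ _ _ mu hmu
      have := form_self_nonneg (P := P) mu
      omega
    | succ n ih =>
      intro l l' hl hl' h mu hmu
      rw [← sub_eq_zero]
      -- The difference has norm below (μ, μ), so it suffices to pair it with X^κ of smaller norm.
      -- Adjointness moves the operators to reversed words acting on X^κ, where the induction
      -- hypothesis applies.
      refine eq_zero_of_constTerm b (demWord_sub_mem b hl hl' h mu) fun kap hk => ?_
      rw [sub_mul, map_sub, constTerm_demWord b hl.1, constTerm_demWord b hl'.1,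
        ih _ _ hl.reverse hl'.reverse (by rw [wordProd_reverse, wordProd_reverse, h]) kap
          (by omega), sub_self]
  refine kx_hom_ext fun mu => key ((form P mu mu).toNat + 1) l l' hl hl' h mu ?_
  have := form_self_nonneg (P := P) mu
  omega

/-- The operator `Θ_w` on `𝕂[X]` with `Θ_{sᵢ u} = Θ_u T_i` if `sᵢ u` is longer than `u`. -/
def demTheta (w : P.weylGroup) : Module.End KK (KX X) :=
  demWord P (Classical.choose (exists_reducedWord b w⁻¹))

lemma demTheta_eq {l : List ι} (hl : ReducedWord b l) {w : P.weylGroup}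
    (h : wordProd P l = w⁻¹) : demTheta b w = demWord P l := by
  have hc := Classical.choose_spec (exists_reducedWord b w⁻¹)
  exact demWord_eq b hc.1 hl (hc.2.trans h.symm)

lemma demTheta_ofIdx_mul {i : ι} (hi : i ∈ b.support) {u : P.weylGroup} (h : b.IsPos (u⁻¹ • i))
    (f : KX X) : demTheta b (ofIdx P i * u) f = demTheta b u (demLus P i f) := by
  obtain ⟨l, hl, hlu⟩ := exists_reducedWord b u
  have h1 : ReducedWord b (i :: l) := hl.cons b hi (by rwa [hlu])
  rw [demTheta_eq b hl.reverse (w := u) (by rw [wordProd_reverse, hlu]),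
    demTheta_eq b h1.reverse (w := ofIdx P i * u) (by rw [wordProd_reverse, wordProd_cons, hlu]),
    List.reverse_cons, demWord_append]
  rfl

end SelfAdjoint

/-! ### Specialization at t^{1/2} = 1 and divisibility by t^{1/2} - 1. -/

section Specialization

/-- The specialization `t^{1/2} ↦ 1`. -/
def evalOne : KK →+* ℤ := LaurentPolynomial.eval₂ (RingHom.id ℤ) 1

@[simp] lemma evalOne_tHalf (n : ℤ) : evalOne (tHalf n) = 1 := by
  simp [evalOne, tHalf]

lemma dvd_tHalf_sub_one (n : ℤ) : tHalf 1 - 1 ∣ tHalf n - 1 := by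
  have h : ∀ m : ℕ, tHalf 1 - 1 ∣ tHalf m - 1 := by
    intro m
    have : tHalf m = tHalf 1 ^ m := by simp [tHalf, LaurentPolynomial.T_pow]
    rw [this]
    exact sub_one_dvd_pow_sub_one _ m
  obtain ⟨m, rfl | rfl⟩ := n.eq_nat_or_neg
  · exact h m
  · have e : tHalf (-(m : ℤ)) - 1 = (tHalf m - 1) * -tHalf (-m) := by
      rw [mul_neg, sub_mul, one_mul, tHalf_mul, add_neg_cancel, tHalf_zero]
      ring
    rw [e]
    exact (h m).mul_right _

lemma dvd_sub_evalOne (p : KK) : tHalf 1 - 1 ∣ p - (evalOne p : KK) := by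
  induction p using LaurentPolynomial.induction_on' with
  | add p q hp hq =>
    rw [map_add, Int.cast_add, add_sub_add_comm]
    exact dvd_add hp hq
  | C_mul_T n a =>
    have e : (LaurentPolynomial.C a : KK) = (a : KK) := map_intCast LaurentPolynomial.C a
    have e2 : evalOne (LaurentPolynomial.C a * LaurentPolynomial.T n) = a := by
      rw [e, map_mul, map_intCast]
      change (a : ℤ) * evalOne (tHalf n) = a
      rw [evalOne_tHalf, mul_one]
    rw [e2, e]
    have := (dvd_tHalf_sub_one n).mul_left (a : KK)
    rwa [mul_sub, mul_one] at this

lemma dvd_of_evalOne_eq_zero {p : KK} (h : evalOne p = 0) : tHalf 1 - 1 ∣ p := by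
  have := dvd_sub_evalOne p
  rwa [h, Int.cast_zero, sub_zero] at this

lemma isNoetherianRing_kk : IsNoetherianRing KK :=
  IsLocalization.isNoetherianRing (Submonoid.powers (Polynomial.X : Polynomial ℤ)) KK inferInstance

lemma tHalf_sub_one_ne_zero : tHalf 1 - 1 ≠ 0 := by
  rw [sub_ne_zero, ← tHalf_zero]
  intro h
  have h2 : (1 : ℤ) = 0 := (AddMonoidAlgebra.single_left_inj one_ne_zero).mp h
  exact one_ne_zero h2

/-- In a Noetherian domain a nonunit divides a nonzero element only finitely often; t^{1/2} - 1 is a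
nonunit because it specializes to 0. -/
lemma eq_zero_of_forall_pow_dvd {p : KK} (h : ∀ n : ℕ, (tHalf 1 - 1) ^ n ∣ p) : p = 0 := by
  have := isNoetherianRing_kk
  by_contra hne
  have hu : ¬ IsUnit (tHalf 1 - 1) := fun hu => by
    have := hu.map evalOne
    simp at this
  obtain ⟨n, hn⟩ := FiniteMultiplicity.of_not_isUnit hu hne
  exact hn (h _)

end Specialization

/-! ### Special values of Demazure-Lusztig operators. -/

section DemazureLusztig

variable {ι X Y : Type*} [Fintype ι] [AddCommGroup X] [AddCommGroup Y]
  {P : RootDatum ι X Y} (b : P.Base)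

/-- The coefficient of `X^ν`, specialized at `t^{1/2} = 1`. -/
def specCoeff (nu : X) : KX X →ₛₗ[evalOne] ℤ where
  toFun f := evalOne (f.coeff nu)
  map_add' f g := map_add evalOne (f.coeff nu) (g.coeff nu)
  map_smul' c f := map_mul evalOne c (f.coeff nu)

lemma specCoeff_apply (nu : X) (f : KX X) : specCoeff nu f = evalOne (f.coeff nu) := rfl

lemma specCoeff_xpow (mu nu : X) [Decidable (mu = nu)] :
    specCoeff nu (xpow mu) = if mu = nu then 1 else 0 := by
  rw [specCoeff_apply, coeff_xpow]
  split_ifs <;> simp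

lemma specCoeff_weylAct (w : P.weylGroup) (f : KX X) (nu : X) :
    specCoeff (w • nu) (weylAct w f) = specCoeff nu f :=
  congrArg evalOne
    (Finsupp.mapDomain_apply (f := fun x : X => w • x) (MulAction.injective w) f.coeff nu)

/-- The factor t^{1/2} - t^{-1/2} of the Demazure part dies, so Tᵢ specializes to -sᵢ. -/
lemma specCoeff_demLus (i : ι) (f : KX X) (nu : X) :
    specCoeff nu (demLus P i f) = -specCoeff (ofIdx P i • nu) f := by
  have h := specCoeff_weylAct (ofIdx P i) f (ofIdx P i • nu)
  rw [ofIdx_smul_smul_wt] at h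
  rw [demLus_apply, map_add, map_neg, map_smulₛₗ, map_smulₛₗ, h, map_sub]
  simp

variable [Module.Finite ℤ X]

lemma demLus_of_invariant {i : ι} {f : KX X} (h : weylAct (ofIdx P i) f = f) :
    demLus P i f = -(tHalf 1 • f) := by
  have := isDomain_kx P
  have h0 : demazure P i f = 0 := by
    apply mul_left_cancel₀ (xpow_root_sub_one_ne_zero (P := P) i)
    rw [mul_demazure, h, sub_self, mul_zero]
  rw [demLus_apply, h, h0, smul_zero, add_zero]

/-- Here f - sᵢf = (X^αᵢ - 1)sᵢf, so the Demazure operator returns sᵢf. Together with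
`demLus_of_invariant` this yields the two identities into which straightening relations translate.
-/
lemma demLus_of_shift {i : ι} {f : KX X} (h : xpow (P.root i) * weylAct (ofIdx P i) f = f) :
    tHalf 1 • demLus P i f = -weylAct (ofIdx P i) f := by
  have := isDomain_kx P
  have h0 : demazure P i f = weylAct (ofIdx P i) f := by
    apply mul_left_cancel₀ (xpow_root_sub_one_ne_zero (P := P) i)
    rw [mul_demazure, sub_mul, h, one_mul]
  have h1 : tHalf 1 * tHalf (-1) = 1 := by rw [tHalf_mul]; exact tHalf_zero
  rw [demLus_apply, h0]
  trans (-(tHalf 1 * tHalf (-1))) • weylAct (ofIdx P i) f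
  · module
  · rw [h1, neg_one_smul]

lemma demLus_add_smul (i : ι) (mu : X) :
    demLus P i (xpow mu + xpow (ofIdx P i • mu)) =
      -(tHalf 1 • (xpow mu + xpow (ofIdx P i • mu))) := by
  apply demLus_of_invariant
  rw [map_add, weylAct_xpow, weylAct_xpow, ofIdx_smul_smul_wt, add_comm]

lemma demLus_add_smul_add_root (i : ι) (mu : X) :
    tHalf 1 • demLus P i (xpow mu + xpow (ofIdx P i • mu + P.root i)) =
      -(xpow (mu - P.root i) + xpow (ofIdx P i • mu)) := by
  have e : ofIdx P i • P.root i = -P.root i := by rw [ofIdx_smul_wt, coroot'_root]; module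
  have h : weylAct (ofIdx P i) (xpow mu + xpow (ofIdx P i • mu + P.root i)) =
      xpow (mu - P.root i) + xpow (ofIdx P i • mu) := by
    rw [map_add, weylAct_xpow, weylAct_xpow, smul_add, ofIdx_smul_smul_wt, e, add_comm,
      sub_eq_add_neg]
  rw [demLus_of_shift, h]
  rw [h, mul_add, xpow_mul, xpow_mul, add_sub_cancel, add_comm (P.root i)]

variable [P.IsReduced]

lemma demTheta_one : demTheta b (1 : P.weylGroup) = 1 :=
  demTheta_eq b (l := []) ⟨by simp, by simp [length_one]⟩ (by simp)

lemma specCoeff_demTheta (w : P.weylGroup) (f : KX X) (nu : X) :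
    specCoeff nu (demTheta b w f) = (-1) ^ length b w * specCoeff (w • nu) f := by
  refine weyl_induction b (p := fun w => ∀ f, specCoeff nu (demTheta b w f) =
    (-1) ^ length b w * specCoeff (w • nu) f) ?_ ?_ w f
  · intro f
    rw [demTheta_one, length_one, one_smul, pow_zero, one_mul]
    rfl
  · intro i hi u hu ih f
    rw [demTheta_ofIdx_mul b hi hu, ih, specCoeff_demLus, length_ofIdx_mul b hi hu, mul_smul]
    ring

end DemazureLusztig

/-! ### Alcoves and the building blocks Θ_w(X^μ) of the detecting functionals. -/

section Independence

variable {ι X Y : Type*} [Fintype ι] [AddCommGroup X] [AddCommGroup Y]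
  {P : RootDatum ι X Y} (b : P.Base) (ℓ : ℕ)

lemma zsmul_left_cancel (P : RootDatum ι X Y) {n : ℤ} (hn : n ≠ 0) {x y : X}
    (h : n • x = n • y) : x = y := by
  have : Module.IsReflexive ℤ X := .of_isPerfPair P.toLinearMap
  exact smul_right_injective X hn h

lemma dot_add_zsmul (w : P.weylGroup) (x nu : X) (n : ℤ) :
    dot b w (x + n • nu) = dot b w x + n • (w • nu) := by
  rw [dot_add, smul_comm]

/-- The weights whose shift by `ρ` lies in the closed fundamental `ℓ`-alcove. -/
def InAlcove (eta : X) : Prop :=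
  ∀ j, b.IsPos j → 0 ≤ shiftedPairing b eta j ∧ shiftedPairing b eta j ≤ ℓ

/-- Unlike `dot_ofIdx` this covers all roots, as the reduction to the alcove reflects in nonsimple
ones. -/
lemma dot_ofIdx_eq_sub [P.IsReduced] (i : ι) (x : X) :
    dot b (ofIdx P i) x = x - shiftedPairing b x i • P.root i := by
  apply torsionFree P
  rw [two_smul_dot, ofIdx_smul_wt, ← two_mul_shiftedPairing]
  module

/-- Make x dominant for the dot action. If some positive α still pairs to m > ℓ, subtracting (m -
ℓ)α is an affine reflection that lowers the norm. -/
lemma exists_inAlcove [P.IsReduced] (hℓ : 0 < ℓ) (x : X) : ∃ (eta : X) (w : P.weylGroup) (nu : X),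
    InAlcove b ℓ eta ∧ x = dot b w (eta + (ℓ : ℤ) • nu) := by
  suffices h : ∀ (n : ℕ) (x : X), shiftedNorm b x < n → ∃ (eta : X) (w : P.weylGroup) (nu : X),
      InAlcove b ℓ eta ∧ x = dot b w (eta + (ℓ : ℤ) • nu) from
    h (shiftedNorm b x + 1).toNat x (by have := shiftedNorm_nonneg b x; omega)
  intro n
  induction n with
  | zero => intro x hx; have := shiftedNorm_nonneg b x; omega
  | succ n ih =>
    intro x hx
    obtain ⟨u, hu⟩ := exists_dot_dominant b x
    set y := dot b u x with hy
    have hxy : x = dot b u⁻¹ y := by rw [hy, ← dot_mul, inv_mul_cancel, dot_one]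
    by_cases hgood : ∀ j, b.IsPos j → shiftedPairing b y j ≤ ℓ
    · exact ⟨y, u⁻¹, 0, fun j hj => ⟨shiftedPairing_nonneg_of_isPos b hu hj, hgood j hj⟩,
        by rw [smul_zero, add_zero, hxy]⟩
    push Not at hgood
    obtain ⟨j, hj, hlt⟩ := hgood
    set m := shiftedPairing b y j with hm
    have hnorm := shiftedNorm_sub_zsmul b y j (m - ℓ)
    rw [← hm, sub_sub_cancel] at hnorm
    have hpos : 0 < 4 * (m - ℓ) * (ℓ : ℤ) * form P (P.root j) (P.root j) :=
      mul_pos (mul_pos (by omega) (by omega)) (form_root_pos j)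
    have hN : shiftedNorm b y = shiftedNorm b x := shiftedNorm_dot b u x
    obtain ⟨eta, w, nu, h1, h2⟩ := ih (y - (m - ℓ) • P.root j) (by push_cast at hx; omega)
    -- With z = y - (m - ℓ)α one has y = s_α∘z + ℓα; the added translation is ℓα pulled back through
    -- the finite part.
    refine ⟨eta, u⁻¹ * ofIdx P j * w, nu + (u⁻¹ * ofIdx P j * w)⁻¹ • u⁻¹ • P.root j, h1, ?_⟩
    rw [smul_add, ← add_assoc, dot_add_zsmul, smul_inv_smul, mul_assoc, dot_mul, dot_mul, ← h2,
      ← dot_add_zsmul, hxy]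
    congr 1
    rw [dot_ofIdx_eq_sub, sub_eq_add_neg y, shiftedPairing_add, map_neg, map_smul, coroot'_root,
      ← hm, smul_eq_mul]
    module

variable [Module.Finite ℤ X] [P.IsReduced]

open Classical in
/-- `Θ_w(X^μ)` if `x = w ∘ η + ℓμ`, and zero if `x` is not of this form. -/
def thetaKet (eta : X) (w : P.weylGroup) (x : X) : KX X :=
  if h : ∃ mu : X, x = dot b w eta + (ℓ : ℤ) • mu then demTheta b w (xpow h.choose) else 0

lemma thetaKet_of_eq (hℓ : 0 < ℓ) {eta : X} {w : P.weylGroup} {x mu : X}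
    (hx : x = dot b w eta + (ℓ : ℤ) • mu) :
    thetaKet b ℓ eta w x = demTheta b w (xpow mu) := by
  have h : ∃ mu : X, x = dot b w eta + (ℓ : ℤ) • mu := ⟨mu, hx⟩
  rw [thetaKet, dif_pos h]
  have h2 := h.choose_spec
  have h3 : h.choose = mu :=
    zsmul_left_cancel P (n := ℓ) (by omega) (add_left_cancel (h2.symm.trans hx))
  rw [h3]

lemma thetaKet_of_ne {eta : X} {w : P.weylGroup} {x : X}
    (h : ∀ mu : X, x ≠ dot b w eta + (ℓ : ℤ) • mu) : thetaKet b ℓ eta w x = 0 := by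
  rw [thetaKet, dif_neg]
  rintro ⟨mu, hmu⟩
  exact h mu hmu

lemma specCoeff_thetaKet (hℓ : 0 < ℓ) (eta : X) (w : P.weylGroup)
    (x nu : X) [Decidable (x = dot b w (eta + (ℓ : ℤ) • nu))] :
    specCoeff nu (thetaKet b ℓ eta w x) =
      (-1) ^ length b w * if x = dot b w (eta + (ℓ : ℤ) • nu) then 1 else 0 := by
  classical
  by_cases h : ∃ mu : X, x = dot b w eta + (ℓ : ℤ) • mu
  · obtain ⟨mu, hmu⟩ := h
    rw [thetaKet_of_eq b ℓ hℓ hmu, specCoeff_demTheta, specCoeff_xpow]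
    congr 1
    apply if_congr _ rfl rfl
    rw [hmu, dot_add_zsmul, add_right_inj]
    exact ⟨fun h => by rw [h], fun h => zsmul_left_cancel P (n := ℓ) (by omega) h⟩
  · rw [thetaKet_of_ne b ℓ (fun mu hmu => h ⟨mu, hmu⟩), map_zero, if_neg, mul_zero]
    intro hx
    exact h ⟨w • nu, by rw [hx, dot_add_zsmul]⟩

lemma shiftedPairing_of_eq {eta : X} {w : P.weylGroup} {x mu : X}
    (hx : x = dot b w eta + (ℓ : ℤ) • mu) (i : ι) :
    shiftedPairing b x i = shiftedPairing b eta (w⁻¹ • i) + ℓ * P.coroot' i mu := by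
  rw [hx, shiftedPairing_add, map_smul, smul_eq_mul, ← shiftedPairing_dot b w eta (w⁻¹ • i),
    smul_inv_smul]

section Pairs

variable {b} {i : ι} {u : P.weylGroup} {eta : X} {p : ℤ}

lemma dot_ofIdx_mul_eq (hp : shiftedPairing b eta (u⁻¹ • i) = p) :
    dot b (ofIdx P i * u) eta = dot b u eta - p • P.root i := by
  rw [dot_mul, dot_ofIdx_eq_sub, ← smul_inv_smul u i, shiftedPairing_dot, smul_inv_smul, hp]

/-- Θ_u applied to `demLus_add_smul`, with Θ_u Tᵢ = Θ_{sᵢu}. The companion `thetaKet_pair_add_root`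
does the same for `demLus_add_smul_add_root`. -/
lemma thetaKet_pair_smul (hℓ : 0 < ℓ) (hi : i ∈ b.support) (hu : b.IsPos (u⁻¹ • i))
    (hp : shiftedPairing b eta (u⁻¹ • i) = p) {x mu : X} (hx : x = dot b u eta + (ℓ : ℤ) • mu) :
    tHalf 1 • thetaKet b ℓ eta u x
      + tHalf 1 • thetaKet b ℓ eta u (x - (ℓ * P.coroot' i mu) • P.root i)
      + thetaKet b ℓ eta (ofIdx P i * u) (x - p • P.root i)
      + thetaKet b ℓ eta (ofIdx P i * u) (x - (p + ℓ * P.coroot' i mu) • P.root i) = 0 := by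
  have hd := dot_ofIdx_mul_eq hp
  rw [thetaKet_of_eq b ℓ hℓ hx, thetaKet_of_eq b ℓ hℓ (mu := ofIdx P i • mu)
      (by rw [hx, ofIdx_smul_wt]; module),
    thetaKet_of_eq b ℓ hℓ (x := x - p • P.root i) (mu := mu) (by rw [hd, hx]; module),
    thetaKet_of_eq b ℓ hℓ (x := x - (p + ℓ * P.coroot' i mu) • P.root i) (mu := ofIdx P i • mu)
      (by rw [hd, hx, ofIdx_smul_wt]; module),
    demTheta_ofIdx_mul b hi hu, demTheta_ofIdx_mul b hi hu, add_assoc _ (demTheta b u _),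
    ← map_add, ← map_add, demLus_add_smul, map_neg, map_smul, map_add]
  module

lemma thetaKet_pair_add_root (hℓ : 0 < ℓ) (hi : i ∈ b.support) (hu : b.IsPos (u⁻¹ • i))
    (hp : shiftedPairing b eta (u⁻¹ • i) = p) {x mu : X}
    (hx : x = dot b u eta - p • P.root i + (ℓ : ℤ) • mu) :
    tHalf 1 • thetaKet b ℓ eta (ofIdx P i * u) x
      + tHalf 1 • thetaKet b ℓ eta (ofIdx P i * u)
        (x - (ℓ * (P.coroot' i mu - 1)) • P.root i)
      + thetaKet b ℓ eta u (x - (ℓ - p) • P.root i)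
      + thetaKet b ℓ eta u (x - (ℓ * P.coroot' i mu - p) • P.root i) = 0 := by
  have hd := dot_ofIdx_mul_eq hp
  rw [← hd] at hx
  rw [thetaKet_of_eq b ℓ hℓ hx, thetaKet_of_eq b ℓ hℓ (mu := ofIdx P i • mu + P.root i)
      (by rw [hx, ofIdx_smul_wt]; module),
    thetaKet_of_eq b ℓ hℓ (x := x - (ℓ - p) • P.root i) (mu := mu - P.root i)
      (by rw [hx, hd]; module),
    thetaKet_of_eq b ℓ hℓ (x := x - (ℓ * P.coroot' i mu - p) • P.root i) (mu := ofIdx P i • mu)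
      (by rw [hx, hd, ofIdx_smul_wt]; module),
    demTheta_ofIdx_mul b hi hu, demTheta_ofIdx_mul b hi hu, ← smul_add, add_assoc,
    ← map_add, ← map_add, ← map_smul, ← map_add, demLus_add_smul_add_root, ← map_add,
    neg_add_cancel, map_zero]

end Pairs

end Independence

/-! ### The detecting functionals and linear independence of the dominant kets. -/

section Detection

variable {ι X Y : Type*} [Fintype ι] [AddCommGroup X] [AddCommGroup Y]
  {P : RootDatum ι X Y} (b : P.Base) (ℓ : ℕ)

/-- The exponent by which `Θ_w` is rescaled on the orbit of `η`. -/
def alcoveExp (eta : X) (w : P.weylGroup) : ℤ :=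
  (((inversions b w).filter fun k => shiftedPairing b eta (w⁻¹ • k) = 0).card : ℤ)
    - ((inversions b w).filter fun k => shiftedPairing b eta (w⁻¹ • k) = -(ℓ : ℤ)).card

lemma eq_zero_of_mul_eq {n m d : ℤ} (h : n * m = d) (h1 : -n < d) (h2 : d < n) : m = 0 := by
  by_contra hne
  rcases lt_or_gt_of_ne hne with h0 | h0 <;> nlinarith

variable [P.IsReduced]

lemma alcoveExp_ofIdx_mul {i : ι} (hi : i ∈ b.support) {u : P.weylGroup}
    (hu : b.IsPos (u⁻¹ • i)) (eta : X) {p : ℤ} (hp : shiftedPairing b eta (u⁻¹ • i) = p) :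
    alcoveExp b ℓ eta (ofIdx P i * u) = alcoveExp b ℓ eta u +
      ((if p = 0 then 1 else 0) - if p = ℓ then 1 else 0) := by
  have h1 : ∀ k : ι, (ofIdx P i * u)⁻¹ • k = u⁻¹ • ofIdx P i • k := by
    intro k
    rw [mul_inv_rev, ofIdx_inv, mul_smul]
  have h2 : shiftedPairing b eta ((ofIdx P i * u)⁻¹ • i) = -p := by
    rw [h1, ofIdx_smul_self, smul_negIdx, shiftedPairing_neg, hp]
  have h3 : ∀ k : ι, (ofIdx P i * u)⁻¹ • ofIdx P i • k = u⁻¹ • k := by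
    intro k
    rw [h1, ofIdx_smul_smul]
  rw [alcoveExp, card_filter_inversions b hi hu (fun k => shiftedPairing b eta (u⁻¹ • k) = 0) _
      (fun k => by rw [h3]),
    card_filter_inversions b hi hu (fun k => shiftedPairing b eta (u⁻¹ • k) = -(ℓ : ℤ)) _
      (fun k => by rw [h3]), h2, alcoveExp]
  simp only [neg_eq_zero, neg_inj]
  push_cast
  split_ifs <;> ring

lemma shiftedPairing_sub (x : X) (i : ι) (c : ℤ) :
    shiftedPairing b (x - c • P.root i) i = shiftedPairing b x i - 2 * c := by
  rw [sub_eq_add_neg, shiftedPairing_add, map_neg, map_smul, coroot'_root, smul_eq_mul]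
  ring

variable [Module.Finite ℤ X]

section Cancellation

variable {b ℓ} {i : ι} {u : P.weylGroup} {eta : X} {p : ℤ}

/-- Half of the generic relation, carried by x ∈ u∘η + ℓX. The alcove bounds 0 ≤ p ≤ ℓ then force p
= j, and the terms are those of `thetaKet_pair_smul`. Off this class all four terms vanish. -/
lemma generic_cancel_one (hℓ : 0 < ℓ) (hi : i ∈ b.support) (hu : b.IsPos (u⁻¹ • i))
    (hp : shiftedPairing b eta (u⁻¹ • i) = p) (hp0 : 0 ≤ p) (hpl : p ≤ ℓ) {x : X} {k j : ℤ}
    (hj : 0 < j) (hjl : j < ℓ) (hx : shiftedPairing b x i = k * ℓ + j) {c : KK}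
    (hc : p = j → c = 1) :
    tHalf 1 • thetaKet b ℓ eta u x + tHalf 1 • thetaKet b ℓ eta u (x - (k * ℓ) • P.root i)
      + c • (thetaKet b ℓ eta (ofIdx P i * u) (x - j • P.root i)
        + thetaKet b ℓ eta (ofIdx P i * u) (x - (k * ℓ + j) • P.root i)) = 0 := by
  have hd := dot_ofIdx_mul_eq hp
  by_cases h : ∃ mu : X, x = dot b u eta + (ℓ : ℤ) • mu
  · obtain ⟨mu, hmu⟩ := h
    have h1 := shiftedPairing_of_eq b ℓ hmu i
    rw [hx, hp] at h1
    have h2 := eq_zero_of_mul_eq (n := ℓ) (m := k - P.coroot' i mu) (d := p - j)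
      (by linarith) (by omega) (by omega)
    have hk : k = P.coroot' i mu := by omega
    have hpj : p = j := by rw [hk] at h1; linarith
    have := thetaKet_pair_smul ℓ hℓ hi hu hp hmu
    rw [hc hpj, one_smul, ← this, hk, hpj, mul_comm (P.coroot' i mu), add_comm j, ← add_assoc]
  · have h3 : ∀ (y mu : X), y = x - j • P.root i → y ≠ dot b (ofIdx P i * u) eta
        + (ℓ : ℤ) • mu := by
      rintro y mu rfl hy
      have h1 := shiftedPairing_of_eq b ℓ hy i
      rw [shiftedPairing_sub, hx, mul_inv_rev, mul_smul, ofIdx_inv, ofIdx_smul_self, smul_negIdx,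
        shiftedPairing_neg, hp] at h1
      have h2 := eq_zero_of_mul_eq (n := ℓ) (m := P.coroot' i mu - k) (d := p - j)
        (by linarith) (by omega) (by omega)
      have hk : k = P.coroot' i mu := by omega
      have hpj : p = j := by rw [hk] at h1; linarith
      refine h ⟨mu, ?_⟩
      rw [hd, sub_eq_iff_eq_add] at hy
      rw [hy, hpj]
      module
    rw [thetaKet_of_ne b ℓ fun mu hmu => h ⟨mu, hmu⟩,
      thetaKet_of_ne b ℓ (x := x - (k * ℓ) • P.root i) fun mu hmu =>
        h ⟨mu + k • P.root i, by rw [sub_eq_iff_eq_add] at hmu; rw [hmu]; module⟩,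
      thetaKet_of_ne b ℓ (x := x - j • P.root i) fun mu => h3 _ _ rfl,
      thetaKet_of_ne b ℓ (x := x - (k * ℓ + j) • P.root i) fun mu hmu =>
        h3 _ (mu + k • P.root i) rfl (by
          rw [sub_eq_iff_eq_add] at hmu; rw [hmu]; module)]
    simp

/-- The other half, carried by x ∈ (sᵢu)∘η + ℓX; now p = ℓ - j and `thetaKet_pair_add_root` applies.
-/
lemma generic_cancel_two (hℓ : 0 < ℓ) (hi : i ∈ b.support) (hu : b.IsPos (u⁻¹ • i))
    (hp : shiftedPairing b eta (u⁻¹ • i) = p) (hp0 : 0 ≤ p) (hpl : p ≤ ℓ) {x : X} {k j : ℤ}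
    (hj : 0 < j) (hjl : j < ℓ) (hx : shiftedPairing b x i = k * ℓ + j) {c : KK}
    (hc : p = ℓ - j → c = 1) :
    thetaKet b ℓ eta u (x - j • P.root i) + thetaKet b ℓ eta u (x - (k * ℓ + j) • P.root i)
      + c • (tHalf 1 • thetaKet b ℓ eta (ofIdx P i * u) x
        + tHalf 1 • thetaKet b ℓ eta (ofIdx P i * u) (x - (k * ℓ) • P.root i)) = 0 := by
  have hd := dot_ofIdx_mul_eq hp
  by_cases h : ∃ mu : X, x = dot b u eta - p • P.root i + (ℓ : ℤ) • mu
  · obtain ⟨mu, hmu⟩ := h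
    have hmu' := hmu
    rw [← hd] at hmu'
    have h1 := shiftedPairing_of_eq b ℓ hmu' i
    rw [hx, mul_inv_rev, mul_smul, ofIdx_inv, ofIdx_smul_self, smul_negIdx,
        shiftedPairing_neg, hp] at h1
    have h2 := eq_zero_of_mul_eq (n := ℓ) (m := P.coroot' i mu - k - 1) (d := p + j - ℓ)
      (by linarith) (by omega) (by omega)
    have hk : P.coroot' i mu = k + 1 := by omega
    have hpj : p = ℓ - j := by rw [hk] at h1; linarith
    have := thetaKet_pair_add_root ℓ hℓ hi hu hp hmu
    rw [hk, hpj] at this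
    rw [hc hpj, one_smul, ← this]
    rw [show (ℓ : ℤ) * (k + 1 - 1) = k * ℓ by ring, show (ℓ : ℤ) - (ℓ - j) = j by ring,
      show (ℓ : ℤ) * (k + 1) - (ℓ - j) = k * ℓ + j by ring]
    abel
  · have h3 : ∀ (y mu : X), y = x - j • P.root i → y ≠ dot b u eta + (ℓ : ℤ) • mu := by
      rintro y mu rfl hy
      have h1 := shiftedPairing_of_eq b ℓ hy i
      rw [shiftedPairing_sub, hx, hp] at h1
      have h2 := eq_zero_of_mul_eq (n := ℓ) (m := k - P.coroot' i mu - 1) (d := p + j - ℓ)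
        (by linarith) (by omega) (by omega)
      have hk : P.coroot' i mu = k - 1 := by omega
      have hpj : p = ℓ - j := by rw [hk] at h1; linarith
      refine h ⟨mu + P.root i, ?_⟩
      rw [sub_eq_iff_eq_add] at hy
      rw [hy, hpj]
      module
    rw [thetaKet_of_ne b ℓ (x := x - j • P.root i) fun mu => h3 _ _ rfl,
      thetaKet_of_ne b ℓ (x := x - (k * ℓ + j) • P.root i) fun mu hmu =>
        h3 _ (mu + k • P.root i) rfl (by
          rw [sub_eq_iff_eq_add] at hmu; rw [hmu]; module),
      thetaKet_of_ne b ℓ (x := x) fun mu hmu => h ⟨mu, by rw [← hd]; exact hmu⟩,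
      thetaKet_of_ne b ℓ (x := x - (k * ℓ) • P.root i) fun mu hmu =>
        h ⟨mu + k • P.root i, by rw [sub_eq_iff_eq_add] at hmu; rw [hmu, hd]; module⟩]
    simp

/-- Only η on a wall, p = 0 or p = ℓ, contributes. The pair identities weight Θ_u against Θ_{sᵢu} by
t^{1/2} : 1 on the first wall and 1 : t^{1/2} on the second, so no single normalization of Θ_w
serves both; the scalar c absorbs this. -/
lemma multiple_cancel (hℓ : 0 < ℓ) (hi : i ∈ b.support) (hu : b.IsPos (u⁻¹ • i))
    (hp : shiftedPairing b eta (u⁻¹ • i) = p) (hp0 : 0 ≤ p) (hpl : p ≤ ℓ) {x : X} {k : ℤ}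
    (hx : shiftedPairing b x i = k * ℓ) {c : KK} (hc0 : p = 0 → c = tHalf (-1))
    (hcl : p = ℓ → c = tHalf 1) :
    thetaKet b ℓ eta u (x - (k * ℓ) • P.root i) + thetaKet b ℓ eta u x
      + c • (thetaKet b ℓ eta (ofIdx P i * u) (x - (k * ℓ) • P.root i)
        + thetaKet b ℓ eta (ofIdx P i * u) x) = 0 := by
  have hd := dot_ofIdx_mul_eq hp
  have h1 : ∀ {mu : X}, x = dot b u eta + (ℓ : ℤ) • mu → k * ℓ = p + ℓ * P.coroot' i mu := by
    intro mu hmu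
    rw [← hx, shiftedPairing_of_eq b ℓ hmu i, hp]
  have h2 : ∀ {mu : X}, x = dot b (ofIdx P i * u) eta + (ℓ : ℤ) • mu →
      k * ℓ = -p + ℓ * P.coroot' i mu := by
    intro mu hmu
    rw [← hx, shiftedPairing_of_eq b ℓ hmu i, mul_inv_rev, mul_smul, ofIdx_inv, ofIdx_smul_self,
      smul_negIdx, shiftedPairing_neg, hp]
  have hq : tHalf (-1) * tHalf 1 = 1 := by rw [tHalf_mul]; exact tHalf_zero
  have hz : (∀ mu : X, x ≠ dot b u eta + (ℓ : ℤ) • mu) →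
      (∀ mu : X, x ≠ dot b (ofIdx P i * u) eta + (ℓ : ℤ) • mu) →
      thetaKet b ℓ eta u (x - (k * ℓ) • P.root i) + thetaKet b ℓ eta u x
      + c • (thetaKet b ℓ eta (ofIdx P i * u) (x - (k * ℓ) • P.root i)
        + thetaKet b ℓ eta (ofIdx P i * u) x) = 0 := by
    intro ha hb
    rw [thetaKet_of_ne b ℓ ha, thetaKet_of_ne b ℓ hb,
      thetaKet_of_ne b ℓ (w := u) (x := x - (k * ℓ) • P.root i) fun mu hmu =>
        ha (mu + k • P.root i) (by rw [sub_eq_iff_eq_add] at hmu; rw [hmu]; module),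
      thetaKet_of_ne b ℓ (w := ofIdx P i * u) (x := x - (k * ℓ) • P.root i) fun mu hmu =>
        hb (mu + k • P.root i) (by rw [sub_eq_iff_eq_add] at hmu; rw [hmu]; module)]
    simp
  by_cases h0 : p = 0
  · rw [hc0 h0]
    rw [h0, zero_smul, sub_zero] at hd
    by_cases h : ∃ mu : X, x = dot b u eta + (ℓ : ℤ) • mu
    · obtain ⟨mu, hmu⟩ := h
      have e := h1 hmu
      rw [h0, zero_add] at e
      have := thetaKet_pair_smul ℓ hℓ hi hu hp hmu
      rw [h0, zero_add, zero_smul, sub_zero, ← e] at this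
      have h4 := congrArg (tHalf (-1) • ·) this
      simp only [smul_add, smul_smul, hq, one_smul, smul_zero] at h4
      rw [← h4, smul_add]
      abel
    · rw [← hc0 h0]
      exact hz (fun mu hmu => h ⟨mu, hmu⟩) fun mu hmu => h ⟨mu, by rw [← hd]; exact hmu⟩
  · by_cases hl : p = ℓ
    · rw [hcl hl]
      by_cases h : ∃ mu : X, x = dot b (ofIdx P i * u) eta + (ℓ : ℤ) • mu
      · obtain ⟨mu, hmu⟩ := h
        have e := h2 hmu
        have := thetaKet_pair_add_root ℓ hℓ hi hu hp (hd ▸ hmu)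
        rw [hl, show (ℓ : ℤ) * (P.coroot' i mu - 1) = k * ℓ by rw [e, hl]; ring,
          show (ℓ : ℤ) * P.coroot' i mu - ℓ = k * ℓ by rw [e, hl]; ring, sub_self, zero_smul,
          sub_zero] at this
        rw [← this, smul_add]
        abel
      · rw [← hcl hl]
        refine hz (fun mu hmu => h ⟨mu + P.root i, ?_⟩) fun mu hmu => h ⟨mu, hmu⟩
        rw [hmu, hd, hl]
        module
    · refine hz (fun mu hmu => ?_) fun mu hmu => ?_
      · have e := h1 hmu
        have h3 := eq_zero_of_mul_eq (n := ℓ) (m := k - P.coroot' i mu) (d := p) (by linarith)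
          (by omega) (by omega)
        rw [sub_eq_zero.mp h3] at e
        exact h0 (by linarith)
      · have e := h2 hmu
        have h3 := eq_zero_of_mul_eq (n := ℓ) (m := P.coroot' i mu - k) (d := p) (by linarith)
          (by omega) (by omega)
        rw [sub_eq_zero.mp h3] at e
        exact h0 (by linarith)

end Cancellation

/-- The value at `|x⟩` of the functional on `F_ℓ` detecting the orbit of `η`. -/
def detectKet (eta x : X) : KX X :=
  ∑ w : P.weylGroup, tHalf (-alcoveExp b ℓ eta w) • thetaKet b ℓ eta w x

variable {b ℓ}

/-- Terms cancel in pairs w, sᵢw. The ratio of their weights is the scalar c of the cancellation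
lemmas, which is what `alcoveExp` is designed for. -/
lemma sum_alcoveExp_eq_zero {eta : X} {i : ι} (hi : i ∈ b.support) (F : P.weylGroup → KX X)
    (hF : ∀ u : P.weylGroup, b.IsPos (u⁻¹ • i) →
      F u + tHalf ((if shiftedPairing b eta (u⁻¹ • i) = ℓ then 1 else 0)
        - if shiftedPairing b eta (u⁻¹ • i) = 0 then 1 else 0) • F (ofIdx P i * u) = 0) :
    ∑ w : P.weylGroup, tHalf (-alcoveExp b ℓ eta w) • F w = 0 := by
  have key : ∀ u : P.weylGroup, b.IsPos (u⁻¹ • i) → tHalf (-alcoveExp b ℓ eta u) • F u +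
      tHalf (-alcoveExp b ℓ eta (ofIdx P i * u)) • F (ofIdx P i * u) = 0 := by
    intro u hu
    rw [alcoveExp_ofIdx_mul b ℓ hi hu eta rfl, neg_add, neg_sub, ← tHalf_mul, mul_smul, ← smul_add,
      hF u hu, smul_zero]
  refine Finset.sum_involution (fun w _ => ofIdx P i * w) ?_ ?_ (fun _ _ => Finset.mem_univ _)
    fun w _ => ofIdx_mul_cancel i w
  · intro w _
    by_cases hw : b.IsPos (w⁻¹ • i)
    · exact key w hw
    · rw [← isPos_ofIdx_mul_inv_smul] at hw
      have := key _ hw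
      rwa [ofIdx_mul_cancel, add_comm] at this
  · intro w _ _ he
    have := isPos_ofIdx_mul_inv_smul b i w
    rw [he] at this
    exact iff_not_self this

lemma detectKet_generic (hℓ : 0 < ℓ) {eta : X} (heta : InAlcove b ℓ eta) {i : ι}
    (hi : i ∈ b.support) {x : X} {k j : ℤ} (hj : 0 < j) (hjl : j < ℓ)
    (hx : shiftedPairing b x i = k * ℓ + j) :
    detectKet b ℓ eta (x - (k * ℓ + j) • P.root i)
      + tHalf 1 • detectKet b ℓ eta (x - (k * ℓ) • P.root i)
      + detectKet b ℓ eta (x - j • P.root i) + tHalf 1 • detectKet b ℓ eta x = 0 := by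
  rw [detectKet, detectKet, detectKet, detectKet, Finset.smul_sum, Finset.smul_sum,
    ← Finset.sum_add_distrib, ← Finset.sum_add_distrib, ← Finset.sum_add_distrib]
  refine Eq.trans (Finset.sum_congr rfl fun w _ => ?_) (sum_alcoveExp_eq_zero (ℓ := ℓ)
    (eta := eta) hi (fun w =>
    thetaKet b ℓ eta w (x - (k * ℓ + j) • P.root i)
      + tHalf 1 • thetaKet b ℓ eta w (x - (k * ℓ) • P.root i)
      + thetaKet b ℓ eta w (x - j • P.root i) + tHalf 1 • thetaKet b ℓ eta w x) ?_)
  · module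
  · intro u hu
    obtain ⟨hp0, hpl⟩ := heta _ hu
    set p := shiftedPairing b eta (u⁻¹ • i) with hp
    have hc : 0 < p → p < ℓ →
        tHalf ((if p = ℓ then 1 else 0) - if p = 0 then 1 else 0) = 1 := by
      intro h1 h2
      rw [if_neg h2.ne, if_neg h1.ne', sub_zero, tHalf_zero]
    have h1 := generic_cancel_one hℓ hi hu hp.symm hp0 hpl hj hjl hx
      (fun h => hc (by omega) (by omega))
    have h2 := generic_cancel_two hℓ hi hu hp.symm hp0 hpl hj hjl hx
      (fun h => hc (by omega) (by omega))
    have h3 := congrArg₂ (· + ·) h1 h2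
    simp only [add_zero] at h3
    rw [← h3]
    module

lemma detectKet_multiple (hℓ : 0 < ℓ) {eta : X} (heta : InAlcove b ℓ eta) {i : ι}
    (hi : i ∈ b.support) {x : X} {k : ℤ} (hx : shiftedPairing b x i = k * ℓ) :
    detectKet b ℓ eta (x - (k * ℓ) • P.root i) + detectKet b ℓ eta x = 0 := by
  rw [detectKet, detectKet, ← Finset.sum_add_distrib]
  simp only [← smul_add]
  refine sum_alcoveExp_eq_zero hi _ fun u hu => ?_
  obtain ⟨hp0, hpl⟩ := heta _ hu
  refine multiple_cancel hℓ hi hu rfl hp0 hpl hx (fun h => ?_) fun h => ?_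
  · rw [h, if_neg (by omega), if_pos rfl, zero_sub]
  · rw [h, if_pos rfl, if_neg (by omega), sub_zero]

lemma two_smul_eq_zero {f : KX X} (h : f + f = 0) : f = 0 := by
  apply AddMonoidAlgebra.coeff_injective
  ext nu n
  have h2 := congrArg (fun g : KX X => (g.coeff nu).coeff n) h
  change (f.coeff nu).coeff n + (f.coeff nu).coeff n = 0 at h2
  change (f.coeff nu).coeff n = 0
  omega

variable (b ℓ) in
/-- The functional on the free module detecting the orbit of `η`. -/
def detectFree (eta : X) : FreeKet X →ₗ[KK] KX X := Finsupp.linearCombination KK (detectKet b ℓ eta)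

lemma detectFree_fket (eta x : X) : detectFree b ℓ eta (fket x) = detectKet b ℓ eta x := by
  rw [detectFree, fket, Finsupp.linearCombination_single, one_smul]

/-- The wall and small relations are the cases k = 0 of the multiple and generic identities. There
they appear doubled, and 𝕂[X] has no 2-torsion. -/
lemma relations_le_ker_detectFree (hℓ : 0 < ℓ) {eta : X} (heta : InAlcove b ℓ eta) :
    relations b ℓ ≤ LinearMap.ker (detectFree b ℓ eta) := by
  rw [relations, Submodule.span_le]
  intro v hv
  change detectFree b ℓ eta v = 0
  rcases hv with ⟨x, i, hi, h⟩ | ⟨x, i, hi, k, h⟩ | ⟨x, i, hi, h₀, h₁⟩ |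
    ⟨x, i, hi, k, j, hk, hj, hjl, h⟩ <;>
  simp only [map_add, map_smul, detectFree_fket]
  · have := detectKet_multiple hℓ heta hi (x := x) (k := 0) (by rw [h, zero_mul])
    rw [zero_mul, zero_smul, sub_zero] at this
    exact two_smul_eq_zero this
  · have := detectKet_multiple hℓ heta hi (x := x) (k := k) (by rw [h, mul_comm])
    rwa [dot_ofIdx b hi, h, mul_comm]
  · have := detectKet_generic hℓ heta hi (x := x) (k := 0) h₀ h₁ (by ring)
    rw [zero_mul, zero_add, zero_smul, sub_zero] at this
    apply two_smul_eq_zero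
    rw [dot_ofIdx b hi, ← this]
    abel
  · have := detectKet_generic hℓ heta hi hj hjl h
    have e : dot b (ofIdx P i) (x - j • P.root i) = x - (k * ℓ) • P.root i := by
      rw [dot_ofIdx b hi, shiftedPairing_sub, h]
      module
    rwa [e, dot_ofIdx b hi, h]

/-- The functional on the Fock space detecting the orbit of `η`. -/
def detect (hℓ : 0 < ℓ) {eta : X} (heta : InAlcove b ℓ eta) : Fock b ℓ →ₗ[KK] KX X :=
  (relations b ℓ).liftQ (detectFree b ℓ eta) (relations_le_ker_detectFree hℓ heta)

lemma detect_ket (hℓ : 0 < ℓ) {eta : X} (heta : InAlcove b ℓ eta) (x : X) :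
    detect hℓ heta (ket b ℓ x) = detectKet b ℓ eta x := detectFree_fket eta x

lemma detect_ketSum (hℓ : 0 < ℓ) {eta : X} (heta : InAlcove b ℓ eta)
    (c : DominantWeight b →₀ KK) :
    detect hℓ heta (ketSum b ℓ c) = ∑ x ∈ c.support, c x • detectKet b ℓ eta x := by
  rw [ketSum, Finsupp.linearCombination_apply, Finsupp.sum, map_sum]
  simp only [map_smul, detect_ket]

/-- At t^{1/2} = 1 the coefficient of X^ν in the detector of |x⟩ counts, with sign, the w with x =
w∘(η + ℓν). Among dominant x only x₀ occurs, with a single w, because the dot action is free on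
dominant weights and each orbit contains at most one. -/
lemma evalOne_eq_zero_of_detect (hℓ : 0 < ℓ) {c : DominantWeight b →₀ KK}
    (hc : ∀ (eta : X) (heta : InAlcove b ℓ eta), detect hℓ heta (ketSum b ℓ c) = 0)
    (x₀ : DominantWeight b) : evalOne (c x₀) = 0 := by
  classical
  obtain ⟨eta, w₀, nu, heta, hx⟩ := exists_inAlcove b ℓ hℓ (x₀ : X)
  have h := congrArg (specCoeff nu) (hc eta heta)
  rw [detect_ketSum, map_sum, map_zero, Finset.sum_eq_single x₀] at h
  · rw [map_smulₛₗ, detectKet, map_sum, Finset.sum_eq_single w₀] at h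
    · rw [map_smulₛₗ, specCoeff_thetaKet b ℓ hℓ, if_pos hx, evalOne_tHalf] at h
      rcases neg_one_pow_eq_or ℤ (length b w₀) with h1 | h1 <;> rw [h1] at h <;>
        simpa using h
    · intro w _ hw
      rw [map_smulₛₗ, specCoeff_thetaKet b ℓ hℓ, if_neg, mul_zero, smul_zero]
      intro hxw
      apply hw
      have e : dot b (w * w₀⁻¹) (x₀ : X) = x₀ := by
        nth_rewrite 1 [hx]
        rw [← dot_mul, inv_mul_cancel_right, ← hxw]
      have := x₀.2.eq_one b (w := w * w₀⁻¹) (by rw [e]; exact fun i hi => (x₀.2 i hi).le)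
      exact mul_inv_eq_one.mp this
    · simp
  · intro x _ hne
    rw [map_smulₛₗ, detectKet, map_sum, Finset.sum_eq_zero, smul_zero]
    intro w _
    rw [map_smulₛₗ, specCoeff_thetaKet b ℓ hℓ, if_neg, mul_zero, smul_zero]
    intro hxw
    apply hne
    have e : dot b (w * w₀⁻¹) (x₀ : X) = x := by
      nth_rewrite 1 [hx]
      rw [← dot_mul, inv_mul_cancel_right, ← hxw]
    have := x₀.2.eq_one b (w := w * w₀⁻¹) (by rw [e]; exact fun i hi => (x.2 i hi).le)
    rw [this, dot_one] at e
    exact Subtype.ext e.symm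
  · intro hns
    rw [Finsupp.notMem_support_iff.mp hns, zero_smul, map_zero]

/-- The division by t^{1/2} - 1 takes place in the joint kernel of the detectors: their values lie
in the torsion-free module 𝕂[X], whereas torsion-freeness of F_ℓ is not yet available. -/
theorem ketSum_injective (hℓ : 0 < ℓ) : Function.Injective (ketSum b ℓ) := by
  have hdiv : ∀ (n : ℕ) (c : DominantWeight b →₀ KK),
      (∀ (eta : X) (heta : InAlcove b ℓ eta), detect hℓ heta (ketSum b ℓ c) = 0) →
      ∀ x, (tHalf 1 - 1) ^ n ∣ c x := by
    intro n
    induction n with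
    | zero => intro c _ x; rw [pow_zero]; exact one_dvd _
    | succ n ih =>
      intro c hc x
      choose d hd using fun x => dvd_of_evalOne_eq_zero (evalOne_eq_zero_of_detect hℓ hc x)
      let c' : DominantWeight b →₀ KK := Finsupp.onFinset c.support d fun x hx => by
        rw [Finsupp.mem_support_iff]
        intro h0
        apply hx
        rw [hd x] at h0
        exact (mul_eq_zero.mp h0).resolve_left tHalf_sub_one_ne_zero
      have hcc : c = (tHalf 1 - 1) • c' := Finsupp.ext fun x => hd x
      have hc' : ∀ (eta : X) (heta : InAlcove b ℓ eta), detect hℓ heta (ketSum b ℓ c') = 0 := by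
        intro eta heta
        have h := hc eta heta
        rw [hcc, map_smul, map_smul] at h
        apply AddMonoidAlgebra.coeff_injective
        ext1 nu
        have h2 : (tHalf 1 - 1) * (detect hℓ heta (ketSum b ℓ c')).coeff nu = 0 :=
          congrArg (fun g : KX X => g.coeff nu) h
        exact (mul_eq_zero.mp h2).resolve_left tHalf_sub_one_ne_zero
      rw [hd x, pow_succ']
      exact mul_dvd_mul_left _ (ih c' hc' x)
  rw [injective_iff_map_eq_zero]
  intro c hc
  ext1 x
  exact eq_zero_of_forall_pow_dvd fun n =>
    hdiv n c (fun eta heta => by rw [hc, map_zero]) x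

end Detection

/-! ### The subring ℤ[t^{1/2}] and self-dual Laurent polynomials. -/

section Integrality

/-- The subring `ℤ[t^{1/2}]` of `𝕂`. -/
def posRing : Subring KK := (Polynomial.toLaurent : Polynomial ℤ →+* KK).range

lemma tHalf_one_mem_posRing : tHalf 1 ∈ posRing :=
  ⟨Polynomial.X, Polynomial.toLaurent_X⟩

lemma isPositivePoly_iff {p : KK} : IsPositivePoly p ↔ ∃ r ∈ posRing, p = tHalf 1 * r :=
  ⟨fun ⟨q, hq⟩ => ⟨_, ⟨q, rfl⟩, hq⟩, fun ⟨_, ⟨q, hq⟩, hr⟩ => ⟨q, by rw [hr, ← hq]⟩⟩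

lemma IsPositivePoly.sub {p q : KK} (hp : IsPositivePoly p) (hq : IsPositivePoly q) :
    IsPositivePoly (p - q) := by
  rw [isPositivePoly_iff] at *
  obtain ⟨r, hr, rfl⟩ := hp
  obtain ⟨s, hs, rfl⟩ := hq
  exact ⟨r - s, sub_mem hr hs, (mul_sub _ _ _).symm⟩

lemma coeff_tHalf_mul (n m : ℤ) (p : KK) : (tHalf n * p).coeff (n + m) = p.coeff m := by
  change (AddMonoidAlgebra.single n 1 * p).coeff (n + m) = p.coeff m
  rw [AddMonoidAlgebra.coeff_single_mul_add, one_mul]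

lemma coeff_toLaurent_of_neg (q : Polynomial ℤ) {n : ℤ} (hn : n < 0) :
    (Polynomial.toLaurent q).coeff n = 0 := by
  rw [LaurentPolynomial.coeff_toLaurent, Finsupp.mapDomain_of_notMem_range]
  rintro ⟨m, hm⟩
  change (m : ℤ) = n at hm
  omega

lemma IsPositivePoly.coeff_eq_zero {p : KK} (hp : IsPositivePoly p) {n : ℤ} (hn : n ≤ 0) :
    p.coeff n = 0 := by
  obtain ⟨q, rfl⟩ := hp
  rw [show n = 1 + (n - 1) by ring, coeff_tHalf_mul, coeff_toLaurent_of_neg q (by omega)]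

lemma coeff_barKK (p : KK) (n : ℤ) : (barKK p).coeff n = p.coeff (-n) := by
  change (LaurentPolynomial.invert p).coeff n = _
  simp

/-- Bar reverses degrees, and p has terms of positive degree only. -/
lemma IsPositivePoly.eq_zero_of_barKK {p : KK} (hp : IsPositivePoly p) (h : barKK p = p) :
    p = 0 := by
  apply AddMonoidAlgebra.coeff_injective
  ext n
  change p.coeff n = 0
  rcases le_total n 0 with hn | hn
  · exact hp.coeff_eq_zero hn
  · rw [← h, coeff_barKK]
    exact hp.coeff_eq_zero (by omega)

end Integrality

/-! ### Straightening: spanning by dominant kets, and leading terms. -/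

section Straightening

variable {ι X Y : Type*} [Fintype ι] [AddCommGroup X] [AddCommGroup Y]
  {P : RootDatum ι X Y} (b : P.Base) (ℓ : ℕ)

lemma ketSum_single (mu : DominantWeight b) (c : KK) :
    ketSum b ℓ (Finsupp.single mu c) = c • ket b ℓ (mu : X) :=
  Finsupp.linearCombination_single KK c mu

/-- The `ℤ[t^{1/2}]`-combinations of the `|μ⟩` with `μ` dominant and `(μ+ρ, μ+ρ)` bounded. -/
def straight (n : ℤ) : AddSubgroup (Fock b ℓ) where
  carrier := {v | ∃ c, v = ketSum b ℓ c ∧ (∀ mu, c mu ∈ posRing) ∧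
    ∀ mu : DominantWeight b, n < shiftedNorm b (mu : X) → c mu = 0}
  zero_mem' := ⟨0, by simp, fun _ => zero_mem _, fun _ _ => rfl⟩
  add_mem' := by
    rintro _ _ ⟨c, rfl, h1, h2⟩ ⟨d, rfl, h3, h4⟩
    exact ⟨c + d, (map_add _ _ _).symm, fun mu => add_mem (h1 mu) (h3 mu),
      fun mu h => by rw [Finsupp.add_apply, h2 mu h, h4 mu h, add_zero]⟩
  neg_mem' := by
    rintro _ ⟨c, rfl, h1, h2⟩
    exact ⟨-c, (map_neg _ _).symm, fun mu => neg_mem (h1 mu),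
      fun mu h => by rw [Finsupp.neg_apply, h2 mu h, neg_zero]⟩

variable {b ℓ}

lemma straight_mono {m n : ℤ} (h : m ≤ n) : straight b ℓ m ≤ straight b ℓ n := by
  rintro _ ⟨c, rfl, h1, h2⟩
  exact ⟨c, rfl, h1, fun mu hmu => h2 mu (by omega)⟩

lemma smul_mem_straight {n : ℤ} {r : KK} (hr : r ∈ posRing) {v : Fock b ℓ}
    (hv : v ∈ straight b ℓ n) : r • v ∈ straight b ℓ n := by
  obtain ⟨c, rfl, h1, h2⟩ := hv
  exact ⟨r • c, (map_smul _ _ _).symm, fun mu => mul_mem hr (h1 mu),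
    fun mu hmu => by rw [Finsupp.smul_apply, h2 mu hmu, smul_zero]⟩

variable (b) in
/-- The number of positive roots `α` with `⟨x + ρ, α^∨⟩ < 0`. -/
def negCount (x : X) : ℕ := by
  classical exact ((posRoots b).filter fun k => shiftedPairing b x k < 0).card

variable [P.IsReduced]

lemma negCount_lt {i : ι} (hi : i ∈ b.support) {x : X} (h : shiftedPairing b x i < 0) :
    negCount b (dot b (ofIdx P i) x) < negCount b x := by
  classical
  have hip := RootPairing.Base.isPos_of_mem_support hi
  have hk : ∀ k, shiftedPairing b (dot b (ofIdx P i) x) k = shiftedPairing b x (ofIdx P i • k) := by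
    intro k
    rw [← shiftedPairing_dot b (ofIdx P i) x (ofIdx P i • k), ofIdx_smul_smul]
  rw [negCount, negCount, ← Finset.card_map (MulAction.toPerm (ofIdx P i)).toEmbedding]
  apply Finset.card_lt_card
  rw [Finset.ssubset_iff_of_subset]
  · refine ⟨i, by simp [mem_posRoots, hip, h], fun hmem => ?_⟩
    obtain ⟨k, hkm, hki⟩ := Finset.mem_map.mp hmem
    change ofIdx P i • k = i at hki
    rw [Finset.mem_filter, mem_posRoots] at hkm
    have : k = negIdx P i := by
      rw [← ofIdx_smul_self]
      nth_rewrite 2 [← hki]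
      rw [ofIdx_smul_smul]
    rw [this, isPos_neg] at hkm
    exact hkm.1 hip
  · intro k' hk'
    obtain ⟨k, hkm, rfl⟩ := Finset.mem_map.mp hk'
    change ofIdx P i • k ∈ _
    rw [Finset.mem_filter, mem_posRoots] at hkm ⊢
    rw [hk] at hkm
    refine ⟨isPos_ofIdx_smul b hi hkm.1 ?_, hkm.2⟩
    rintro rfl
    rw [ofIdx_smul_self, shiftedPairing_neg] at hkm
    omega

lemma exists_quotient_remainder (hℓ : 0 < ℓ) {m : ℤ} (hm : ¬ (ℓ : ℤ) ∣ m) :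
    ∃ k j : ℤ, 0 < j ∧ j < ℓ ∧ m = k * ℓ + j := by
  refine ⟨m / ℓ, m % ℓ, ?_, Int.emod_lt_of_pos _ (by omega), ?_⟩
  · have := Int.emod_nonneg m (b := ℓ) (by omega)
    rcases this.lt_or_eq with h | h
    · exact h
    · exact absurd (Int.dvd_of_emod_eq_zero h.symm) hm
  · rw [mul_comm, Int.mul_ediv_add_emod]

lemma shiftedNorm_sub_lt {x : X} {i : ι} {j : ℤ} (hj : 0 < j) (h : j < shiftedPairing b x i) :
    shiftedNorm b (x - j • P.root i) < shiftedNorm b x := by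
  rw [shiftedNorm_sub_zsmul]
  have := mul_pos (mul_pos (by omega : 0 < 4 * j) (by omega : 0 < shiftedPairing b x i - j))
    (form_root_pos (P := P) i)
  omega

/-- Double induction, on the norm and then on `negCount`. A simple reflection with negative pairing
keeps the norm and lowers `negCount`; the other terms of the relation have smaller norm, and all
coefficients lie in ℤ[t^{1/2}]. -/
lemma ket_mem_straight (hℓ : 0 < ℓ) (x : X) : ket b ℓ x ∈ straight b ℓ (shiftedNorm b x) := by
  suffices h : ∀ (n m : ℕ) (x : X), shiftedNorm b x < n → negCount b x < m →
      ket b ℓ x ∈ straight b ℓ (shiftedNorm b x) from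
    h (shiftedNorm b x + 1).toNat (negCount b x + 1) x
      (by have := shiftedNorm_nonneg b x; omega) (Nat.lt_succ_self _)
  intro n
  induction n with
  | zero => intro m x hx; have := shiftedNorm_nonneg b x; omega
  | succ n ihn =>
    intro m
    induction m with
    | zero => intro x _ hx; omega
    | succ m ihm =>
      intro x hx hm
      by_cases hdom : IsDominant b x
      · refine ⟨Finsupp.single ⟨x, hdom⟩ 1, by rw [ketSum_single, one_smul], fun mu => ?_,
          fun mu hmu => ?_⟩
        · classical
          rw [Finsupp.single_apply]
          split_ifs
          exacts [one_mem _, zero_mem _]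
        · apply Finsupp.single_eq_of_ne
          rintro rfl
          exact lt_irrefl _ hmu
      rw [IsDominant] at hdom
      push Not at hdom
      obtain ⟨i, hi, hle⟩ := hdom
      rcases hle.eq_or_lt with h0 | h0
      · rw [ket_wall b ℓ hi h0]
        exact zero_mem _
      set y := dot b (ofIdx P i) x with hy
      have hxy : x = dot b (ofIdx P i) y := by rw [hy, dot_ofIdx_dot_ofIdx]
      have hN : shiftedNorm b y = shiftedNorm b x := shiftedNorm_dot b _ x
      have hyi : shiftedPairing b y i = -shiftedPairing b x i := shiftedPairing_dot_ofIdx b x i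
      have hky : ket b ℓ y ∈ straight b ℓ (shiftedNorm b x) := by
        rw [← hN]
        exact ihm y (by rw [hN]; exact hx) (by have := negCount_lt hi h0; rw [← hy] at this; omega)
      by_cases hdvd : (ℓ : ℤ) ∣ shiftedPairing b y i
      · have := ket_multiple b ℓ hi hdvd
        rw [← hxy] at this
        rw [eq_neg_of_add_eq_zero_left this]
        exact neg_mem hky
      · obtain ⟨k, j, hj, hjl, he⟩ := exists_quotient_remainder hℓ hdvd
        have hk : 0 ≤ k := by
          by_contra! hk
          have : k * ℓ ≤ -1 * (ℓ : ℤ) := mul_le_mul_of_nonneg_right (by omega) (by omega)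
          omega
        rcases hk.eq_or_lt with hk | hk
        · rw [← hk, zero_mul, zero_add] at he
          have := ket_small b ℓ hi (x := y) (by omega) (by omega)
          rw [← hxy] at this
          rw [eq_neg_of_add_eq_zero_left this]
          exact neg_mem (smul_mem_straight tHalf_one_mem_posRing hky)
        · have := ket_generic b ℓ hi k j hj hjl he
          rw [← hxy, add_assoc, add_assoc] at this
          rw [eq_neg_of_add_eq_zero_left this]
          -- Since j < ℓ ≤ kℓ, the multiple j lies strictly between 0 and the pairing kℓ + j.
          have hlt : shiftedNorm b (y - j • P.root i) < shiftedNorm b y := by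
            apply shiftedNorm_sub_lt hj
            have : (ℓ : ℤ) ≤ k * ℓ := le_mul_of_one_le_left (by omega) (by omega)
            omega
          have hlt' := hlt
          rw [← shiftedNorm_dot b (ofIdx P i)] at hlt
          push_cast at hx
          refine neg_mem (add_mem (smul_mem_straight tHalf_one_mem_posRing ?_)
            (add_mem ?_ (smul_mem_straight tHalf_one_mem_posRing hky)))
          · exact straight_mono (by omega) (ihn _ _ (by omega) (Nat.lt_succ_self _))
          · exact straight_mono (by omega) (ihn _ _ (by omega) (Nat.lt_succ_self _))

theorem ketSum_surjective (hℓ : 0 < ℓ) : Function.Surjective (ketSum b ℓ) := by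
  rw [← LinearMap.range_eq_top, eq_top_iff]
  rintro v -
  obtain ⟨v, rfl⟩ := Submodule.mkQ_surjective _ v
  rw [← v.sum_single, Finsupp.sum, map_sum]
  refine Submodule.sum_mem _ fun x _ => ?_
  have e : (relations b ℓ).mkQ (Finsupp.single x (v x)) = v x • ket b ℓ x := by
    rw [ket, fket, ← map_smul, Finsupp.smul_single, smul_eq_mul, mul_one]
  rw [e]
  obtain ⟨c, hc, -⟩ := ket_mem_straight (b := b) hℓ x
  exact Submodule.smul_mem _ _ ⟨c, hc.symm⟩

variable (b ℓ) in
/-- The span of the `|y⟩` with `(y+ρ, y+ρ)` smaller than a given bound. -/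
def lowSpan (n : ℤ) : Submodule KK (Fock b ℓ) :=
  Submodule.span KK (ket b ℓ '' {y | shiftedNorm b y < n})

lemma ket_mem_lowSpan {n : ℤ} {y : X} (h : shiftedNorm b y < n) : ket b ℓ y ∈ lowSpan b ℓ n :=
  Submodule.subset_span ⟨y, h, rfl⟩

lemma exists_of_mem_lowSpan (hℓ : 0 < ℓ) {n : ℤ} {v : Fock b ℓ} (hv : v ∈ lowSpan b ℓ n) :
    ∃ c, v = ketSum b ℓ c ∧ ∀ mu : DominantWeight b, n ≤ shiftedNorm b (mu : X) → c mu = 0 := by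
  induction hv using Submodule.span_induction with
  | mem v hv =>
    obtain ⟨y, hy, rfl⟩ := hv
    obtain ⟨c, h1, -, h2⟩ := ket_mem_straight (b := b) hℓ y
    exact ⟨c, h1, fun mu hmu => h2 mu (lt_of_lt_of_le hy hmu)⟩
  | zero => exact ⟨0, by simp, fun _ _ => rfl⟩
  | add v w _ _ hv hw =>
    obtain ⟨c, rfl, h1⟩ := hv
    obtain ⟨d, rfl, h2⟩ := hw
    exact ⟨c + d, (map_add _ _ _).symm, fun mu h => by
      rw [Finsupp.add_apply, h1 mu h, h2 mu h, add_zero]⟩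
  | smul a v _ hv =>
    obtain ⟨c, rfl, h1⟩ := hv
    exact ⟨a • c, (map_smul _ _ _).symm, fun mu h => by
      rw [Finsupp.smul_apply, h1 mu h, smul_zero]⟩

/-- The two middle terms of the generic relation have smaller norm, so only the leading coefficient
survives: -1 on an ℓ-wall, -t^{1/2} off it. -/
lemma ket_dot_ofIdx_add_mem (hℓ : 0 < ℓ) {n : ℤ} [Decidable (¬ (ℓ : ℤ) ∣ n)] {i : ι}
    (hi : i ∈ b.support) {y : X} (h : shiftedPairing b y i = n) (h0 : 0 < n) :
    ket b ℓ (dot b (ofIdx P i) y) + tHalf (if ¬ (ℓ : ℤ) ∣ n then 1 else 0) • ket b ℓ y ∈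
      lowSpan b ℓ (shiftedNorm b y) := by
  subst h
  split_ifs with hdvd
  swap
  · obtain ⟨k, j, hj, hjl, he⟩ := exists_quotient_remainder hℓ hdvd
    have hk : 0 ≤ k := by
      by_contra! hk
      have : k * ℓ ≤ -1 * (ℓ : ℤ) := mul_le_mul_of_nonneg_right (by omega) (by omega)
      omega
    rcases hk.eq_or_lt with hk | hk
    · rw [← hk, zero_mul, zero_add] at he
      rw [ket_small b ℓ hi (x := y) (by omega) (by omega)]
      exact zero_mem _
    · have := ket_generic b ℓ hi k j hj hjl he
      have hlt : shiftedNorm b (y - j • P.root i) < shiftedNorm b y := by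
        apply shiftedNorm_sub_lt hj
        have : (ℓ : ℤ) ≤ k * ℓ := le_mul_of_one_le_left (by omega) (by omega)
        omega
      have e : ket b ℓ (dot b (ofIdx P i) y) + tHalf 1 • ket b ℓ y =
          -(tHalf 1 • ket b ℓ (dot b (ofIdx P i) (y - j • P.root i)) +
            ket b ℓ (y - j • P.root i)) := by
        rw [← sub_eq_zero, ← this]
        abel
      rw [e]
      refine neg_mem (add_mem (Submodule.smul_mem _ _ (ket_mem_lowSpan ?_)) (ket_mem_lowSpan hlt))
      rwa [shiftedNorm_dot]
  · rw [tHalf_zero, one_smul, ket_multiple b ℓ hi (hdvd)]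
    exact zero_mem _

/-- Each letter of a reduced word contributes one leading coefficient; for w₀ the exponent becomes
|R⁺| - N_x, the one in `barScalar`. -/
lemma ket_dot_sub_mem (hℓ : 0 < ℓ) {x : X} (hx : IsDominant b x) (w : P.weylGroup)
    [DecidablePred fun k => ¬ (ℓ : ℤ) ∣ shiftedPairing b (dot b w x) k] :
    ket b ℓ (dot b w x) - ((-1) ^ length b w * tHalf ((inversions b w).filter fun k =>
      ¬ (ℓ : ℤ) ∣ shiftedPairing b (dot b w x) k).card) • ket b ℓ x ∈
        lowSpan b ℓ (shiftedNorm b x) := by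
  classical
  have key : ∀ w : P.weylGroup,
      ket b ℓ (dot b w x) - ((-1) ^ length b w * tHalf ((inversions b w).filter fun k =>
      ¬ (ℓ : ℤ) ∣ shiftedPairing b (dot b w x) k).card) • ket b ℓ x ∈
        lowSpan b ℓ (shiftedNorm b x) := by
    refine weyl_induction b ?_ ?_
    · have e : inversions b (1 : P.weylGroup) = ∅ := by
        rw [← Finset.card_eq_zero]; exact length_one b
      rw [e, length_one, dot_one]
      simp [tHalf_zero]
    · intro i hi u hu ih
      have hpos : shiftedPairing b (dot b u x) i = shiftedPairing b x (u⁻¹ • i) := by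
        rw [← shiftedPairing_dot b u x (u⁻¹ • i), smul_inv_smul]
      have h1 := ket_dot_ofIdx_add_mem hℓ hi (y := dot b u x) rfl
        (by rw [hpos]; exact hx.pos b hu)
      rw [shiftedNorm_dot] at h1
      rw [card_filter_inversions b hi hu
        (fun k => ¬ (ℓ : ℤ) ∣ shiftedPairing b (dot b u x) k) _ (fun k => by
          rw [dot_mul, shiftedPairing_dot]), length_ofIdx_mul b hi hu, dot_mul,
          shiftedPairing_dot_ofIdx]
      simp only [dvd_neg]
      have h2 := sub_mem h1 (Submodule.smul_mem _ (tHalf (if ¬ (ℓ : ℤ) ∣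
        shiftedPairing b (dot b u x) i then 1 else 0)) ih)
      convert! h2 using 1
      push_cast
      rw [← tHalf_mul, pow_succ]
      module
  convert! key w

end Straightening

/-! ### Unitriangularity of bar and uniqueness of Kazhdan-Lusztig elements. -/

section BarInvariance

variable {ι X Y : Type*} [Fintype ι] [AddCommGroup X] [AddCommGroup Y]
  {P : RootDatum ι X Y} {b : P.Base} {ℓ : ℕ} [P.IsReduced]

lemma bar_ket (x : X) :
    bar b ℓ (ket b ℓ x) = barScalar b ℓ x • ket b ℓ (dot b (longest b) x) := by
  change (relations b ℓ).mkQ (barFree b ℓ (fket x)) = _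
  rw [barFree_fket, map_smul, ket]

/-- `barScalar` is the inverse of the leading coefficient obtained by straightening |w₀∘x⟩. -/
lemma bar_ket_sub_mem (hℓ : 0 < ℓ) {x : X} (hx : IsDominant b x) :
    bar b ℓ (ket b ℓ x) - ket b ℓ x ∈ lowSpan b ℓ (shiftedNorm b x) := by
  classical
  have e : inversions b (longest b) = posRoots b := by
    ext k
    rw [mem_inversions, mem_posRoots, and_iff_left_iff_imp]
    exact longest_inv_neg b
  have h := Submodule.smul_mem _ (barScalar b ℓ x) (ket_dot_sub_mem (b := b) hℓ hx (longest b))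
  rw [smul_sub, ← bar_ket, smul_smul] at h
  convert! h
  have hc : wallCount b ℓ x + ((posRoots b).filter fun k =>
      ¬ (ℓ : ℤ) ∣ shiftedPairing b (dot b (longest b) x) k).card = (posRoots b).card := by
    rw [← wallCount_dot b ℓ (longest b) x, wallCount]
    convert! Finset.card_filter_add_card_filter_not _
  rw [length, e, barScalar, mul_mul_mul_comm, ← mul_pow, neg_one_mul, neg_neg, one_pow, one_mul,
    tHalf_mul, ← hc]
  push_cast
  rw [show -((wallCount b ℓ x : ℤ) + ((posRoots b).filter fun k =>
      ¬ (ℓ : ℤ) ∣ shiftedPairing b (dot b (longest b) x) k).card - wallCount b ℓ x) +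
      ((posRoots b).filter fun k =>
      ¬ (ℓ : ℤ) ∣ shiftedPairing b (dot b (longest b) x) k).card = 0 by ring, tHalf_zero,
    one_smul]

variable [Module.Finite ℤ X]

/-- By unitriangularity nothing from other terms reaches a coefficient at the top norm, so there bar
acts by `barKK` alone. -/
lemma barKK_coeff_of_maximal (hℓ : 0 < ℓ) {c : DominantWeight b →₀ KK}
    (hc : bar b ℓ (ketSum b ℓ c) = ketSum b ℓ c) {lam : DominantWeight b}
    (hlam : ∀ mu ∈ c.support, shiftedNorm b (mu : X) ≤ shiftedNorm b (lam : X)) :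
    barKK (c lam) = c lam := by
  have h1 : bar b ℓ (ketSum b ℓ c) =
      ∑ mu ∈ c.support, barKK (c mu) • bar b ℓ (ket b ℓ (mu : X)) := by
    rw [ketSum, Finsupp.linearCombination_apply, Finsupp.sum, map_sum]
    simp only [map_smulₛₗ]
  let d : DominantWeight b →₀ KK := c.mapRange barKK (map_zero _)
  have h2 : ketSum b ℓ d = ∑ mu ∈ c.support, barKK (c mu) • ket b ℓ (mu : X) := by
    rw [ketSum, Finsupp.linearCombination_apply]
    exact Finsupp.sum_of_support_subset _ Finsupp.support_mapRange _ (by simp)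
  have h3 : ketSum b ℓ (c - d) ∈ lowSpan b ℓ (shiftedNorm b (lam : X)) := by
    rw [map_sub, ← hc, h1, h2, ← Finset.sum_sub_distrib]
    refine Submodule.sum_mem _ fun mu hmu => ?_
    rw [← smul_sub]
    refine Submodule.smul_mem _ _ (Submodule.span_mono (Set.image_mono ?_)
      (bar_ket_sub_mem hℓ mu.2))
    exact fun y hy => lt_of_lt_of_le hy (hlam mu hmu)
  obtain ⟨f, hf, h4⟩ := exists_of_mem_lowSpan hℓ h3
  have h5 := h4 lam le_rfl
  rw [← ketSum_injective hℓ hf, Finsupp.sub_apply, sub_eq_zero] at h5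
  exact h5.symm

lemma eq_zero_of_bar_invariant (hℓ : 0 < ℓ) {c : DominantWeight b →₀ KK}
    (hc : bar b ℓ (ketSum b ℓ c) = ketSum b ℓ c) (hp : ∀ mu, IsPositivePoly (c mu)) : c = 0 := by
  by_contra hne
  obtain ⟨lam, hlam, hmax⟩ := Finset.exists_max_image c.support
    (fun mu => shiftedNorm b (mu : X)) (Finsupp.support_nonempty_iff.mpr hne)
  exact Finsupp.mem_support_iff.mp hlam
    ((hp lam).eq_zero_of_barKK (barKK_coeff_of_maximal hℓ hc hmax))

lemma IsKLElement.eq (hℓ : 0 < ℓ) {lam : DominantWeight b} {C C' : Fock b ℓ}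
    (h : IsKLElement b ℓ lam C) (h' : IsKLElement b ℓ lam C') : C = C' := by
  obtain ⟨hb, c, rfl, h1, h2⟩ := h
  obtain ⟨hb', c', rfl, h1', h2'⟩ := h'
  rw [← sub_eq_zero, ← map_sub]
  rw [eq_zero_of_bar_invariant (b := b) hℓ (c := c - c'), map_zero]
  · rw [map_sub, map_sub, hb, hb']
  · intro mu
    rw [Finsupp.sub_apply]
    by_cases hmu : mu = lam
    · rw [hmu, h1, h1', sub_self]
      exact ⟨0, by simp⟩
    · exact (h2 mu hmu).sub (h2' mu hmu)

lemma klElement_eq (hℓ : 0 < ℓ) {lam : DominantWeight b} {C : Fock b ℓ}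
    (h : IsKLElement b ℓ lam C) : klElement b ℓ lam = C :=
  (Classical.epsilon_spec ⟨C, h⟩ : IsKLElement b ℓ lam (klElement b ℓ lam)).eq hℓ h

lemma form_nonneg_of_dominant {x : X} (hx : ∀ i ∈ b.support, 0 ≤ P.coroot' i x) :
    0 ≤ form P x (twoRho b) := by
  rw [twoRho, map_sum]
  refine Finset.sum_nonneg fun j hj => ?_
  have h1 := two_mul_form_root (P := P) j x
  have h2 := mul_nonneg (coroot'_nonneg_of_isPos b hx ((mem_posRoots b).mp hj))
    (form_root_pos (P := P) j).le
  rw [form_comm]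
  omega

lemma shiftedNorm_eq (x : X) : shiftedNorm b x =
    4 * form P x x + 4 * form P x (twoRho b) + shiftedNorm b 0 := by
  have := form_comm (P := P) x (twoRho b)
  simp only [shiftedNorm, map_add, map_nsmul, LinearMap.add_apply, LinearMap.smul_apply, smul_zero,
    zero_add, nsmul_eq_mul]
  rw [← this]
  push_cast
  ring

lemma shiftedNorm_zero_le (mu : DominantWeight b) :
    shiftedNorm b (0 : X) ≤ shiftedNorm b (mu : X) := by
  rw [shiftedNorm_eq (mu : X)]
  have h1 := form_self_nonneg (P := P) (mu : X)
  have h2 := form_nonneg_of_dominant ((isDominant_iff b _).mp mu.2)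
  omega

/-- No dominant weight has smaller shifted norm than 0, so the lower terms of bar |0⟩ are absent. -/
lemma bar_ket_zero (hℓ : 0 < ℓ) : bar b ℓ (ket b ℓ 0) = ket b ℓ 0 := by
  obtain ⟨c, hc, h⟩ := exists_of_mem_lowSpan hℓ (bar_ket_sub_mem hℓ (zeroWeight b).2)
  have h0 : c = 0 := Finsupp.ext fun mu => h mu (shiftedNorm_zero_le mu)
  rw [h0, map_zero] at hc
  exact sub_eq_zero.mp hc

lemma isKLElement_zero (hℓ : 0 < ℓ) : IsKLElement b ℓ (zeroWeight b) (ket b ℓ 0) := by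
  refine ⟨bar_ket_zero hℓ, Finsupp.single (zeroWeight b) 1, ?_, Finsupp.single_eq_same,
    fun mu hmu => ?_⟩
  · rw [ketSum_single, one_smul]
    rfl
  · rw [Finsupp.single_eq_of_ne hmu]
    exact ⟨0, by simp⟩

end BarInvariance

/-! ### Existence, uniqueness and integrality of Weyl characters. -/

section WeylCharacters

variable {ι X Y : Type*} [Fintype ι] [AddCommGroup X] [AddCommGroup Y]
  {P : RootDatum ι X Y} (b : P.Base)

lemma weylNumerator_def (x : X) :
    weylNumerator b x = ∑ w : P.weylGroup, weylDet w • xpow (dot b w x) := rfl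

lemma weylNumerator_dot (w : P.weylGroup) (x : X) :
    weylNumerator b (dot b w x) = weylDet w • weylNumerator b x := by
  rw [weylNumerator_def, weylNumerator_def, Finset.smul_sum]
  refine Fintype.sum_equiv (Equiv.mulRight w) _ _ fun u => ?_
  change _ = weylDet w • weylDet (u * w) • xpow (dot b (u * w) x)
  rw [dot_mul, smul_smul, mul_comm, weylDet_mul, mul_assoc, weylDet_mul_self, mul_one]

/-- In the term of w replace f by wf and use X^{wμ}·X^{w∘0} = X^{w∘μ}. This serves both the
construction of characters and the averaging argument. -/
lemma symFun_mul_weylNumerator_zero {f : KX X} (hf : f ∈ symFun P) :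
    f * weylNumerator b 0 = kxLift (weylNumerator b) f := by
  let g : KX X →ₗ[KK] KX X := ∑ w : P.weylGroup,
    weylDet w • (LinearMap.mulRight KK (xpow (dot b w 0)) ∘ₗ (weylAct w).toLinearMap)
  have h1 : g = kxLift (weylNumerator b) := by
    refine kx_hom_ext fun mu => ?_
    rw [kxLift_xpow, weylNumerator_def, LinearMap.sum_apply]
    refine Finset.sum_congr rfl fun w _ => ?_
    change weylDet w • (weylAct w (xpow mu) * xpow (dot b w 0)) = _
    rw [weylAct_xpow, xpow_mul, add_comm, ← dot_add, zero_add]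
  rw [← h1, LinearMap.sum_apply, weylNumerator_def, Finset.mul_sum]
  refine Finset.sum_congr rfl fun w _ => ?_
  change _ = weylDet w • (weylAct w f * xpow (dot b w 0))
  rw [hf w, mul_smul_comm]

/-- The elements of `𝕂[X]` with integer coefficients. -/
def integralKX (X : Type*) [AddCommGroup X] : AddSubgroup (KX X) where
  carrier := {f | ∀ mu, ∃ n : ℤ, f.coeff mu = n}
  zero_mem' mu := ⟨0, by simp⟩
  add_mem' hf hg mu := by
    obtain ⟨m, hm⟩ := hf mu
    obtain ⟨n, hn⟩ := hg mu
    exact ⟨m + n, by rw [Int.cast_add, ← hm, ← hn]; rfl⟩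
  neg_mem' hf mu := by
    obtain ⟨m, hm⟩ := hf mu
    exact ⟨-m, by rw [Int.cast_neg, ← hm]; rfl⟩

lemma xpow_mem_integralKX (mu : X) : xpow mu ∈ integralKX X := by
  classical
  intro nu
  rw [coeff_xpow]
  split_ifs
  exacts [⟨1, by simp⟩, ⟨0, by simp⟩]

open Classical in
/-- The Weyl group orbit of a weight. -/
def weylOrbit (P : RootDatum ι X Y) (x : X) : Finset X :=
  Finset.univ.image fun w : P.weylGroup => w • x

lemma mem_weylOrbit {x y : X} : y ∈ weylOrbit P x ↔ ∃ w : P.weylGroup, w • x = y := by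
  simp [weylOrbit]

lemma sum_weylOrbit_mem_symFun (x : X) : ∑ y ∈ weylOrbit P x, xpow y ∈ symFun P := by
  intro w
  rw [map_sum]
  simp only [weylAct_xpow]
  refine Finset.sum_bij (fun y _ => w • y) ?_ ?_ ?_ fun _ _ => rfl
  · intro y hy
    obtain ⟨u, rfl⟩ := mem_weylOrbit.mp hy
    exact mem_weylOrbit.mpr ⟨w * u, mul_smul w u x⟩
  · intro y _ z _ h
    exact MulAction.injective w h
  · intro y hy
    obtain ⟨u, rfl⟩ := mem_weylOrbit.mp hy
    exact ⟨(w⁻¹ * u) • x, mem_weylOrbit.mpr ⟨_, rfl⟩, by rw [← mul_smul, mul_inv_cancel_left]⟩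

variable [P.IsReduced]

/-- A maximizer of the product with 2ρ on the orbit is dominant, hence equal to x by
`smul_eq_of_dominant`. -/
lemma form_lt_of_mem_weylOrbit {x y : X} (hx : ∀ i ∈ b.support, 0 ≤ P.coroot' i x)
    (hy : y ∈ weylOrbit P x) (hne : y ≠ x) : form P y (twoRho b) < form P x (twoRho b) := by
  obtain ⟨w, hw⟩ := Finite.exists_max fun w : P.weylGroup => form P (w • x) (twoRho b)
  have key : ∀ u : P.weylGroup, form P (w • x) (twoRho b) ≤ form P (u • x) (twoRho b) →
      u • x = x := by
    intro u hu
    refine smul_eq_of_dominant b u hx fun i hi => dominant_of_form_maximal b (fun v => ?_) hi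
    rw [← mul_smul]
    exact (hw _).trans hu
  obtain ⟨u, rfl⟩ := mem_weylOrbit.mp hy
  rw [key w le_rfl] at hw key
  exact lt_of_not_ge fun h => hne (key u h)

variable [Module.Finite ℤ X]

lemma weylNumerator_eq_zero {x : X} {i : ι} (h : shiftedPairing b x i = 0) :
    weylNumerator b x = 0 := by
  have h1 := weylNumerator_dot b (ofIdx P i) x
  rw [dot_ofIdx_eq_sub, h, zero_smul, sub_zero, weylDet_ofIdx, neg_one_smul] at h1
  exact two_smul_eq_zero (by nth_rewrite 2 [h1]; exact add_neg_cancel _)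

lemma weylNumerator_zero_ne_zero : weylNumerator b 0 ≠ 0 := by
  classical
  intro h
  have h1 := congrArg (specCoeff (0 : X)) h
  rw [weylNumerator_def, map_sum, map_zero, Finset.sum_eq_single 1] at h1
  · rw [map_zsmul, dot_one, specCoeff_xpow, if_pos rfl, weylDet_one] at h1
    norm_num at h1
  · intro w _ hw
    rw [map_zsmul, specCoeff_xpow, if_neg, smul_zero]
    intro h0
    exact hw ((zeroWeight b).2.eq_one b (by
      change ∀ i ∈ b.support, 0 ≤ shiftedPairing b (dot b w 0) i
      rw [h0]
      exact fun i hi => ((zeroWeight b).2 i hi).le))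
  · simp

/-- For dominant y the orbit sum times a_0 is ∑ a_z over z ∈ W₀y; the characters of the z ≠ y come
from induction and are subtracted. Integrality is carried along because bar is only semilinear. -/
theorem exists_weylCharacter (x : X) :
    ∃ s : symFun P, IsWeylCharacter b x s ∧ (s : KX X) ∈ integralKX X := by
  classical
  suffices h : ∀ (n : ℕ) (x : X), shiftedNorm b x < n →
      ∃ s : symFun P, IsWeylCharacter b x s ∧ (s : KX X) ∈ integralKX X from
    h (shiftedNorm b x + 1).toNat x (by have := shiftedNorm_nonneg b x; omega)
  intro n
  induction n with
  | zero => intro x hx; have := shiftedNorm_nonneg b x; omega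
  | succ n ih =>
    intro x hx
    obtain ⟨u, hu⟩ := exists_dot_dominant b x
    set y := dot b u x with hy
    have hxy : weylNumerator b x = weylDet u • weylNumerator b y := by
      rw [hy, weylNumerator_dot, smul_smul, weylDet_mul_self, one_smul]
    have hN : shiftedNorm b y = shiftedNorm b x := shiftedNorm_dot b u x
    suffices hs : ∃ s : symFun P, IsWeylCharacter b y s ∧ (s : KX X) ∈ integralKX X by
      obtain ⟨s, h1, h2⟩ := hs
      refine ⟨weylDet u • s, ?_, AddSubgroup.zsmul_mem _ h2 _⟩
      rw [IsWeylCharacter] at h1 ⊢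
      rw [hxy, ← h1]
      exact smul_mul_assoc _ _ _
    by_cases hdom : IsDominant b y
    · have hdom' := (isDominant_iff b y).mp hdom
      have hlow : ∀ z : (weylOrbit P y).erase y, ∃ s : symFun P,
          IsWeylCharacter b (z : X) s ∧ (s : KX X) ∈ integralKX X := by
        rintro ⟨z, hz⟩
        rw [Finset.mem_erase] at hz
        apply ih
        -- All z in the orbit have (z, z) = (y, y), so the ρ-shifted norm is compared through the
        -- product with 2ρ.
        have h1 := form_lt_of_mem_weylOrbit b hdom' hz.2 hz.1
        have h2 : form P z z = form P y y := by
          obtain ⟨w, rfl⟩ := mem_weylOrbit.mp hz.2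
          exact form_smul w y y
        have h3 := shiftedNorm_eq (b := b) z
        have h4 := shiftedNorm_eq (b := b) y
        push_cast at hx
        change shiftedNorm b z < _
        omega
      choose s hs1 hs2 using hlow
      have hy : y ∈ weylOrbit P y := mem_weylOrbit.mpr ⟨1, one_smul _ y⟩
      refine ⟨⟨∑ z ∈ weylOrbit P y, xpow z, sum_weylOrbit_mem_symFun y⟩ - ∑ z, s z, ?_, ?_⟩
      · rw [IsWeylCharacter, AddSubgroupClass.coe_sub, AddSubmonoidClass.coe_finsetSum, sub_mul,
          symFun_mul_weylNumerator_zero b (sum_weylOrbit_mem_symFun y), map_sum, Finset.sum_mul]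
        simp only [kxLift_xpow]
        rw [← Finset.add_sum_erase _ _ hy, ← Finset.sum_coe_sort, add_sub_assoc, add_eq_left,
          sub_eq_zero]
        exact Finset.sum_congr rfl fun z _ => (hs1 z).symm
      · rw [AddSubgroupClass.coe_sub, AddSubmonoidClass.coe_finsetSum]
        exact sub_mem (sum_mem fun z _ => xpow_mem_integralKX z) (sum_mem fun z _ => hs2 z)
    · rw [IsDominant] at hdom
      push Not at hdom
      obtain ⟨i, hi, hle⟩ := hdom
      refine ⟨0, ?_, zero_mem _⟩
      rw [IsWeylCharacter, weylNumerator_eq_zero b (le_antisymm hle (hu i hi))]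
      exact zero_mul _

lemma IsWeylCharacter.eq {x : X} {s s' : symFun P} (h : IsWeylCharacter b x s)
    (h' : IsWeylCharacter b x s') : s = s' := by
  have := isDomain_kx P
  exact Subtype.ext (mul_right_cancel₀ (weylNumerator_zero_ne_zero b) (h.trans h'.symm))

lemma isWeylCharacter_weylCharacter (x : X) : IsWeylCharacter b x (weylCharacter b x) :=
  Classical.epsilon_spec ((exists_weylCharacter b x).imp fun _ h => h.1)

lemma weylCharacter_mem_integralKX (x : X) : (weylCharacter b x : KX X) ∈ integralKX X := by
  obtain ⟨s, h1, h2⟩ := exists_weylCharacter b x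
  rwa [(isWeylCharacter_weylCharacter b x).eq b h1]

end WeylCharacters

/-! ### Division by integers in t^{1/2}ℤ[t^{1/2}]. -/

section PositivePolynomials

/-- The additive group `t^{1/2} ℤ[t^{1/2}]`. -/
def positivePoly : AddSubgroup KK where
  carrier := {p | IsPositivePoly p}
  zero_mem' := ⟨0, by simp⟩
  add_mem' := by
    rintro _ _ ⟨p, rfl⟩ ⟨q, rfl⟩
    exact ⟨p + q, by rw [map_add, mul_add]⟩
  neg_mem' := by
    rintro _ ⟨p, rfl⟩
    exact ⟨-p, by rw [map_neg, mul_neg]⟩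

lemma mem_positivePoly_of_coeff {p : KK} (h : ∀ n ≤ 0, p.coeff n = 0) : p ∈ positivePoly := by
  have e : p = ∑ n ∈ p.coeff.support, (AddMonoidAlgebra.single n (p.coeff n) : KK) := by
    apply AddMonoidAlgebra.coeff_injective
    rw [AddMonoidAlgebra.coeff_sum]
    exact p.coeff.sum_single.symm
  rw [e]
  refine sum_mem fun n hn => ?_
  have hpos : 0 < n := by
    by_contra! hle
    exact Finsupp.mem_support_iff.mp hn (h n hle)
  obtain ⟨m, rfl⟩ : ∃ m : ℕ, n = m + 1 := ⟨(n - 1).toNat, by omega⟩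
  refine ⟨Polynomial.C (p.coeff (m + 1)) * Polynomial.X ^ m, ?_⟩
  rw [Polynomial.toLaurent_C_mul_X_pow, mul_left_comm]
  change _ = LaurentPolynomial.C _ * (tHalf 1 * tHalf m)
  rw [tHalf_mul, LaurentPolynomial.single_eq_C_mul_T, add_comm (1 : ℤ)]
  rfl

/-- Membership means vanishing of the integer coefficients in degrees ≤ 0; this is what permits
cancelling |W₀|. -/
lemma mem_positivePoly_of_zsmul {n : ℤ} (hn : n ≠ 0) {p : KK} (h : n • p ∈ positivePoly) :
    p ∈ positivePoly := by
  refine mem_positivePoly_of_coeff fun m hm => ?_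
  have h1 : n • p.coeff m = 0 := IsPositivePoly.coeff_eq_zero h hm
  exact (smul_eq_zero.mp h1).resolve_left hn

end PositivePolynomials

/-! ### Weyl characters acting on |0⟩. -/

section Action

variable {ι X Y : Type*} [Fintype ι] [AddCommGroup X] [AddCommGroup Y]
  {P : RootDatum ι X Y} {b : P.Base} {ℓ : ℕ} [P.IsReduced]

lemma symAct_ket (f : symFun P) (x : X) : symAct b ℓ f (ket b ℓ x) =
    ∑ mu ∈ (f : KX X).coeff.support, (f : KX X).coeff mu • ket b ℓ (x + (ℓ : ℤ) • star b mu) := by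
  change (relations b ℓ).mkQ (actFree b ℓ (f : KX X) (fket x)) = _
  rw [actFree_apply, map_sum]
  refine Finset.sum_congr rfl fun mu _ => ?_
  rw [map_smul, shift_fket, add_comm, natCast_zsmul, ket]

lemma star_longest_smul (mu : X) : star b (longest b • mu) = longest b • star b mu := by
  rw [star, star, smul_neg]

lemma longest_mul_self : longest b * longest b = 1 := by
  rw [← inv_eq_one]
  by_contra hne
  obtain ⟨i, hi, h⟩ := exists_descent b hne
  rw [inv_inv, mul_smul, ← isPos_neg, ← smul_negIdx] at h
  refine longest_neg b ?_ h
  rw [isPos_neg]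
  exact longest_neg b (RootPairing.Base.isPos_of_mem_support hi)

lemma star_star (mu : X) : star b (star b mu) = mu := by
  rw [star, star, smul_neg, neg_neg, ← mul_smul, longest_mul_self, one_smul]

lemma barKK_intCast (n : ℤ) : barKK n = n := map_intCast barKK n

/-- Bar turns the translate by ℓμ* into the one by ℓw₀μ*, which only reindexes the W₀-invariant f;
N_x is unchanged by ℓX, and `barKK` fixes integers. -/
lemma bar_symAct_ket {f : symFun P} (hf : (f : KX X) ∈ integralKX X) (x : X) :
    bar b ℓ (symAct b ℓ f (ket b ℓ x)) = symAct b ℓ f (bar b ℓ (ket b ℓ x)) := by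
  have h : ∀ mu : X, (f : KX X).coeff (longest b • mu) = (f : KX X).coeff mu :=
    fun mu => coeff_of_mem_symFun f.2 _ mu
  rw [bar_ket, map_smul, symAct_ket, symAct_ket, map_sum, Finset.smul_sum]
  refine Finset.sum_bij (fun mu _ => longest b • mu) ?_ ?_ ?_ ?_
  · intro mu hmu
    rw [Finsupp.mem_support_iff] at hmu ⊢
    rwa [h]
  · intro mu _ nu _ he
    exact MulAction.injective _ he
  · intro mu hmu
    rw [Finsupp.mem_support_iff] at hmu
    refine ⟨longest b • mu, ?_, by rw [← mul_smul, longest_mul_self, one_smul]⟩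
    rwa [Finsupp.mem_support_iff, h]
  · intro mu _
    obtain ⟨n, hn⟩ := hf mu
    rw [h, hn, map_smulₛₗ, barKK_intCast, bar_ket, dot_add_zsmul, star_longest_smul, smul_comm]
    congr 1
    rw [barScalar, barScalar, wallCount_add]

variable (b ℓ) in
/-- The `t^{1/2} ℤ[t^{1/2}]`-combinations of the `|μ⟩` with `μ` dominant. -/
def positiveLattice : AddSubgroup (Fock b ℓ) where
  carrier := {v | ∃ c, v = ketSum b ℓ c ∧ ∀ mu, IsPositivePoly (c mu)}
  zero_mem' := ⟨0, by simp, fun _ => ⟨0, by simp⟩⟩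
  add_mem' := by
    rintro _ _ ⟨c, rfl, h1⟩ ⟨d, rfl, h2⟩
    exact ⟨c + d, (map_add _ _ _).symm, fun mu => positivePoly.add_mem (h1 mu) (h2 mu)⟩
  neg_mem' := by
    rintro _ ⟨c, rfl, h1⟩
    exact ⟨-c, (map_neg _ _).symm, fun mu => positivePoly.neg_mem (h1 mu)⟩

lemma tHalf_smul_ket_mem (hℓ : 0 < ℓ) (x : X) : tHalf 1 • ket b ℓ x ∈ positiveLattice b ℓ := by
  obtain ⟨c, hc, h, -⟩ := ket_mem_straight (b := b) hℓ x
  exact ⟨tHalf 1 • c, by rw [hc, map_smul], fun mu => isPositivePoly_iff.mpr ⟨c mu, h mu, rfl⟩⟩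

/-- Two of the four coefficients in a generic relation are 1, the others t^{1/2}; the relation is
chosen so that the former sit at ℓ(sᵢ∘ν) and ℓν. -/
lemma ket_smul_dot_ofIdx_add_mem (hℓ : 0 < ℓ) {i : ι} (hi : i ∈ b.support) (nu : X) :
    ket b ℓ ((ℓ : ℤ) • dot b (ofIdx P i) nu) + ket b ℓ ((ℓ : ℤ) • nu) ∈
      positiveLattice b ℓ := by
  have hsp : shiftedPairing b ((ℓ : ℤ) • nu) i = ℓ * (shiftedPairing b nu i - 1) + 1 := by
    rw [shiftedPairing, shiftedPairing, rhoPairing_simple b hi, map_smul, smul_eq_mul]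
    ring
  set m := shiftedPairing b nu i with hm
  -- The pairing of x + ρ is mℓ + (ℓ - 1), so j = ℓ - 1 and x - jαᵢ = ℓν. For ℓ = 1 this j is 0 and
  -- the multiple relation takes over.
  set x : X := (ℓ : ℤ) • nu + ((ℓ : ℤ) - 1) • P.root i with hx
  have hxi : shiftedPairing b x i = m * ℓ + (ℓ - 1) := by
    rw [hx, shiftedPairing_add, hsp, map_smul, coroot'_root, smul_eq_mul]
    ring
  have e1 : dot b (ofIdx P i) x = (ℓ : ℤ) • dot b (ofIdx P i) nu := by
    rw [dot_ofIdx b hi, hxi, hx, dot_ofIdx b hi, ← hm]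
    module
  have e2 : x - ((ℓ : ℤ) - 1) • P.root i = (ℓ : ℤ) • nu := by rw [hx, add_sub_cancel_right]
  rcases (show 1 ≤ ℓ from hℓ).eq_or_lt with h1 | h1
  · have e3 : x = (ℓ : ℤ) • nu := by rw [← e2, ← h1]; simp
    have := ket_multiple b ℓ hi (x := x) (by rw [← h1]; simp)
    rw [e1, e3] at this
    rw [this]
    exact zero_mem _
  · have := ket_generic b ℓ hi (x := x) m ((ℓ : ℤ) - 1) (by omega) (by omega) hxi
    rw [e1, e2] at this
    have e3 : ket b ℓ ((ℓ : ℤ) • dot b (ofIdx P i) nu) + ket b ℓ ((ℓ : ℤ) • nu) =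
        -(tHalf 1 • ket b ℓ (dot b (ofIdx P i) ((ℓ : ℤ) • nu)) + tHalf 1 • ket b ℓ x) := by
      rw [← sub_eq_zero, ← this]
      abel
    rw [e3]
    exact neg_mem (add_mem (tHalf_smul_ket_mem hℓ _) (tHalf_smul_ket_mem hℓ _))

lemma star_dot_ofIdx {i : ι} (hi : i ∈ b.support) (mu : X) :
    star b (dot b (ofIdx P i) mu) = dot b (ofIdx P (negIdx P (longest b • i))) (star b mu) := by
  have hi' := longest_simple b hi
  have e : shiftedPairing b (star b mu) (negIdx P (longest b • i)) = shiftedPairing b mu i := by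
    rw [shiftedPairing, shiftedPairing, rhoPairing_simple b hi, rhoPairing_simple b hi', star,
      coroot'_neg, map_neg, pairing_smul, neg_neg]
  rw [dot_ofIdx b hi, dot_ofIdx b hi', e, root_neg, root_smul, star, star, smul_sub,
    smul_comm (longest b), smul_neg, sub_neg_eq_add, neg_sub, sub_eq_neg_add]

variable [Module.Finite ℤ X]

lemma ket_star_dot_sub_mem (hℓ : 0 < ℓ) (w : P.weylGroup) (mu : X) :
    weylDet w • ket b ℓ ((ℓ : ℤ) • star b (dot b w mu)) - ket b ℓ ((ℓ : ℤ) • star b mu) ∈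
      positiveLattice b ℓ := by
  refine weyl_induction b (p := fun w : P.weylGroup =>
    weylDet w • ket b ℓ ((ℓ : ℤ) • star b (dot b w mu)) - ket b ℓ ((ℓ : ℤ) • star b mu) ∈ positiveLattice b ℓ) ?_ ?_ w
  · rw [weylDet_one, dot_one, one_smul, sub_self]
    exact zero_mem _
  · intro i hi u _ ih
    have h1 := ket_smul_dot_ofIdx_add_mem hℓ (longest_simple b hi) (star b (dot b u mu))
    rw [← star_dot_ofIdx hi] at h1
    rw [dot_mul, weylDet_mul, weylDet_ofIdx]
    convert! sub_mem ih (AddSubgroup.zsmul_mem _ h1 (weylDet u)) using 1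
    module

variable (b ℓ) in
/-- The linear map `X^μ ↦ |ℓ μ*⟩`. -/
def starKet : KX X →ₗ[KK] Fock b ℓ := kxLift fun mu => ket b ℓ ((ℓ : ℤ) • star b mu)

lemma symAct_ket_zero (f : symFun P) : symAct b ℓ f (ket b ℓ 0) = starKet b ℓ (f : KX X) := by
  rw [symAct_ket, starKet, kxLift_apply]
  simp only [zero_add]

lemma starKet_weylNumerator_sub_mem (hℓ : 0 < ℓ) (mu : X) :
    starKet b ℓ (weylNumerator b mu) -
      (Fintype.card P.weylGroup : ℤ) • ket b ℓ ((ℓ : ℤ) • star b mu) ∈ positiveLattice b ℓ := by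
  have h : ∑ w : P.weylGroup, (weylDet w • ket b ℓ ((ℓ : ℤ) • star b (dot b w mu)) -
      ket b ℓ ((ℓ : ℤ) • star b mu)) ∈ positiveLattice b ℓ :=
    sum_mem fun w _ => ket_star_dot_sub_mem hℓ w mu
  rw [Finset.sum_sub_distrib, Finset.sum_const, Finset.card_univ, ← natCast_zsmul] at h
  convert! h using 2
  rw [weylNumerator_def, map_sum]
  refine Finset.sum_congr rfl fun w _ => ?_
  rw [map_zsmul, starKet, kxLift_xpow]

/-- The image of a_λ is computed twice modulo the lattice: directly it is |W₀|·|ℓλ*⟩, and through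
a_λ = s_λ a_0 = ∑ n_μ a_μ, with integers n_μ, it is |W₀| times the image of s_λ. -/
lemma starKet_weylCharacter_sub_mem (hℓ : 0 < ℓ) (lam : X) :
    (Fintype.card P.weylGroup : ℤ) • (starKet b ℓ (weylCharacter b lam : KX X) -
      ket b ℓ ((ℓ : ℤ) • star b lam)) ∈ positiveLattice b ℓ := by
  set s := weylCharacter b lam
  have h1 := starKet_weylNumerator_sub_mem (b := b) hℓ lam
  have h2 : starKet b ℓ (weylNumerator b lam) -
      (Fintype.card P.weylGroup : ℤ) • starKet b ℓ (s : KX X) ∈ positiveLattice b ℓ := by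
    rw [← (isWeylCharacter_weylCharacter b lam : _ = _), symFun_mul_weylNumerator_zero b s.2,
      kxLift_apply, map_sum, starKet, kxLift_apply _ (s : KX X), Finset.smul_sum,
      ← Finset.sum_sub_distrib]
    refine sum_mem fun mu _ => ?_
    obtain ⟨n, hn⟩ := weylCharacter_mem_integralKX b lam mu
    have h3 := AddSubgroup.zsmul_mem _ (starKet_weylNumerator_sub_mem (b := b) hℓ mu) n
    rw [← starKet]
    convert! h3 using 1
    rw [hn, map_smul, smul_comm _ (n : KK), ← smul_sub, Int.cast_smul_eq_zsmul]
  convert! sub_mem h1 h2 using 1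
  module

theorem isKLElement_symAct (hℓ : 0 < ℓ) (lam : DominantWeight b) :
    IsKLElement b ℓ (scaleWeight b ℓ lam)
      (symAct b ℓ (weylCharacter b (star b (lam : X))) (ket b ℓ 0)) := by
  classical
  set v := symAct b ℓ (weylCharacter b (star b (lam : X))) (ket b ℓ 0) with hv
  have hbar : bar b ℓ v = v := by
    rw [hv, bar_symAct_ket (weylCharacter_mem_integralKX b _), bar_ket_zero hℓ]
  obtain ⟨c, hc⟩ := ketSum_surjective (b := b) hℓ v
  set lam' := scaleWeight b ℓ lam with hlam'
  have hpos : ∀ mu, (c - Finsupp.single lam' 1 : DominantWeight b →₀ KK) mu ∈ positivePoly := by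
    obtain ⟨d, hd, hdp⟩ := starKet_weylCharacter_sub_mem (b := b) hℓ (star b (lam : X))
    rw [← symAct_ket_zero, star_star, ← hv, ← hc] at hd
    have e : ket b ℓ ((ℓ : ℤ) • (lam : X)) = ketSum b ℓ (Finsupp.single lam' 1) := by
      rw [ketSum_single, one_smul, natCast_zsmul]
      rfl
    rw [e, ← map_sub, ← map_zsmul] at hd
    intro mu
    apply mem_positivePoly_of_zsmul (n := (Fintype.card P.weylGroup : ℤ))
      (by exact_mod_cast Fintype.card_ne_zero)
    have := hdp mu
    rw [← ketSum_injective hℓ hd] at this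
    exact this
  have hne : ∀ mu, mu ≠ lam' → IsPositivePoly (c mu) := by
    intro mu hmu
    have := hpos mu
    rwa [Finsupp.sub_apply, Finsupp.single_eq_of_ne hmu, sub_zero] at this
  refine ⟨hbar, c, hc.symm, ?_, hne⟩
  rw [← hc] at hbar
  -- A norm-maximal weight in the support has a self-dual coefficient; away from ℓλ it would lie in
  -- t^{1/2}ℤ[t^{1/2}] and vanish, so the weight is ℓλ. Thus c(ℓλ) - 1 is self-dual and in
  -- t^{1/2}ℤ[t^{1/2}], hence zero.
  have hfix : barKK (c lam') = c lam' := by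
    by_cases h0 : c = 0
    · rw [h0, Finsupp.zero_apply, map_zero]
    obtain ⟨mu, hmu, hmax⟩ := Finset.exists_max_image c.support
      (fun mu => shiftedNorm b (mu : X)) (Finsupp.support_nonempty_iff.mpr h0)
    have h1 := barKK_coeff_of_maximal hℓ hbar hmax
    by_cases he : mu = lam'
    · rwa [he] at h1
    · exact absurd ((hne mu he).eq_zero_of_barKK h1) (Finsupp.mem_support_iff.mp hmu)
  have h1 : IsPositivePoly (c lam' - 1) := by
    have := hpos lam'
    rwa [Finsupp.sub_apply, Finsupp.single_eq_same] at this
  exact sub_eq_zero.mp (h1.eq_zero_of_barKK (by rw [map_sub, hfix, map_one]))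

end Action

end FockSpace

end

/-! ### Assembly of the main theorem. -/

theorem mainTheorem5 {ι X Y : Type*} [Fintype ι] [AddCommGroup X] [AddCommGroup Y]
    [Module.Finite ℤ X] [Module.Finite ℤ Y] (P : RootDatum ι X Y) [P.IsReduced] (b : P.Base)
    (ℓ : ℕ) (hℓ : 0 < ℓ) :
    -- the kets of dominant weights are a basis of the Fock space
    Function.Bijective (FockSpace.ketSum b ℓ) ∧
    -- the Weyl characters exist and are unique
    (∀ lam : FockSpace.DominantWeight b,
      ∃! s : FockSpace.symFun P, FockSpace.IsWeylCharacter b (lam : X) s) ∧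
    -- the elements `C_{ℓλ}` exist and are unique
    (∀ lam : FockSpace.DominantWeight b,
      ∃! C : FockSpace.Fock b ℓ,
        FockSpace.IsKLElement b ℓ (FockSpace.scaleWeight b ℓ lam) C) ∧
    -- `C_0 = |0⟩`
    FockSpace.klElement b ℓ (FockSpace.zeroWeight b) = FockSpace.ket b ℓ 0 ∧
    -- `C_{ℓλ} = s_{λ*} · C_0 = s_{λ*} · |0⟩`
    (∀ lam : FockSpace.DominantWeight b,
      FockSpace.klElement b ℓ (FockSpace.scaleWeight b ℓ lam) =
        FockSpace.symAct b ℓ (FockSpace.weylCharacter b (FockSpace.star b (lam : X)))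
          (FockSpace.klElement b ℓ (FockSpace.zeroWeight b)) ∧
      FockSpace.klElement b ℓ (FockSpace.scaleWeight b ℓ lam) =
        FockSpace.symAct b ℓ (FockSpace.weylCharacter b (FockSpace.star b (lam : X)))
          (FockSpace.ket b ℓ 0)) ∧
    -- `p_{ℓλ,μ} = Q^λ_{μ,0}`
    (∀ lam mu : FockSpace.DominantWeight b,
      FockSpace.klCoeff b ℓ (FockSpace.scaleWeight b ℓ lam) mu =
        FockSpace.qCoeff b ℓ lam mu (FockSpace.zeroWeight b)) ∧
    -- the two LLT polynomials agree up to a power of `t`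
    (∀ (l : X → ℕ) (J : Finset ι) (eta bet gam : X) (v w : FockSpace.AffWeyl P)
      (mu : FockSpace.DominantWeight b),
      FockSpace.IsGHDatum b ℓ J eta bet v mu →
      FockSpace.IsGHDatum b ℓ J eta gam w (FockSpace.zeroWeight b) →
      FockSpace.ghLLT b ℓ l bet gam v w mu (FockSpace.zeroWeight b) =
        FockSpace.tHalf (2 * ((l (bet - gam) : ℤ) + FockSpace.affLength b w
          - FockSpace.affLength b v)) • FockSpace.lecouveyLLT b ℓ mu) := by
  have hzero := FockSpace.klElement_eq hℓ (FockSpace.isKLElement_zero (b := b) hℓ)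
  have hkl : ∀ lam : FockSpace.DominantWeight b,
      FockSpace.klElement b ℓ (FockSpace.scaleWeight b ℓ lam) =
        FockSpace.symAct b ℓ (FockSpace.weylCharacter b (FockSpace.star b (lam : X)))
          (FockSpace.ket b ℓ 0) :=
    fun lam => FockSpace.klElement_eq hℓ (FockSpace.isKLElement_symAct hℓ lam)
  have hcoeff : ∀ lam mu : FockSpace.DominantWeight b,
      FockSpace.klCoeff b ℓ (FockSpace.scaleWeight b ℓ lam) mu =
        FockSpace.qCoeff b ℓ lam mu (FockSpace.zeroWeight b) := by
    intro lam mu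
    rw [FockSpace.klCoeff, hkl]
    rfl
  refine ⟨⟨FockSpace.ketSum_injective hℓ, FockSpace.ketSum_surjective hℓ⟩,
    fun lam => ⟨_, FockSpace.isWeylCharacter_weylCharacter b (lam : X),
      fun s hs => hs.eq b (FockSpace.isWeylCharacter_weylCharacter b (lam : X))⟩,
    fun lam => ⟨_, FockSpace.isKLElement_symAct hℓ lam,
      fun C hC => hC.eq hℓ (FockSpace.isKLElement_symAct hℓ lam)⟩,
    hzero, fun lam => ⟨by rw [hzero]; exact hkl lam, hkl lam⟩, hcoeff, ?_⟩
  intro l J eta bet gam v w mu _ _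
  -- The same power of t stands on both sides, so the coefficient families are compared weight by
  -- weight.
  rw [FockSpace.ghLLT]
  congr 1
  funext lam
  exact (hcoeff lam mu).symm
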